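/- Let $n\ge 4$ be an even integer, let $u\in C^\infty(\mathbb{R}^n)$ be real-valued, and consider the conformal metric $g=e^{2u}|dx|^2$ on $\mathbb{R}^n$ (not assumed complete). Let $R_g$ be its scalar curvature and let $Q$ be its Q-curvature, that is, the function determined by $(-\Delta)^{n/2}u=Qe^{nu}$ on $\mathbb{R}^n$, where $\Delta$ is the Euclidean Laplacian. Let $|\mathbb{S}^n|$ denote the volume of the unit sphere $\mathbb{S}^n\subset\mathbb{R}^{n+1}$. Assume that $g$ has finite total Q-curvature, i.e. $Qe^{nu}\in L^1(\mathbb{R}^n)$, and that there are a constant $C$ and a compact set $K\subset\mathbb{R}^n$ such that $0\le R_g\le C$ on $\mathbb{R}^n\setminus K$. Then: 1. Either $$0\le\int_{\mathbb{R}^n}Qe^{nu}\,dx\le\frac{(n-1)!\,|\mathbb{S}^n|}{2}\qquad\text{or}\qquad\int_{\mathbb{R}^n}Qe^{nu}\,dx=(n-1)!\,|\mathbb{S}^n|.$$ 2. If in addition the volume of $g$ is finite, i.e. $e^{nu}\in L^1(\mathbb{R}^n)$, then $$\int_{\mathbb{R}^n}Qe^{nu}\,dx=(n-1)!\,|\mathbb{S}^n|.$$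 -/

import Mathlib

open MeasureTheory
open scoped ContDiff

noncomputable section

namespace ConformalQ

/-- Euclidean space `ℝⁿ`. -/
abbrev E (n : ℕ) : Type := EuclideanSpace ℝ (Fin n)

/-- The partial derivative `∂ᵢ f` at `x` in the standard coordinates of `ℝⁿ`. -/
def partialDeriv {n : ℕ} (i : Fin n) (f : E n → ℝ) (x : E n) : ℝ :=
  fderiv ℝ f x (EuclideanSpace.single i 1)

/-- The Christoffel symbol `Γᵏᵢⱼ = ½ ∑ₗ gᵏˡ (∂ᵢ gⱼₗ + ∂ⱼ gᵢₗ - ∂ₗ gᵢⱼ)` of a metric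
`g = (gᵢⱼ)` on `ℝⁿ`, given by its components in the standard coordinates. -/
def christoffel {n : ℕ} (g : E n → Matrix (Fin n) (Fin n) ℝ) (k i j : Fin n) (x : E n) : ℝ :=
  (1 / 2 : ℝ) * ∑ l, (g x)⁻¹ k l *
    (partialDeriv i (fun y => g y j l) x + partialDeriv j (fun y => g y i l) x
      - partialDeriv l (fun y => g y i j) x)

/-- The Ricci curvature
`Ricᵢⱼ = ∑ₖ (∂ₖ Γᵏᵢⱼ - ∂ⱼ Γᵏᵢₖ) + ∑ₖ ∑ₗ (Γᵏₖₗ Γˡᵢⱼ - Γᵏⱼₗ Γˡᵢₖ)` of a metric on `ℝⁿ`. -/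
def ricci {n : ℕ} (g : E n → Matrix (Fin n) (Fin n) ℝ) (i j : Fin n) (x : E n) : ℝ :=
  ∑ k, (partialDeriv k (christoffel g k i j) x - partialDeriv j (christoffel g k i k) x)
    + ∑ k, ∑ l, (christoffel g k k l x * christoffel g l i j x
        - christoffel g k j l x * christoffel g l i k x)

/-- The scalar curvature `R = ∑ᵢⱼ gⁱʲ Ricᵢⱼ` of a metric on `ℝⁿ`. -/
def scalarCurvature {n : ℕ} (g : E n → Matrix (Fin n) (Fin n) ℝ) (x : E n) : ℝ :=
  ∑ i, ∑ j, (g x)⁻¹ i j * ricci g i j x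

/-- The conformal metric `e^{2u} |dx|²` on `ℝⁿ`. -/
def conformalMetric {n : ℕ} (u : E n → ℝ) (x : E n) : Matrix (Fin n) (Fin n) ℝ :=
  Real.exp (2 * u x) • (1 : Matrix (Fin n) (Fin n) ℝ)

/-- The iterated operator `(-Δ)ᵐ` on functions on `ℝⁿ`. -/
def negLaplacianPow {n : ℕ} (m : ℕ) (u : E n → ℝ) : E n → ℝ :=
  (fun f : E n → ℝ => -Laplacian.laplacian f)^[m] u

/-- The Q-curvature of the metric `e^{2u} |dx|²` on `ℝⁿ`, `n` even: the unique function `Q` with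
`(-Δ)^{n/2} u = Q e^{nu}`. -/
def qCurvature {n : ℕ} (u : E n → ℝ) (x : E n) : ℝ :=
  Real.exp (-(n * u x)) * negLaplacianPow (n / 2) u x

/-- The volume `|𝕊ⁿ|` of the standard unit sphere in `ℝⁿ⁺¹`. -/
def sphereVolume (n : ℕ) : ℝ :=
  (volume : Measure (E (n + 1))).toSphere.real Set.univ

end ConformalQ

end

namespace ConformalQ

/-! Write `γ = critConst n` for half of (n-1)!|𝕊ⁿ|, `f = Q e^{nu} / γ` and `α = ∫ f`. The claim
becomes: `α` lies in [0,1] or equals 2, and finite volume forces `α = 2`.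

The metric is normal. In terms of `u`, R_g e^{2u} is 2(n-1) times `scalarDensity u`, that is -Δu -
(n-2)/2 |∇u|². Since n ≥ 4, nonnegative R_g near infinity gives |∇u|² ≤ -Δu there. A Caccioppoli
estimate then shows that |∇u| has average O(1/R) on balls of radius R (`integral_norm_gradient_le`).
Testing against a truncated logarithm, this decay removes any polyharmonic remainder, and ∇u is the
Riesz potential of `f` (`critConst_mul_partialDeriv`), so `u` behaves like -α log|x|.

Blow-down. The rescalings R∇u(Rx) converge in L² on a compact set `B` in an annulus to -αx/|x|².
Hence R² `scalarDensity u`(Rx) converges weakly to (n-2)(α - α²/2)/|x|²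
(`IsLogPotential.tendsto_energy`). Its sign gives 0 ≤ α ≤ 2.

Quantization. Put I(R) = ∫_B R² e^{2u(Rx)} dx. If 0 < α < 2, the weak limit is positive, and the
upper bound on R_g keeps I(R) away from 0. If α = 0, the same holds by exponential integrability of
`u` (`IsLogPotential.exists_exp_le`). That integrability also makes I(R) tend to 0 when α > 1, so α
in (1,2) is impossible. A lower bound on I(R) bounds the volume of the dilate R·B from below for all
large R, so finite volume leaves only α = 2. -/

/-! ### Partial derivatives and the Laplacian in coordinates. -/

theorem contDiff_partialDeriv {n : ℕ} (i : Fin n) {f : E n → ℝ} (hf : ContDiff ℝ ∞ f) :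
    ContDiff ℝ ∞ (partialDeriv i f) := by
  unfold partialDeriv
  exact (hf.fderiv_right (m := ∞) (by simp)).clm_apply contDiff_const

theorem laplacian_eq_sum {n : ℕ} {f : E n → ℝ} (hf : ContDiff ℝ ∞ f) :
    Laplacian.laplacian f = fun x => ∑ i, partialDeriv i (partialDeriv i f) x := by
  rw [InnerProductSpace.laplacian_eq_iteratedFDeriv_orthonormalBasis f
    (EuclideanSpace.basisFun (Fin n) ℝ)]
  ext x
  refine Finset.sum_congr rfl fun i _ => ?_
  rw [iteratedFDeriv_two_apply]
  unfold partialDeriv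
  have h : DifferentiableAt ℝ (fderiv ℝ f) x :=
    (hf.fderiv_right (m := ∞) (by simp)).differentiable (by simp) x
  rw [fderiv_clm_apply h (differentiableAt_const _)]
  simp

theorem contDiff_laplacian {n : ℕ} {f : E n → ℝ} (hf : ContDiff ℝ ∞ f) :
    ContDiff ℝ ∞ (Laplacian.laplacian f) := by
  rw [laplacian_eq_sum hf]
  exact ContDiff.sum fun i _ => contDiff_partialDeriv i (contDiff_partialDeriv i hf)

/-! ### Scalar curvature of a conformally flat metric. -/

/-- The Kronecker symbol. -/
def kron {n : ℕ} (i j : Fin n) : ℝ := if i = j then 1 else 0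

theorem sum_kron_mul {n : ℕ} (i : Fin n) (f : Fin n → ℝ) : ∑ j, kron i j * f j = f i := by
  simp [kron]

theorem kron_comm {n : ℕ} (i j : Fin n) : kron i j = kron j i := by
  simp [kron, eq_comm]

theorem kron_self {n : ℕ} (i : Fin n) : kron i i = 1 := by simp [kron]

theorem conformalMetric_apply {n : ℕ} (u : E n → ℝ) (x : E n) (i j : Fin n) :
    conformalMetric u x i j = kron i j * Real.exp (2 * u x) := by
  simp [conformalMetric, Matrix.one_apply, kron]

theorem conformalMetric_inv_apply {n : ℕ} (u : E n → ℝ) (x : E n) (i j : Fin n) :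
    (conformalMetric u x)⁻¹ i j = kron i j * Real.exp (-(2 * u x)) := by
  have h : (conformalMetric u x)⁻¹ = Real.exp (-(2 * u x)) • (1 : Matrix (Fin n) (Fin n) ℝ) := by
    apply Matrix.inv_eq_left_inv
    simp [conformalMetric, smul_smul, ← Real.exp_add]
  rw [h]
  simp [Matrix.one_apply, kron]

theorem partialDeriv_conformalMetric {n : ℕ} {u : E n → ℝ} (hu : ContDiff ℝ ∞ u) (x : E n)
    (i j l : Fin n) : partialDeriv i (fun y => conformalMetric u y j l) x
      = kron j l * (2 * partialDeriv i u x) * Real.exp (2 * u x) := by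
  simp only [conformalMetric_apply]
  have hd : DifferentiableAt ℝ u x := hu.differentiable (by simp) x
  have h : HasFDerivAt (fun y => kron j l * Real.exp (2 * u y))
      (kron j l • (Real.exp (2 * u x) • ((2 : ℝ) • fderiv ℝ u x))) x :=
    ((hd.hasFDerivAt.const_mul 2).exp).const_mul _
  unfold partialDeriv
  rw [h.fderiv]
  simp
  ring

theorem christoffel_conformalMetric {n : ℕ} {u : E n → ℝ} (hu : ContDiff ℝ ∞ u)
    (k i j : Fin n) : christoffel (conformalMetric u) k i j = fun x =>
      kron j k * partialDeriv i u x + kron i k * partialDeriv j u x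
        - kron i j * partialDeriv k u x := by
  ext x
  unfold christoffel
  simp only [partialDeriv_conformalMetric hu, conformalMetric_inv_apply]
  have h : ∀ l, kron k l * Real.exp (-(2 * u x)) *
      (kron j l * (2 * partialDeriv i u x) * Real.exp (2 * u x)
        + kron i l * (2 * partialDeriv j u x) * Real.exp (2 * u x)
        - kron i j * (2 * partialDeriv l u x) * Real.exp (2 * u x))
      = kron k l * (2 * (kron j l * partialDeriv i u x + kron i l * partialDeriv j u x
        - kron i j * partialDeriv l u x)) := fun l => by
    rw [Real.exp_neg]
    field_simp
  simp only [h, sum_kron_mul]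
  ring

theorem partialDeriv_christoffel {n : ℕ} {u : E n → ℝ} (hu : ContDiff ℝ ∞ u)
    (l k i j : Fin n) (x : E n) : partialDeriv l (christoffel (conformalMetric u) k i j) x =
      kron j k * partialDeriv l (partialDeriv i u) x + kron i k * partialDeriv l (partialDeriv j u) x
        - kron i j * partialDeriv l (partialDeriv k u) x := by
  rw [christoffel_conformalMetric hu]
  have hd : ∀ a, HasFDerivAt (partialDeriv a u) (fderiv ℝ (partialDeriv a u) x) x := fun a =>
    ((contDiff_partialDeriv a hu).differentiable (by simp) x).hasFDerivAt
  have h := (((hd i).const_mul (kron j k)).add ((hd j).const_mul (kron i k))).sub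
    ((hd k).const_mul (kron i j))
  have h' := DFunLike.congr_fun h.fderiv (EuclideanSpace.single l 1)
  exact h'.trans (by simp [partialDeriv])

theorem kron_mul_kron_self {n : ℕ} (i j : Fin n) : kron i j * kron i j = kron i j := by
  unfold kron; split_ifs <;> simp

/-- The inverse metric is a multiple of the identity, so only the Euclidean trace of Ricci is
needed. The derivatives of the Christoffel symbols contract to the Laplacian term, their products to
the gradient term. -/
theorem sum_ricci_conformalMetric {n : ℕ} {u : E n → ℝ} (hu : ContDiff ℝ ∞ u) (x : E n) :
    ∑ i, ricci (conformalMetric u) i i x = -(2 * ((n : ℝ) - 1) * Laplacian.laplacian u x)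
      - ((n : ℝ) - 1) * ((n : ℝ) - 2) * ∑ i, (partialDeriv i u x) ^ 2 := by
  unfold ricci
  simp only [partialDeriv_christoffel hu]
  simp only [christoffel_conformalMetric hu, laplacian_eq_sum hu]
  set U : Fin n → ℝ := fun i => partialDeriv i u x with hU
  set V : Fin n → Fin n → ℝ := fun i j => partialDeriv i (partialDeriv j u) x with hV
  have h1 : ∀ i k : Fin n, kron i k * V k i + kron i k * V k i - kron i i * V k k
      - (kron k k * V i i + kron i k * V i k - kron i k * V i k)
      = 2 * (kron i k * V k i) - V k k - V i i := fun i k => by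
    rw [kron_self, kron_self]; ring
  -- Squares of Kronecker symbols are reduced first, so that every remaining term can be summed with
  -- `sum_kron_mul`.
  have h2 : ∀ i k l : Fin n, (kron l k * U k + kron k k * U l - kron k l * U k) *
        (kron i l * U i + kron i l * U i - kron i i * U l)
      - (kron l k * U i + kron i k * U l - kron i l * U k) *
        (kron k l * U i + kron i l * U k - kron i k * U l)
      = 2 * (kron i l * (U l * U i)) - U l ^ 2 - kron l k * U i ^ 2
        + kron i k * U l ^ 2 + kron i l * U k ^ 2 - 2 * (kron i k * (kron i l * (U k * U l))) :=
    fun i k l => by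
    rw [kron_self, kron_self, kron_comm k l]
    linear_combination (-U i ^ 2) * kron_mul_kron_self l k + U l ^ 2 * kron_mul_kron_self i k
      + U k ^ 2 * kron_mul_kron_self i l
  have e1 : ∀ i : Fin n, (∑ k, (kron i k * V k i + kron i k * V k i - kron i i * V k k
      - (kron k k * V i i + kron i k * V i k - kron i k * V i k)))
      = 2 * V i i - ∑ k, V k k - n * V i i := fun i => by
    simp only [h1, Finset.sum_sub_distrib, ← Finset.mul_sum, sum_kron_mul]
    simp
  have e2 : ∀ i : Fin n, (∑ k, ∑ l, ((kron l k * U k + kron k k * U l - kron k l * U k) *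
        (kron i l * U i + kron i l * U i - kron i i * U l)
      - (kron l k * U i + kron i k * U l - kron i l * U k) *
        (kron k l * U i + kron i l * U k - kron i k * U l)))
      = (2 * n - 2 - n) * U i ^ 2 + 2 * ∑ k, U k ^ 2 - n * ∑ k, U k ^ 2 := fun i => by
    have e3 : ∀ k : Fin n, ∑ l, kron l k * U i ^ 2 = U i ^ 2 := fun k => by
      simp only [kron_comm _ k]; exact sum_kron_mul k fun _ => U i ^ 2
    simp only [h2, Finset.sum_sub_distrib, Finset.sum_add_distrib, ← Finset.mul_sum,
      sum_kron_mul, e3]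
    simp
    ring
  refine (Finset.sum_congr rfl fun i _ => congrArg₂ (· + ·) (e1 i) (e2 i)).trans ?_
  simp only [Finset.sum_sub_distrib, Finset.sum_add_distrib, ← Finset.mul_sum]
  simp
  ring

theorem scalarCurvature_conformalMetric {n : ℕ} {u : E n → ℝ} (hu : ContDiff ℝ ∞ u) (x : E n) :
    scalarCurvature (conformalMetric u) x * Real.exp (2 * u x)
      = -(2 * ((n : ℝ) - 1) * Laplacian.laplacian u x)
      - ((n : ℝ) - 1) * ((n : ℝ) - 2) * ∑ i, (partialDeriv i u x) ^ 2 := by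
  rw [← sum_ricci_conformalMetric hu]
  unfold scalarCurvature
  simp only [conformalMetric_inv_apply, mul_assoc, sum_kron_mul]
  rw [← Finset.mul_sum, mul_right_comm, ← Real.exp_add]
  simp

/-! ### Gradients, integration by parts and iterated Laplacians. -/

theorem fderiv_apply_eq_inner_gradient {n : ℕ} (f : E n → ℝ) (x v : E n) :
    fderiv ℝ f x v = inner ℝ (gradient f x) v := by
  simp [gradient]

theorem partialDeriv_eq_gradient {n : ℕ} (i : Fin n) (f : E n → ℝ) (x : E n) :
    partialDeriv i f x = gradient f x i := by
  rw [partialDeriv, fderiv_apply_eq_inner_gradient, EuclideanSpace.inner_single_right]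
  simp

theorem sum_partialDeriv_mul {n : ℕ} (f g : E n → ℝ) (x : E n) :
    ∑ i, partialDeriv i f x * partialDeriv i g x = inner ℝ (gradient f x) (gradient g x) := by
  simp only [partialDeriv_eq_gradient, PiLp.inner_apply]
  simp [mul_comm]

theorem sum_partialDeriv_sq {n : ℕ} (f : E n → ℝ) (x : E n) :
    ∑ i, partialDeriv i f x ^ 2 = ‖gradient f x‖ ^ 2 := by
  rw [← real_inner_self_eq_norm_sq, ← sum_partialDeriv_mul]
  simp [sq]

theorem norm_gradient {n : ℕ} (f : E n → ℝ) (x : E n) : ‖gradient f x‖ = ‖fderiv ℝ f x‖ := by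
  simp [gradient]

theorem continuous_gradient {n : ℕ} {f : E n → ℝ} (hf : ContDiff ℝ ∞ f) :
    Continuous (gradient f) :=
  (InnerProductSpace.toDual ℝ (E n)).symm.continuous.comp (hf.continuous_fderiv (by simp))

theorem hasCompactSupport_partialDeriv {n : ℕ} (i : Fin n) {f : E n → ℝ}
    (hf : HasCompactSupport f) : HasCompactSupport (partialDeriv i f) :=
  hf.fderiv_apply ℝ _

theorem integral_mul_partialDeriv {n : ℕ} (i : Fin n) {h g : E n → ℝ} (hh : ContDiff ℝ ∞ h)
    (hc : HasCompactSupport h) (hg : ContDiff ℝ ∞ g) :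
    ∫ x, h x * partialDeriv i g x = -∫ x, partialDeriv i h x * g x := by
  have h1 := (contDiff_partialDeriv i hh).continuous
  have h2 := (contDiff_partialDeriv i hg).continuous
  refine integral_mul_fderiv_eq_neg_fderiv_mul_of_integrable ?_ ?_ ?_
    (fun x _ => hh.differentiable (by simp) x) (fun x _ => hg.differentiable (by simp) x)
  · exact (h1.mul hg.continuous).integrable_of_hasCompactSupport
      ((hasCompactSupport_partialDeriv i hc).mul_right)
  · exact (hh.continuous.mul h2).integrable_of_hasCompactSupport hc.mul_right
  · exact (hh.continuous.mul hg.continuous).integrable_of_hasCompactSupport hc.mul_right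

theorem integral_mul_laplacian_eq_neg_inner {n : ℕ} {h g : E n → ℝ} (hh : ContDiff ℝ ∞ h)
    (hc : HasCompactSupport h) (hg : ContDiff ℝ ∞ g) :
    ∫ x, h x * Laplacian.laplacian g x = -∫ x, inner ℝ (gradient h x) (gradient g x) := by
  simp only [laplacian_eq_sum hg, Finset.mul_sum, ← sum_partialDeriv_mul]
  rw [integral_finsetSum, integral_finsetSum, ← Finset.sum_neg_distrib]
  · exact Finset.sum_congr rfl fun i _ =>
      integral_mul_partialDeriv i hh hc (contDiff_partialDeriv i hg)
  · intro i _
    exact ((contDiff_partialDeriv i hh).continuous.mul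
      (contDiff_partialDeriv i hg).continuous).integrable_of_hasCompactSupport
      ((hasCompactSupport_partialDeriv i hc).mul_right)
  · intro i _
    exact (hh.continuous.mul (contDiff_partialDeriv i
      (contDiff_partialDeriv i hg)).continuous).integrable_of_hasCompactSupport hc.mul_right

theorem hasCompactSupport_laplacian {n : ℕ} {h : E n → ℝ} (hc : HasCompactSupport h) :
    HasCompactSupport (Laplacian.laplacian h) := by
  refine hc.mono' ?_
  intro x hx
  by_contra hx'
  have h0 : h =ᶠ[nhds x] fun _ => 0 := by
    filter_upwards [(isClosed_tsupport h).isOpen_compl.mem_nhds hx'] with y hy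
    exact image_eq_zero_of_notMem_tsupport hy
  apply hx
  rw [(InnerProductSpace.laplacian_congr_nhds h0).eq_of_nhds]
  simp [InnerProductSpace.laplacian_const]

theorem integral_mul_laplacian {n : ℕ} {h g : E n → ℝ} (hh : ContDiff ℝ ∞ h)
    (hc : HasCompactSupport h) (hg : ContDiff ℝ ∞ g) :
    ∫ x, h x * Laplacian.laplacian g x = ∫ x, Laplacian.laplacian h x * g x := by
  simp only [laplacian_eq_sum hg, laplacian_eq_sum hh, Finset.mul_sum, Finset.sum_mul]
  rw [integral_finsetSum, integral_finsetSum]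
  · refine Finset.sum_congr rfl fun i _ => ?_
    rw [integral_mul_partialDeriv i hh hc (contDiff_partialDeriv i hg),
      integral_mul_partialDeriv i (contDiff_partialDeriv i hh)
        (hasCompactSupport_partialDeriv i hc) hg, neg_neg]
  · intro i _
    exact ((contDiff_partialDeriv i (contDiff_partialDeriv i hh)).continuous.mul
      hg.continuous).integrable_of_hasCompactSupport
      ((hasCompactSupport_partialDeriv i (hasCompactSupport_partialDeriv i hc)).mul_right)
  · intro i _
    exact (hh.continuous.mul (contDiff_partialDeriv i
      (contDiff_partialDeriv i hg)).continuous).integrable_of_hasCompactSupport hc.mul_right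

theorem contDiff_iterate_laplacian {n : ℕ} (m : ℕ) {f : E n → ℝ} (hf : ContDiff ℝ ∞ f) :
    ContDiff ℝ ∞ (Laplacian.laplacian^[m] f) := by
  induction m generalizing f with
  | zero => exact hf
  | succ m ih => exact ih (contDiff_laplacian hf)

theorem integral_mul_iterate_laplacian {n : ℕ} (m : ℕ) {h g : E n → ℝ} (hh : ContDiff ℝ ∞ h)
    (hc : HasCompactSupport h) (hg : ContDiff ℝ ∞ g) :
    ∫ x, h x * (Laplacian.laplacian^[m] g) x = ∫ x, (Laplacian.laplacian^[m] h) x * g x := by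
  induction m generalizing h with
  | zero => rfl
  | succ m ih =>
    rw [Function.iterate_succ_apply', integral_mul_laplacian hh hc (contDiff_iterate_laplacian m hg),
      ih (contDiff_laplacian hh) (hasCompactSupport_laplacian hc), Function.iterate_succ_apply]

theorem laplacian_partialDeriv {n : ℕ} (i : Fin n) {f : E n → ℝ} (hf : ContDiff ℝ ∞ f) :
    Laplacian.laplacian (partialDeriv i f) = partialDeriv i (Laplacian.laplacian f) := by
  have hcomm : ∀ (a b : Fin n) (g : E n → ℝ), ContDiff ℝ ∞ g →
      partialDeriv a (partialDeriv b g) = partialDeriv b (partialDeriv a g) := by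
    intro a b g hg
    have hd : ∀ x, DifferentiableAt ℝ (fderiv ℝ g) x :=
      (hg.fderiv_right (m := ∞) (by simp)).differentiable (by simp)
    ext x
    unfold partialDeriv
    rw [fderiv_clm_apply (hd x) (differentiableAt_const _),
      fderiv_clm_apply (hd x) (differentiableAt_const _)]
    have hs : IsSymmSndFDerivAt ℝ g x :=
      (hg.contDiffAt).isSymmSndFDerivAt (by
        rw [minSmoothness_of_isRCLikeNormedField]
        exact WithTop.coe_le_coe.2 (le_top : (2 : ℕ∞) ≤ ⊤))
    simpa using hs.eq _ _
  rw [laplacian_eq_sum hf, laplacian_eq_sum (contDiff_partialDeriv i hf)]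
  ext x
  have h2 : ∀ j, partialDeriv j (partialDeriv j (partialDeriv i f))
      = partialDeriv i (partialDeriv j (partialDeriv j f)) := fun j => by
    rw [hcomm j i f hf, hcomm j i _ (contDiff_partialDeriv j hf)]
  simp only [h2]
  unfold partialDeriv
  rw [fderiv_fun_sum fun j _ => ?_]
  · simp
  · exact (contDiff_partialDeriv j (contDiff_partialDeriv j hf)).differentiable (by simp) x

theorem iterate_laplacian_partialDeriv {n : ℕ} (m : ℕ) (i : Fin n) {f : E n → ℝ}
    (hf : ContDiff ℝ ∞ f) : Laplacian.laplacian^[m] (partialDeriv i f)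
      = partialDeriv i (Laplacian.laplacian^[m] f) := by
  induction m generalizing f with
  | zero => rfl
  | succ m ih =>
    rw [Function.iterate_succ_apply, Function.iterate_succ_apply, laplacian_partialDeriv i hf,
      ih (contDiff_laplacian hf)]

/-! ### Radial functions. -/

/-- The Laplacian of `ℝⁿ` on radial functions, as an operator in `t = |x|²`. -/
noncomputable def radialLaplacian (n : ℕ) (ψ : ℝ → ℝ) (t : ℝ) : ℝ :=
  4 * t * deriv (deriv ψ) t + 2 * n * deriv ψ t

theorem contDiff_deriv {ψ : ℝ → ℝ} (hψ : ContDiff ℝ ∞ ψ) : ContDiff ℝ ∞ (deriv ψ) :=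
  ((contDiff_succ_iff_deriv (n := ∞)).1 hψ).2.2

theorem contDiff_radialLaplacian (n : ℕ) {ψ : ℝ → ℝ} (hψ : ContDiff ℝ ∞ ψ) :
    ContDiff ℝ ∞ (radialLaplacian n ψ) := by
  have h1 := contDiff_deriv hψ
  have h2 := contDiff_deriv h1
  unfold radialLaplacian
  fun_prop

theorem hasFDerivAt_radial {n : ℕ} {ψ : ℝ → ℝ} (hψ : ContDiff ℝ ∞ ψ) (x y : E n) :
    HasFDerivAt (fun y => ψ (‖y - x‖ ^ 2))
      (deriv ψ (‖y - x‖ ^ 2) • ((2 : ℝ) • innerSL ℝ (y - x))) y := by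
  have h1 : HasFDerivAt (fun y => ‖y - x‖ ^ 2) ((2 : ℝ) • innerSL ℝ (y - x)) y := by
    simpa [two_smul] using ((hasFDerivAt_id y).sub_const x).norm_sq
  exact ((hψ.differentiable (by simp) _).hasDerivAt).comp_hasFDerivAt y h1

theorem contDiff_radial {n : ℕ} {ψ : ℝ → ℝ} (hψ : ContDiff ℝ ∞ ψ) (x : E n) :
    ContDiff ℝ ∞ (fun y => ψ (‖y - x‖ ^ 2)) :=
  hψ.comp ((contDiff_id.sub contDiff_const).norm_sq ℝ)

theorem partialDeriv_radial {n : ℕ} (i : Fin n) {ψ : ℝ → ℝ} (hψ : ContDiff ℝ ∞ ψ) (x y : E n) :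
    partialDeriv i (fun y => ψ (‖y - x‖ ^ 2)) y = 2 * (y - x) i * deriv ψ (‖y - x‖ ^ 2) := by
  rw [partialDeriv, (hasFDerivAt_radial hψ x y).fderiv]
  simp [EuclideanSpace.inner_single_right]
  ring

/-- Using the squared distance as the variable keeps radial functions smooth at their centre. Each
second derivative is 2ψ' + 4(y-x)ᵢ²ψ'', and the squares add up to `t`. -/
theorem laplacian_radial {n : ℕ} {ψ : ℝ → ℝ} (hψ : ContDiff ℝ ∞ ψ) (x : E n) :
    Laplacian.laplacian (fun y => ψ (‖y - x‖ ^ 2))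
      = fun y => radialLaplacian n ψ (‖y - x‖ ^ 2) := by
  rw [laplacian_eq_sum (contDiff_radial hψ x)]
  ext y
  have h : ∀ i : Fin n, partialDeriv i (partialDeriv i (fun y => ψ (‖y - x‖ ^ 2))) y
      = 2 * deriv ψ (‖y - x‖ ^ 2) + 4 * (y - x) i ^ 2 * deriv (deriv ψ) (‖y - x‖ ^ 2) := by
    intro i
    have h1 : partialDeriv i (fun y => ψ (‖y - x‖ ^ 2))
        = fun y => (2 * (y - x) i) * deriv ψ (‖y - x‖ ^ 2) :=
      funext fun y => partialDeriv_radial i hψ x y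
    have h3 : HasFDerivAt (fun y : E n => 2 * (y - x) i)
        ((2 : ℝ) • (EuclideanSpace.proj i : E n →L[ℝ] ℝ)) y := by
      have := ((EuclideanSpace.proj i : E n →L[ℝ] ℝ).hasFDerivAt (x := y - x)).comp y
        ((hasFDerivAt_id y).sub_const x)
      exact this.const_mul 2
    have h4 := DFunLike.congr_fun (h3.mul (hasFDerivAt_radial (contDiff_deriv hψ) x y)).fderiv
      (EuclideanSpace.single i 1)
    rw [h1]
    refine Eq.trans h4 ?_
    simp [EuclideanSpace.inner_single_right]
    ring
  simp only [h, radialLaplacian, Finset.sum_add_distrib, ← Finset.sum_mul, ← Finset.mul_sum]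
  rw [EuclideanSpace.norm_sq_eq]
  simp
  ring

theorem iterate_laplacian_radial {n : ℕ} (m : ℕ) {ψ : ℝ → ℝ} (hψ : ContDiff ℝ ∞ ψ) (x : E n) :
    Laplacian.laplacian^[m] (fun y => ψ (‖y - x‖ ^ 2))
      = fun y => ((radialLaplacian n)^[m] ψ) (‖y - x‖ ^ 2) := by
  induction m generalizing ψ with
  | zero => rfl
  | succ m ih =>
    rw [Function.iterate_succ_apply, laplacian_radial hψ, ih (contDiff_radialLaplacian n hψ),
      Function.iterate_succ_apply]

/-! ### Cutoffs and growth of the Dirichlet energy. -/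

theorem gradient_comp_smul {n : ℕ} {f : E n → ℝ} (hf : ContDiff ℝ ∞ f) (r : ℝ) (x : E n) :
    gradient (fun y => f (r • y)) x = r • gradient f (r • x) := by
  have h : HasFDerivAt (fun y : E n => r • y) (r • ContinuousLinearMap.id ℝ (E n)) x :=
    (hasFDerivAt_id x).const_smul r
  have h2 := ((hf.differentiable (by simp) (r • x)).hasFDerivAt.comp x h).fderiv
  refine ext_inner_right ℝ fun v => ?_
  rw [← fderiv_apply_eq_inner_gradient, inner_smul_left, ← fderiv_apply_eq_inner_gradient]
  refine (DFunLike.congr_fun h2 v).trans ?_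
  simp

theorem gradient_sq {n : ℕ} {f : E n → ℝ} (hf : ContDiff ℝ ∞ f) (x : E n) :
    gradient (fun y => f y ^ 2) x = (2 * f x) • gradient f x := by
  have h := ((hf.differentiable (by simp) x).hasFDerivAt.pow 2).fderiv
  refine ext_inner_right ℝ fun v => ?_
  rw [← fderiv_apply_eq_inner_gradient, inner_smul_left, ← fderiv_apply_eq_inner_gradient]
  refine (DFunLike.congr_fun h v).trans ?_
  simp

theorem exists_norm_gradient_le {n : ℕ} {f : E n → ℝ} (hf : ContDiff ℝ ∞ f)
    (hc : HasCompactSupport f) : ∃ M, 0 ≤ M ∧ ∀ x, ‖gradient f x‖ ≤ M := by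
  obtain ⟨M, hM⟩ := (hf.continuous_fderiv (by simp)).bounded_above_of_compact_support (hc.fderiv ℝ)
  exact ⟨M, (norm_nonneg _).trans (hM 0), fun x => by rw [norm_gradient]; exact hM x⟩

/-- All cutoffs are dilates of one bump with radii 1 and 2, hence a single `M` for every scale. -/
theorem exists_cutoff (n : ℕ) : ∃ M : ℝ, 0 ≤ M ∧ ∀ R : ℝ, 0 < R → ∃ ζ : E n → ℝ,
    ContDiff ℝ ∞ ζ ∧ (∀ x, 0 ≤ ζ x) ∧ (∀ x, ζ x ≤ 1) ∧
    (∀ x, x ∉ Metric.closedBall (0 : E n) (2 * R) → ζ x = 0) ∧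
    (∀ x ∈ Metric.closedBall (0 : E n) R, ζ x = 1) ∧ ∀ x, ‖gradient ζ x‖ ≤ M / R := by
  obtain ⟨η, hη1, hη2⟩ : ∃ η : ContDiffBump (0 : E n), η.rIn = 1 ∧ η.rOut = 2 :=
    ⟨⟨1, 2, by norm_num, by norm_num⟩, rfl, rfl⟩
  have hη : ContDiff ℝ ∞ (η : E n → ℝ) := η.contDiff
  obtain ⟨M, hM0, hM⟩ := exists_norm_gradient_le hη η.hasCompactSupport
  refine ⟨M, hM0, fun R hR0 => ⟨fun x => η (R⁻¹ • x), hη.comp (contDiff_const_smul _),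
    fun x => η.nonneg, fun x => η.le_one, ?_, ?_, ?_⟩⟩
  · intro x hx
    apply η.zero_of_le_dist
    simp only [Metric.mem_closedBall, dist_zero_right, not_le] at hx
    rw [dist_zero_right, norm_smul, norm_inv, Real.norm_of_nonneg hR0.le,
      le_inv_mul_iff₀ hR0, hη2]
    linarith
  · intro x hx
    apply η.one_of_mem_closedBall
    simp only [Metric.mem_closedBall, dist_zero_right] at hx ⊢
    rw [norm_smul, norm_inv, Real.norm_of_nonneg hR0.le, inv_mul_le_iff₀ hR0, hη1]
    linarith
  · intro x
    rw [gradient_comp_smul hη, norm_smul, norm_inv, Real.norm_of_nonneg hR0.le, div_eq_inv_mul]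
    exact mul_le_mul_of_nonneg_left (hM _) (by positivity)

/-- A function with `‖∇u‖² ≤ -Δu` near infinity has Dirichlet energy `O(Rⁿ⁻²)` on balls. -/
theorem integral_norm_gradient_sq_le {n : ℕ} (hn : 2 ≤ n) {u : E n → ℝ} (hu : ContDiff ℝ ∞ u)
    (h : ∀ᶠ x in Filter.cocompact (E n), ‖gradient u x‖ ^ 2 + Laplacian.laplacian u x ≤ 0) :
    ∃ C : ℝ, ∀ R : ℝ, 1 ≤ R →
      ∫ x in Metric.closedBall 0 R, ‖gradient u x‖ ^ 2 ≤ C * R ^ (n - 2) := by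
  have hp : Continuous fun x => ‖gradient u x‖ ^ 2 := (continuous_gradient hu).norm.pow 2
  have hL : Continuous (Laplacian.laplacian u) := (contDiff_laplacian hu).continuous
  -- The positive part is supported where the differential inequality fails. Its integral bounds the
  -- contribution of that bounded region, independently of `R`.
  set q : E n → ℝ := fun x => max (‖gradient u x‖ ^ 2 + Laplacian.laplacian u x) 0 with hq
  have hqc : Continuous q := (hp.add hL).max continuous_const
  have hqs : HasCompactSupport q := by
    rw [hasCompactSupport_iff_eventuallyEq, Filter.coclosedCompact_eq_cocompact]
    filter_upwards [h] with x hx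
    simpa [hq] using hx
  have hqi : Integrable q := hqc.integrable_of_hasCompactSupport hqs
  obtain ⟨M, hM0, hM⟩ := exists_cutoff n
  refine ⟨2 * (∫ x, q x) + 4 * (M ^ 2 * (2 ^ n * volume.real (Metric.ball (0 : E n) 1))),
    fun R hR => ?_⟩
  have hR0 : 0 < R := by linarith
  obtain ⟨ζ, hζs, hζn, hζle, hζ0, hζ1, hg⟩ := hM R hR0
  have hζc : HasCompactSupport ζ :=
    HasCompactSupport.intro (isCompact_closedBall (0 : E n) (2 * R)) hζ0
  have hgs : HasCompactSupport fun x => ‖gradient ζ x‖ ^ 2 := by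
    refine (hζc.fderiv ℝ).mono ?_
    intro x hx h0
    apply hx
    simp [norm_gradient, h0]
  have hgc : Continuous fun x => ‖gradient ζ x‖ ^ 2 := (continuous_gradient hζs).norm.pow 2
  have hgi : ∫ x, ‖gradient ζ x‖ ^ 2
      ≤ M ^ 2 * (2 ^ n * volume.real (Metric.ball (0 : E n) 1)) * R ^ (n - 2) := by
    have h1 : ∫ x, ‖gradient ζ x‖ ^ 2 = ∫ x in Metric.closedBall (0 : E n) (2 * R),
        ‖gradient ζ x‖ ^ 2 := by
      refine (setIntegral_eq_integral_of_forall_compl_eq_zero fun x hx => ?_).symm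
      have : fderiv ℝ ζ x = 0 := by
        have h0 : ζ =ᶠ[nhds x] fun _ => 0 := by
          filter_upwards [Metric.isClosed_closedBall.isOpen_compl.mem_nhds hx] with y hy
          exact hζ0 y hy
        rw [h0.fderiv_eq]; simp
      rw [norm_gradient, this]; simp
    rw [h1]
    have h2 : ∫ x in Metric.closedBall (0 : E n) (2 * R), ‖gradient ζ x‖ ^ 2
        ≤ ∫ x in Metric.closedBall (0 : E n) (2 * R), (M / R) ^ 2 := by
      refine setIntegral_mono_on (hgc.integrable_of_hasCompactSupport hgs).integrableOn
        (integrableOn_const measure_closedBall_lt_top.ne) Metric.isClosed_closedBall.measurableSet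
        fun x _ => ?_
      have := hg x
      gcongr
    refine h2.trans (le_of_eq ?_)
    rw [setIntegral_const, Measure.real, Measure.addHaar_closedBall _ _ (by positivity)]
    simp only [finrank_euclideanSpace_fin, ENNReal.toReal_mul, smul_eq_mul]
    rw [ENNReal.toReal_ofReal (by positivity)]
    obtain ⟨k, rfl⟩ := Nat.exists_eq_add_of_le hn
    rw [Nat.add_sub_cancel_left, Measure.real, div_pow, mul_pow, pow_add R]
    field_simp
  have hζ2c : HasCompactSupport fun x => ζ x ^ 2 :=
    hζc.mono fun x hx h0 => hx (by simp [h0])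
  have hi1 : Integrable fun x => ζ x ^ 2 * ‖gradient u x‖ ^ 2 :=
    ((hζs.continuous.pow 2).mul hp).integrable_of_hasCompactSupport
      hζ2c.mul_right
  have hi2 : Integrable fun x => ζ x ^ 2 * Laplacian.laplacian u x :=
    ((hζs.continuous.pow 2).mul hL).integrable_of_hasCompactSupport
      hζ2c.mul_right
  have hi3 : Integrable fun x => ‖gradient ζ x‖ ^ 2 := hgc.integrable_of_hasCompactSupport hgs
  have hI := integral_mul_laplacian_eq_neg_inner (h := fun x => ζ x ^ 2) (hζs.pow 2)
    hζ2c hu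
  -- Young's inequality for 2ζ⟨∇ζ, ∇u⟩. The half of ζ²|∇u|² is absorbed into the left side, which
  -- doubles the other terms and produces the constants 2 and 4 of the witness.
  have hcs : ∀ x, inner ℝ (gradient (fun y => ζ y ^ 2) x) (gradient u x)
      ≤ 1 / 2 * (ζ x ^ 2 * ‖gradient u x‖ ^ 2) + 2 * ‖gradient ζ x‖ ^ 2 := by
    intro x
    rw [gradient_sq hζs, inner_smul_left]
    have h1 := abs_real_inner_le_norm (gradient ζ x) (gradient u x)
    have h2 : ζ x * inner ℝ (gradient ζ x) (gradient u x)
        ≤ |ζ x| * (‖gradient ζ x‖ * ‖gradient u x‖) :=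
      (le_abs_self _).trans (by rw [abs_mul]; gcongr)
    have h3 := sq_nonneg (|ζ x| * ‖gradient u x‖ - 2 * ‖gradient ζ x‖)
    have h4 := sq_abs (ζ x)
    simp only [conj_trivial]
    nlinarith
  have hI2 : ∫ x, inner ℝ (gradient (fun y => ζ y ^ 2) x) (gradient u x)
      ≤ ∫ x, (1 / 2 * (ζ x ^ 2 * ‖gradient u x‖ ^ 2) + 2 * ‖gradient ζ x‖ ^ 2) := by
    refine integral_mono ?_ ((hi1.const_mul _).add (hi3.const_mul _)) hcs
    have : Continuous fun x => inner ℝ (gradient (fun y => ζ y ^ 2) x) (gradient u x) :=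
      (continuous_gradient (hζs.pow 2)).inner (continuous_gradient hu)
    refine this.integrable_of_hasCompactSupport ?_
    refine hζc.mono ?_
    intro x hx h0
    apply hx
    simp [gradient_sq hζs, h0]
  rw [integral_add (hi1.const_mul _) (hi3.const_mul _), integral_const_mul,
    integral_const_mul] at hI2
  have hI3 : ∫ x, (ζ x ^ 2 * ‖gradient u x‖ ^ 2 + ζ x ^ 2 * Laplacian.laplacian u x)
      ≤ ∫ x, q x := by
    refine integral_mono (hi1.add hi2) hqi fun x => ?_
    have h0 := hζn x
    have h1 := hζle x
    have h2 : ζ x ^ 2 ≤ 1 := by nlinarith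
    have h3 : ‖gradient u x‖ ^ 2 + Laplacian.laplacian u x ≤ q x := le_max_left _ _
    have h4 : 0 ≤ q x := le_max_right _ _
    calc ζ x ^ 2 * ‖gradient u x‖ ^ 2 + ζ x ^ 2 * Laplacian.laplacian u x
        = ζ x ^ 2 * (‖gradient u x‖ ^ 2 + Laplacian.laplacian u x) := by ring
      _ ≤ ζ x ^ 2 * q x := by gcongr
      _ ≤ 1 * q x := by gcongr
      _ = q x := one_mul _
  rw [integral_add hi1 hi2] at hI3
  have hfin : ∫ x in Metric.closedBall 0 R, ‖gradient u x‖ ^ 2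
      ≤ ∫ x, ζ x ^ 2 * ‖gradient u x‖ ^ 2 := by
    calc ∫ x in Metric.closedBall 0 R, ‖gradient u x‖ ^ 2
        = ∫ x in Metric.closedBall 0 R, ζ x ^ 2 * ‖gradient u x‖ ^ 2 := by
          refine setIntegral_congr_fun Metric.isClosed_closedBall.measurableSet fun x hx => ?_
          simp [hζ1 x hx]
      _ ≤ _ := setIntegral_le_integral hi1 (Filter.Eventually.of_forall fun x => by positivity)
  have hq0 : 0 ≤ ∫ x, q x := integral_nonneg fun x => le_max_right _ _
  have hRn : 1 ≤ R ^ (n - 2) := one_le_pow₀ hR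
  have : ∫ x, q x ≤ (∫ x, q x) * R ^ (n - 2) := le_mul_of_one_le_right hq0 hRn
  rw [add_mul, mul_assoc 2, mul_assoc 4]
  linarith

/-- The inequality a ≤ R a² + 1/R plays the role of Cauchy–Schwarz: its weights turn both the energy
bound and the volume of the ball into multiples of Rⁿ⁻¹. -/
theorem integral_norm_gradient_le {n : ℕ} (hn : 2 ≤ n) {u : E n → ℝ} (hu : ContDiff ℝ ∞ u)
    (h : ∀ᶠ x in Filter.cocompact (E n), ‖gradient u x‖ ^ 2 + Laplacian.laplacian u x ≤ 0) :
    ∃ C : ℝ, ∀ R : ℝ, 1 ≤ R →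
      ∫ x in Metric.closedBall 0 R, ‖gradient u x‖ ≤ C * R ^ (n - 1) := by
  obtain ⟨C, hC⟩ := integral_norm_gradient_sq_le hn hu h
  refine ⟨C + volume.real (Metric.ball (0 : E n) 1), fun R hR => ?_⟩
  have hR0 : 0 < R := by linarith
  have hc := continuous_gradient hu
  have hi2 : IntegrableOn (fun x => ‖gradient u x‖ ^ 2) (Metric.closedBall 0 R) :=
    (hc.norm.pow 2).continuousOn.integrableOn_compact (isCompact_closedBall _ _)
  have h1 : ∫ x in Metric.closedBall 0 R, ‖gradient u x‖
      ≤ ∫ x in Metric.closedBall 0 R, (R * ‖gradient u x‖ ^ 2 + R⁻¹) := by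
    refine setIntegral_mono_on (hc.norm.continuousOn.integrableOn_compact (isCompact_closedBall _ _))
      ((hi2.const_mul _).add (integrableOn_const measure_closedBall_lt_top.ne))
      Metric.isClosed_closedBall.measurableSet fun x _ => ?_
    have h2 := norm_nonneg (gradient u x)
    have h3 : R * ‖gradient u x‖ ^ 2 + R⁻¹ - ‖gradient u x‖
      = R * (‖gradient u x‖ - (2 * R)⁻¹) ^ 2 + 3 / 4 * R⁻¹ := by field_simp; ring
    have : 0 ≤ R * (‖gradient u x‖ - (2 * R)⁻¹) ^ 2 + 3 / 4 * R⁻¹ := by positivity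
    linarith
  refine h1.trans ?_
  rw [integral_add (hi2.const_mul _) (integrableOn_const measure_closedBall_lt_top.ne),
    integral_const_mul, setIntegral_const, Measure.real, Measure.addHaar_closedBall _ _ hR0.le]
  simp only [finrank_euclideanSpace_fin, ENNReal.toReal_mul, smul_eq_mul]
  rw [ENNReal.toReal_ofReal (by positivity)]
  have := mul_le_mul_of_nonneg_left (hC R hR) hR0.le
  obtain ⟨k, rfl⟩ := Nat.exists_eq_add_of_le hn
  have e : 2 + k - 1 = k + 1 := by omega
  rw [Nat.add_sub_cancel_left] at this
  rw [e, Measure.real]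
  have h5 : R ^ (2 + k) * (volume (Metric.ball (0 : E (2 + k)) 1)).toReal * R⁻¹
      = R ^ (k + 1) * (volume (Metric.ball (0 : E (2 + k)) 1)).toReal := by field_simp; ring
  rw [h5]
  calc _ ≤ R * (C * R ^ k) + R ^ (k + 1) * (volume (Metric.ball (0 : E (2 + k)) 1)).toReal := by
        gcongr
    _ = _ := by ring

/-! ### The regularised logarithm, its iterated Laplacians and the normalising constant. -/

/-- A smooth function on `ℝ` which agrees with the logarithm on `[1, ∞)`. -/
noncomputable def smoothLog (t : ℝ) : ℝ := Real.smoothTransition (2 * t - 1) * Real.log t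

theorem smoothLog_of_one_le {t : ℝ} (ht : 1 ≤ t) : smoothLog t = Real.log t := by
  rw [smoothLog, Real.smoothTransition.one_of_one_le (by linarith), one_mul]

/-- The transition factor vanishes for t ≤ 1/2, which removes the singularity at 0. -/
theorem contDiff_smoothLog : ContDiff ℝ ∞ smoothLog := by
  rw [contDiff_iff_contDiffAt]
  intro t
  rcases eq_or_ne t 0 with rfl | ht
  · have h : smoothLog =ᶠ[nhds 0] fun _ => 0 := by
      filter_upwards [Iio_mem_nhds (show (0 : ℝ) < 1 / 2 by norm_num)] with s hs
      rw [smoothLog, Real.smoothTransition.zero_of_nonpos (by simp at hs; linarith), zero_mul]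
    exact contDiffAt_const.congr_of_eventuallyEq h
  · have h1 : ContDiff ℝ ∞ fun t : ℝ => Real.smoothTransition (2 * t - 1) :=
      Real.smoothTransition.contDiff.comp (by fun_prop)
    exact h1.contDiffAt.mul (Real.contDiffAt_log.2 ht)

theorem deriv_smoothLog {t : ℝ} (ht : 1 < t) : deriv smoothLog t = t⁻¹ := by
  have h : smoothLog =ᶠ[nhds t] Real.log := by
    filter_upwards [Ioi_mem_nhds ht] with s hs using smoothLog_of_one_le (le_of_lt hs)
  rw [h.deriv_eq, Real.deriv_log]

theorem exists_abs_deriv_smoothLog_le : ∃ C, 0 ≤ C ∧ ∀ t, 0 < t → |deriv smoothLog t| ≤ C / t := by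
  have hc : Continuous fun t => t * deriv smoothLog t :=
    continuous_id.mul (contDiff_deriv contDiff_smoothLog).continuous
  obtain ⟨C, hC⟩ := (isCompact_Icc (a := (0 : ℝ)) (b := 1)).exists_bound_of_continuousOn
    hc.continuousOn
  refine ⟨max C 1, by positivity, fun t ht => ?_⟩
  rw [le_div_iff₀ ht, mul_comm, ← abs_of_pos ht, ← abs_mul, abs_of_pos ht]
  rcases le_or_gt t 1 with h | h
  · exact (hC t ⟨ht.le, h⟩).trans (le_max_left _ _)
  · rw [deriv_smoothLog h, mul_inv_cancel₀ ht.ne']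
    simp

theorem deriv_eqOn_Ioi {ψ φ : ℝ → ℝ} {a : ℝ} (h : ∀ t, a < t → ψ t = φ t) {t : ℝ} (ht : a < t) :
    deriv ψ t = deriv φ t := by
  refine Filter.EventuallyEq.deriv_eq ?_
  filter_upwards [Ioi_mem_nhds ht] with s hs using h s hs

theorem deriv_mul_zpow (c : ℝ) (z : ℤ) : deriv (fun t : ℝ => c * t ^ z)
    = fun t => (c * z) * t ^ (z - 1) := by
  ext t
  rw [deriv_const_mul_field, deriv_zpow]
  ring

theorem radialLaplacian_of_eq_zpow (n : ℕ) {ψ : ℝ → ℝ} {c : ℝ} {z : ℤ}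
    (h : ∀ t, 1 < t → ψ t = c * t ^ z) {t : ℝ} (ht : 1 < t) :
    radialLaplacian n ψ t = c * (4 * z * (z - 1) + 2 * n * z) * t ^ (z - 1) := by
  have h1 : ∀ t, 1 < t → deriv ψ t = (c * z) * t ^ (z - 1) := fun t ht => by
    rw [deriv_eqOn_Ioi h ht, deriv_mul_zpow]
  rw [radialLaplacian, deriv_eqOn_Ioi h1 ht, deriv_mul_zpow, h1 t ht]
  have h2 : t ^ (z - 1) = t * t ^ (z - 1 - 1) := by
    rw [mul_comm, ← zpow_add_one₀ (by linarith), sub_add_cancel]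
  rw [h2]
  push_cast
  ring

/-- Applied to the power of exponent -(i+1), the radial Laplacian lowers the exponent by one and
multiplies by 2(i+1)(2(i+2) - n). In even dimension n ≥ 4 one such factor vanishes: the logarithm is
polyharmonic away from 0. -/
theorem iterate_radialLaplacian_smoothLog (n j : ℕ) {t : ℝ} (ht : 1 < t) :
    ((radialLaplacian n)^[j + 1] smoothLog) t
      = (2 * n - 4) * (∏ i ∈ Finset.range j, (4 * ((i : ℝ) + 1) * (i + 2) - 2 * n * (i + 1)))
        * t ^ (-(j + 1 : ℤ)) := by
  induction j generalizing t with
  | zero =>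
    have h1 : ∀ t, 1 < t → deriv smoothLog t = 1 * t ^ (-1 : ℤ) := fun t ht => by
      rw [deriv_smoothLog ht]; simp
    simp only [zero_add, Function.iterate_one, radialLaplacian, h1 t ht]
    rw [deriv_eqOn_Ioi h1 ht, deriv_mul_zpow]
    have : t ≠ 0 := by linarith
    have h2 : t ^ (-1 - 1 : ℤ) = (t * t)⁻¹ := by
      rw [show (-1 - 1 : ℤ) = -((2 : ℕ) : ℤ) by norm_num, zpow_neg, zpow_natCast, sq]
    simp only [h2]
    simp
    field_simp
    ring
  | succ j ih =>
    rw [Function.iterate_succ_apply', radialLaplacian_of_eq_zpow n (fun s hs => ih hs) ht,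
      Finset.prod_range_succ]
    have e : (-(j + 1 : ℤ) - 1) = -((j + 1 : ℕ) + 1 : ℤ) := by push_cast; ring
    rw [e]
    push_cast
    ring

theorem contDiff_iterate_radialLaplacian (n m : ℕ) {ψ : ℝ → ℝ} (hψ : ContDiff ℝ ∞ ψ) :
    ContDiff ℝ ∞ ((radialLaplacian n)^[m] ψ) := by
  induction m generalizing ψ with
  | zero => exact hψ
  | succ m ih => exact ih (contDiff_radialLaplacian n hψ)

/-- The profile of a smooth approximation to the identity obtained by applying `Δᵐ`, `n = 2m`, to
the regularised logarithm. -/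
noncomputable def bump (m : ℕ) : ℝ → ℝ := (radialLaplacian (2 * m))^[m] smoothLog

theorem contDiff_bump (m : ℕ) : ContDiff ℝ ∞ (bump m) :=
  contDiff_iterate_radialLaplacian _ _ contDiff_smoothLog

/-- For n = 2(k+2) the last factor of the product, at i = k, is zero. The endpoint t = 1 follows by
continuity. -/
theorem bump_eq_zero {k : ℕ} {t : ℝ} (ht : 1 ≤ t) : bump (k + 2) t = 0 := by
  have h : ∀ t ∈ Set.Ioi (1 : ℝ), bump (k + 2) t = 0 := fun t ht => by
    rw [bump, iterate_radialLaplacian_smoothLog _ _ ht, Finset.prod_range_succ]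
    push_cast
    ring
  have hc : IsClosed {t | bump (k + 2) t = 0} :=
    isClosed_eq (contDiff_bump _).continuous continuous_const
  have := hc.closure_subset_iff.2 h
  rw [closure_Ioi] at this
  exact this ht

/-- A divergence theorem in polar coordinates: with h the iterate of order k+1, the radial integrand
is the derivative of 2rⁿh'(r²). Beyond r = 1 this flux is constant, because h is an explicit power
there. -/
theorem integral_bump (k : ℕ) : ∫ z : E (2 * (k + 2)), bump (k + 2) (‖z‖ ^ 2)
    = -8 * (-4) ^ k * ((k + 1).factorial : ℝ) ^ 2 * ((2 * (k + 2) : ℕ) *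
      volume.real (Metric.ball (0 : E (2 * (k + 2))) 1)) := by
  set n := 2 * (k + 2) with hn
  have : Nonempty (Fin n) := ⟨⟨0, by omega⟩⟩
  rw [integral_fun_norm_addHaar volume (fun r : ℝ => bump (k + 2) (r ^ 2))]
  set h : ℝ → ℝ := (radialLaplacian n)^[k + 1] smoothLog with hh
  have hsm : ContDiff ℝ ∞ h := contDiff_iterate_radialLaplacian _ _ contDiff_smoothLog
  have hb : bump (k + 2) = radialLaplacian n h := Function.iterate_succ_apply' _ _ _
  have hd : ∀ r : ℝ, HasDerivAt (fun r => 2 * r ^ n * deriv h (r ^ 2))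
      (r ^ (n - 1) * bump (k + 2) (r ^ 2)) r := by
    intro r
    have h1 : HasDerivAt (fun r : ℝ => r ^ 2) (2 * r) r := by simpa using hasDerivAt_pow 2 r
    have h2 := (((contDiff_deriv hsm).differentiable (by simp) (r ^ 2)).hasDerivAt).comp r h1
    have h3 := ((hasDerivAt_pow n r).const_mul 2).mul h2
    refine h3.congr_deriv ?_
    rw [hb, radialLaplacian]
    have : r ^ n = r ^ (n - 1) * r := by rw [← pow_succ]; congr 1
    simp only [Function.comp]
    rw [this]
    ring
  set c : ℝ := (2 * n - 4) * (∏ i ∈ Finset.range k, (4 * ((i : ℝ) + 1) * (i + 2) - 2 * n * (i + 1)))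
    with hc
  have hlim : Filter.Tendsto (fun r : ℝ => 2 * r ^ n * deriv h (r ^ 2)) Filter.atTop
      (nhds (-2 * (k + 1) * c)) := by
    refine tendsto_const_nhds.congr' ?_
    filter_upwards [Filter.eventually_gt_atTop 1] with r hr
    have hr2 : 1 < r ^ 2 := one_lt_pow₀ hr (by norm_num)
    rw [deriv_eqOn_Ioi (fun t ht => iterate_radialLaplacian_smoothLog n k ht) hr2, deriv_mul_zpow]
    have e : r ^ n * (r ^ 2) ^ (-(k + 1 : ℤ) - 1) = 1 := by
      rw [show (-(k + 1 : ℤ) - 1) = -((k + 2 : ℕ) : ℤ) by push_cast; ring, zpow_neg, zpow_natCast,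
        ← pow_mul, ← hn]
      exact mul_inv_cancel₀ (by positivity)
    rw [← hc]
    push_cast
    linear_combination 2 * c * (k + 1) * e
  have hint : IntegrableOn (fun r : ℝ => r ^ (n - 1) * bump (k + 2) (r ^ 2)) (Set.Ioi 0) := by
    have hcont : Continuous fun r : ℝ => r ^ (n - 1) * bump (k + 2) (r ^ 2) :=
      (continuous_pow _).mul ((contDiff_bump _).continuous.comp (continuous_pow 2))
    refine (hcont.integrable_of_hasCompactSupport ?_).integrableOn
    refine HasCompactSupport.intro (isCompact_Icc (a := (-1 : ℝ)) (b := 1)) fun r hr => ?_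
    rw [bump_eq_zero, mul_zero]
    by_contra hlt
    have := (sq_lt_one_iff_abs_lt_one r).1 (not_le.1 hlt)
    exact hr ⟨(abs_lt.1 this).1.le, (abs_lt.1 this).2.le⟩
  have hI := integral_Ioi_of_hasDerivAt_of_tendsto (hd 0).continuousAt.continuousWithinAt
    (fun r _ => hd r) hint hlim
  have hn0 : n ≠ 0 := by omega
  simp only [smul_eq_mul, nsmul_eq_mul, finrank_euclideanSpace_fin]
  rw [hI]
  -- Since n = 2(k+2), each factor equals -4(i+1)(k-i). Both (i+1) and (k-i) run through 1, …, k.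
  have hprod : ∏ i ∈ Finset.range k, (4 * ((i : ℝ) + 1) * (i + 2) - 2 * n * (i + 1))
      = (-4) ^ k * (k.factorial : ℝ) ^ 2 := by
    have e1 : ∀ i ∈ Finset.range k, (4 * ((i : ℝ) + 1) * (i + 2) - 2 * n * (i + 1))
        = -4 * (((i + 1 : ℕ) : ℝ) * ((k - 1 - i + 1 : ℕ) : ℝ)) := by
      intro i hi
      have hi' : i < k := Finset.mem_range.1 hi
      have : k - 1 - i + 1 = k - i := by omega
      rw [this, Nat.cast_sub hi'.le, hn]
      push_cast
      ring
    rw [Finset.prod_congr rfl e1, Finset.prod_mul_distrib, Finset.prod_mul_distrib,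
      Finset.prod_range_reflect (fun i => ((i + 1 : ℕ) : ℝ)), ← Nat.cast_prod,
      Finset.prod_range_add_one_eq_factorial]
    simp
    ring
  rw [hc, hprod, Nat.factorial_succ, hn]
  push_cast
  rw [zero_pow (by omega)]
  ring

/-- The constant `(n-1)! |𝕊ⁿ| / 2`. -/
noncomputable def critConst (n : ℕ) : ℝ := ((n - 1).factorial : ℝ) * sphereVolume n / 2

/-- The sphere volume is n+1 times the volume of the unit ball in dimension n+1. Ball volumes in
dimensions n and n+1 involve Γ at an integer and at a half-integer, so the comparison reduces to the
double factorial identity `hdf`. -/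
theorem critConst_eq (k : ℕ) : critConst (2 * (k + 2)) = 4 ^ (k + 1) * ((k + 1).factorial : ℝ) ^ 2
    * ((2 * (k + 2) : ℕ) * volume.real (Metric.ball (0 : E (2 * (k + 2))) 1)) := by
  rw [critConst, sphereVolume, Measure.toSphere_real_apply_univ, Measure.real, Measure.real]
  have : Nonempty (Fin (2 * (k + 2))) := ⟨⟨0, by omega⟩⟩
  rw [EuclideanSpace.volume_ball, EuclideanSpace.volume_ball]
  simp only [ENNReal.ofReal_one, one_pow, one_mul, Fintype.card_fin, finrank_euclideanSpace_fin]
  have hG1 : Real.Gamma (((2 * (k + 2) : ℕ) : ℝ) / 2 + 1) = ((k + 2).factorial : ℝ) := by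
    rw [← Real.Gamma_nat_eq_factorial]
    push_cast
    congr 1
    ring
  have hG2 : Real.Gamma (((2 * (k + 2) + 1 : ℕ) : ℝ) / 2 + 1)
      = ((2 * (k + 3) - 1 : ℕ).doubleFactorial : ℝ) * √Real.pi / 2 ^ (k + 3) := by
    rw [← Real.Gamma_nat_add_half]
    push_cast
    congr 1
    ring
  rw [hG1, hG2]
  have hdf : ((2 * (k + 3) - 1 : ℕ).doubleFactorial : ℝ) * (2 ^ (k + 2) * ((k + 2).factorial : ℝ))
      = ((2 * (k + 2) + 1).factorial : ℝ) := by
    have h := Nat.factorial_eq_mul_doubleFactorial (2 * (k + 2))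
    rw [Nat.doubleFactorial_two_mul] at h
    rw [show 2 * (k + 3) - 1 = 2 * (k + 2) + 1 by omega, h]
    push_cast
    ring
  rw [ENNReal.toReal_ofReal (by positivity), ENNReal.toReal_ofReal (by positivity)]
  have hf1 : ((2 * (k + 2) + 1).factorial : ℝ)
      = (2 * (k + 2) + 1) * (2 * (k + 2)) * ((2 * (k + 2) - 1).factorial : ℝ) := by
    rw [Nat.factorial_succ, show 2 * (k + 2) = 2 * (k + 2) - 1 + 1 by omega, Nat.factorial_succ]
    have : 2 * (k + 2) - 1 + 1 = 2 * (k + 2) := by omega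
    rw [this]
    push_cast
    ring
  have hf2 : ((k + 2).factorial : ℝ) = (k + 2) * ((k + 1).factorial : ℝ) := by
    rw [Nat.factorial_succ]; push_cast; ring
  rw [hf1, hf2] at hdf
  have hd0 : ((2 * (k + 3) - 1 : ℕ).doubleFactorial : ℝ) ≠ 0 := by
    have := Nat.doubleFactorial_pos (2 * (k + 3) - 1)
    positivity
  have hπ : √Real.pi ≠ 0 := by positivity
  have hk : ((k + 1).factorial : ℝ) ≠ 0 := by positivity
  rw [hf2, pow_succ √Real.pi]
  have h2 : (4 : ℝ) ^ (k + 1) = 2 ^ (k + 1) * 2 ^ (k + 1) := by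
    rw [← mul_pow]; norm_num
  rw [h2]
  field_simp
  push_cast
  have e : (2 : ℝ) ^ (k + 3) = 2 ^ (k + 1) * 4 := by rw [pow_add, pow_add]; norm_num; ring
  have e' : (2 : ℝ) ^ (k + 2) = 2 ^ (k + 1) * 2 := by rw [pow_add, pow_add]; norm_num; ring
  rw [e'] at hdf
  simp only [e]
  linear_combination (-(2 ^ (k + 1) * 2) : ℝ) * hdf

theorem critConst_pos (k : ℕ) : 0 < critConst (2 * (k + 2)) := by
  rw [critConst_eq]
  have : 0 < volume.real (Metric.ball (0 : E (2 * (k + 2))) 1) :=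
    ENNReal.toReal_pos (Metric.measure_ball_pos _ _ one_pos).ne' measure_ball_lt_top.ne
  positivity

theorem integral_bump_eq_critConst (k : ℕ) : ∫ z : E (2 * (k + 2)), bump (k + 2) (‖z‖ ^ 2)
    = -2 * (-1) ^ k * critConst (2 * (k + 2)) := by
  rw [integral_bump, critConst_eq, neg_pow (4 : ℝ) k]
  ring

/-! ### Riesz potentials of continuous integrable functions. -/

theorem integrableOn_norm_pow_inv {n p : ℕ} (hp : p < n) :
    IntegrableOn (fun z : E n => (‖z‖ ^ p)⁻¹) (Metric.ball 0 1) := by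
  have : Nonempty (Fin n) := ⟨⟨0, by omega⟩⟩
  rw [integrableOn_fun_norm_addHaar volume (f := fun r : ℝ => (r ^ p)⁻¹)]
  have h : IntegrableOn (fun y : ℝ => y ^ (n - 1 - p)) (Set.Ioo 0 1) :=
    ((continuous_pow _).continuousOn.integrableOn_compact isCompact_Icc).mono_set
      Set.Ioo_subset_Icc_self
  refine h.congr_fun (fun y hy => ?_) measurableSet_Ioo
  have hy0 : y ≠ 0 := hy.1.ne'
  simp only [finrank_euclideanSpace_fin, smul_eq_mul]
  rw [pow_sub₀ y hy0 (by omega)]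

/-- The integral of `‖z‖⁻ᵖ` over the unit ball. -/
noncomputable def ballMoment (n p : ℕ) : ℝ :=
  ∫ z in Metric.ball (0 : E n) 1, (‖z‖ ^ p)⁻¹

theorem ballMoment_nonneg (n p : ℕ) : 0 ≤ ballMoment n p :=
  integral_nonneg fun _ => by positivity

theorem integrable_indicator_pow_inv {n p : ℕ} (hp : p < n) (x : E n) :
    Integrable fun y : E n => (Metric.ball (0 : E n) 1).indicator (fun z => (‖z‖ ^ p)⁻¹) (x - y) :=
  ((integrable_indicator_iff measurableSet_ball).2 (integrableOn_norm_pow_inv hp)).comp_sub_left x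

theorem integral_indicator_pow_inv {n p : ℕ} (x : E n) :
    ∫ y : E n, (Metric.ball (0 : E n) 1).indicator (fun z => (‖z‖ ^ p)⁻¹) (x - y)
      = ballMoment n p := by
  rw [integral_sub_left_eq_self, integral_indicator measurableSet_ball, ballMoment]

/-- Riesz potentials of integrable functions which are bounded near the pole. -/
theorem integrable_div_norm_pow {n p : ℕ} (hp : p < n) {f : E n → ℝ} (hf : Integrable f)
    {x : E n} {M : ℝ} (hM : ∀ y ∈ Metric.ball x 1, |f y| ≤ M) :
    Integrable (fun y => |f y| / ‖x - y‖ ^ p) ∧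
      ∫ y, |f y| / ‖x - y‖ ^ p ≤ M * ballMoment n p + ∫ y, |f y| := by
  have hM0 : 0 ≤ M := (abs_nonneg _).trans (hM x (Metric.mem_ball_self one_pos))
  have hbi := (integrable_indicator_pow_inv hp x).const_mul M
  have hle : ∀ y, |f y| / ‖x - y‖ ^ p
      ≤ M * (Metric.ball (0 : E n) 1).indicator (fun z => (‖z‖ ^ p)⁻¹) (x - y) + |f y| := by
    intro y
    by_cases hy : x - y ∈ Metric.ball (0 : E n) 1
    · rw [Set.indicator_of_mem hy, div_eq_mul_inv]
      have : |f y| ≤ M := hM y (by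
        rw [mem_ball_zero_iff] at hy
        rwa [Metric.mem_ball, dist_comm, dist_eq_norm])
      have h2 : 0 ≤ (‖x - y‖ ^ p)⁻¹ := by positivity
      have := mul_le_mul_of_nonneg_right this h2
      linarith [abs_nonneg (f y)]
    · rw [Set.indicator_of_notMem hy, mul_zero, zero_add]
      rw [mem_ball_zero_iff, not_lt] at hy
      exact div_le_self (abs_nonneg _) (one_le_pow₀ hy)
  have hmeas : AEStronglyMeasurable (fun y => |f y| / ‖x - y‖ ^ p) volume := by
    have h1 : AEStronglyMeasurable (fun y : E n => (‖x - y‖ ^ p)⁻¹) volume :=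
      (by fun_prop : Measurable fun y : E n => (‖x - y‖ ^ p)⁻¹).aestronglyMeasurable
    simp only [div_eq_mul_inv]
    exact hf.abs.aestronglyMeasurable.mul h1
  have hint : Integrable (fun y => |f y| / ‖x - y‖ ^ p) := by
    refine (hbi.add hf.abs).mono' hmeas (Filter.Eventually.of_forall fun y => ?_)
    rw [Real.norm_of_nonneg (by positivity)]
    exact hle y
  refine ⟨hint, ?_⟩
  calc _ ≤ ∫ y, (M * (Metric.ball (0 : E n) 1).indicator (fun z => (‖z‖ ^ p)⁻¹) (x - y)
        + |f y|) := integral_mono hint (hbi.add hf.abs) hle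
    _ = _ := by
      rw [integral_add hbi hf.abs, integral_const_mul, integral_indicator_pow_inv]

/-- On a bounded set, the Riesz potentials of a continuous integrable function are bounded. -/
theorem exists_bound_div_norm_pow {n p : ℕ} (hp : p < n) {f : E n → ℝ} (hf : Integrable f)
    (hc : Continuous f) (r : ℝ) : ∃ A, ∀ x : E n, ‖x‖ ≤ r →
      Integrable (fun y => |f y| / ‖x - y‖ ^ p) ∧ ∫ y, |f y| / ‖x - y‖ ^ p ≤ A := by
  obtain ⟨M, hM⟩ := (isCompact_closedBall (0 : E n) (r + 1)).exists_bound_of_continuousOn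
    hc.continuousOn
  refine ⟨M * ballMoment n p + ∫ y, |f y|, fun x hx => integrable_div_norm_pow hp hf
    fun y hy => hM y ?_⟩
  rw [mem_closedBall_zero_iff]
  rw [mem_ball_iff_norm] at hy
  calc ‖y‖ = ‖(y - x) + x‖ := by rw [sub_add_cancel]
    _ ≤ ‖y - x‖ + ‖x‖ := norm_add_le _ _
    _ ≤ r + 1 := by linarith

theorem integrable_div_norm {n : ℕ} (hn : 1 < n) {f : E n → ℝ} (hf : Integrable f)
    (hc : Continuous f) (x : E n) : Integrable (fun y => |f y| / ‖x - y‖) := by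
  obtain ⟨A, hA⟩ := exists_bound_div_norm_pow hn hf hc ‖x‖
  simpa using (hA x le_rfl).1

/-! ### The two-scale logarithmic kernel. -/

theorem radialLaplacian_sub {n : ℕ} {ψ φ : ℝ → ℝ} (hψ : ContDiff ℝ ∞ ψ) (hφ : ContDiff ℝ ∞ φ) :
    radialLaplacian n (fun t => ψ t - φ t)
      = fun t => radialLaplacian n ψ t - radialLaplacian n φ t := by
  have h1 : deriv (fun t => ψ t - φ t) = fun t => deriv ψ t - deriv φ t := funext fun t =>
    deriv_fun_sub (hψ.differentiable (by simp) t) (hφ.differentiable (by simp) t)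
  ext t
  simp only [radialLaplacian, h1]
  rw [deriv_fun_sub ((contDiff_deriv hψ).differentiable (by simp) t)
    ((contDiff_deriv hφ).differentiable (by simp) t)]
  ring

theorem iterate_radialLaplacian_sub {n : ℕ} (m : ℕ) {ψ φ : ℝ → ℝ} (hψ : ContDiff ℝ ∞ ψ)
    (hφ : ContDiff ℝ ∞ φ) : (radialLaplacian n)^[m] (fun t => ψ t - φ t)
      = fun t => (radialLaplacian n)^[m] ψ t - (radialLaplacian n)^[m] φ t := by
  induction m generalizing ψ φ with
  | zero => rfl
  | succ m ih =>
    simp only [Function.iterate_succ_apply]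
    rw [radialLaplacian_sub hψ hφ, ih (contDiff_radialLaplacian n hψ)
      (contDiff_radialLaplacian n hφ)]

theorem radialLaplacian_comp_mul {n : ℕ} (ψ : ℝ → ℝ) (a : ℝ) :
    radialLaplacian n (fun t => ψ (a * t)) = fun t => a * radialLaplacian n ψ (a * t) := by
  have h : ∀ φ : ℝ → ℝ, deriv (fun t => φ (a * t)) = fun t => a * deriv φ (a * t) := fun φ => by
    ext t
    simpa using deriv_comp_mul_left a φ t
  ext t
  simp only [radialLaplacian, h]
  rw [deriv_const_mul_field, h]
  ring

theorem radialLaplacian_const_mul {n : ℕ} (ψ : ℝ → ℝ) (a : ℝ) :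
    radialLaplacian n (fun t => a * ψ t) = fun t => a * radialLaplacian n ψ t := by
  have h : ∀ φ : ℝ → ℝ, deriv (fun t => a * φ t) = fun t => a * deriv φ t := fun φ => by
    ext t
    exact deriv_const_mul_field a
  ext t
  simp only [radialLaplacian, h]
  ring

theorem iterate_radialLaplacian_const_mul {n : ℕ} (m : ℕ) (ψ : ℝ → ℝ) (a : ℝ) :
    (radialLaplacian n)^[m] (fun t => a * ψ t) = fun t => a * (radialLaplacian n)^[m] ψ t := by
  induction m generalizing ψ with
  | zero => rfl
  | succ m ih =>
    rw [Function.iterate_succ_apply, radialLaplacian_const_mul, ih, Function.iterate_succ_apply]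

theorem iterate_radialLaplacian_comp_mul {n : ℕ} (m : ℕ) (ψ : ℝ → ℝ) (a : ℝ) :
    (radialLaplacian n)^[m] (fun t => ψ (a * t))
      = fun t => a ^ m * (radialLaplacian n)^[m] ψ (a * t) := by
  induction m generalizing ψ with
  | zero => simp
  | succ m ih =>
    rw [Function.iterate_succ_apply, radialLaplacian_comp_mul, iterate_radialLaplacian_const_mul,
      ih, Function.iterate_succ_apply]
    ext t
    ring

theorem iterate_radialLaplacian_add_const {n m : ℕ} (ψ : ℝ → ℝ) (c : ℝ) :
    (radialLaplacian n)^[m + 1] (fun t => ψ t + c) = (radialLaplacian n)^[m + 1] ψ := by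
  rw [Function.iterate_succ_apply, Function.iterate_succ_apply]
  congr 1
  ext t
  simp [radialLaplacian]

/-- The compactly supported kernel `λ(N² t) - λ(t / N²) - log N⁴`, where `λ` is `smoothLog`. -/
noncomputable def logKernel (N : ℝ) (t : ℝ) : ℝ :=
  (smoothLog (N ^ 2 * t) + -(4 * Real.log N)) - smoothLog ((N ^ 2)⁻¹ * t)

theorem contDiff_smoothLog_mul (a : ℝ) : ContDiff ℝ ∞ fun t => smoothLog (a * t) :=
  contDiff_smoothLog.comp (contDiff_const.mul contDiff_id)

theorem contDiff_logKernel (N : ℝ) : ContDiff ℝ ∞ (logKernel N) :=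
  ((contDiff_smoothLog_mul _).add contDiff_const).sub (contDiff_smoothLog_mul _)

/-- Both arguments of `smoothLog` are at least 1 here, and the logarithms differ by exactly 4 log N.
As `t` is a squared distance, the kernel lives in a ball of radius N. -/
theorem logKernel_eq_zero {N t : ℝ} (hN : 1 ≤ N) (ht : N ^ 2 ≤ t) : logKernel N t = 0 := by
  have hN2 : 1 ≤ N ^ 2 := one_le_pow₀ hN
  have ht0 : 0 < t := by linarith
  have h1 : 1 ≤ N ^ 2 * t := by nlinarith
  have h2 : 1 ≤ (N ^ 2)⁻¹ * t := by
    rw [le_inv_mul_iff₀ (by linarith), mul_one]; exact ht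
  have hN0 : N ^ 2 ≠ 0 := by positivity
  rw [logKernel, smoothLog_of_one_le h1, smoothLog_of_one_le h2, Real.log_mul hN0 ht0.ne',
    Real.log_mul (inv_ne_zero hN0) ht0.ne', Real.log_inv, Real.log_pow]
  push_cast
  ring

/-- The prefactors are the mass-preserving ones in dimension 2(m+1). The first term concentrates at
scale 1/N and reproduces point values; the second averages at scale N and will vanish in the limit.
-/
theorem iterate_radialLaplacian_logKernel (m : ℕ) (N : ℝ) :
    (radialLaplacian (2 * (m + 1)))^[m + 1] (logKernel N) = fun t =>
      (N ^ 2) ^ (m + 1) * bump (m + 1) (N ^ 2 * t)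
        - ((N ^ 2)⁻¹) ^ (m + 1) * bump (m + 1) ((N ^ 2)⁻¹ * t) := by
  unfold logKernel
  rw [iterate_radialLaplacian_sub _ ((contDiff_smoothLog_mul _).add contDiff_const)
    (contDiff_smoothLog_mul _), iterate_radialLaplacian_add_const,
    iterate_radialLaplacian_comp_mul, iterate_radialLaplacian_comp_mul]
  rfl

theorem deriv_logKernel (N t : ℝ) : deriv (logKernel N) t
    = N ^ 2 * deriv smoothLog (N ^ 2 * t) - (N ^ 2)⁻¹ * deriv smoothLog ((N ^ 2)⁻¹ * t) := by
  have hd : ∀ a, DifferentiableAt ℝ (fun t => smoothLog (a * t)) t := fun a =>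
    (contDiff_smoothLog_mul a).differentiable (by simp) t
  have h : ∀ a, deriv (fun t => smoothLog (a * t)) t = a * deriv smoothLog (a * t) := fun a => by
    simpa using deriv_comp_mul_left a smoothLog t
  unfold logKernel
  rw [deriv_fun_sub ((hd _).add_const _) (hd _), deriv_add_const, h, h]

/-- Uniformity in N comes from the scale invariance of the bound C/t. It supplies the dominating
function in `tendsto_integral_deriv_logKernel`. -/
theorem exists_abs_deriv_logKernel_le : ∃ C, 0 ≤ C ∧ ∀ N t : ℝ, 0 < N → 0 < t →
    |deriv (logKernel N) t| ≤ C / t := by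
  obtain ⟨C, hC0, hC⟩ := exists_abs_deriv_smoothLog_le
  refine ⟨2 * C, by positivity, fun N t hN ht => ?_⟩
  have h : ∀ a, 0 < a → |a * deriv smoothLog (a * t)| ≤ C / t := fun a ha => by
    rw [abs_mul, abs_of_pos ha]
    refine (mul_le_mul_of_nonneg_left (hC (a * t) (by positivity)) ha.le).trans (le_of_eq ?_)
    field_simp
  rw [deriv_logKernel]
  refine (abs_sub _ _).trans ((add_le_add (h _ (by positivity)) (h _ (by positivity))).trans
    (le_of_eq (by ring)))

theorem tendsto_deriv_logKernel {t : ℝ} (ht : 0 < t) :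
    Filter.Tendsto (fun N => deriv (logKernel N) t) Filter.atTop (nhds t⁻¹) := by
  have hsq : Filter.Tendsto (fun N : ℝ => N ^ 2) Filter.atTop Filter.atTop :=
    Filter.tendsto_pow_atTop (by norm_num)
  have h1 : Filter.Tendsto (fun N : ℝ => N ^ 2 * deriv smoothLog (N ^ 2 * t)) Filter.atTop
      (nhds t⁻¹) := by
    refine tendsto_const_nhds.congr' ?_
    filter_upwards [hsq.eventually (Filter.eventually_gt_atTop (max 0 t⁻¹))] with N hN
    have h0 : 0 < N ^ 2 := (le_max_left _ _).trans_lt hN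
    have h2 : t⁻¹ < N ^ 2 := (le_max_right _ _).trans_lt hN
    rw [deriv_smoothLog (by rwa [← inv_lt_iff_one_lt_mul₀ ht]), mul_inv, mul_inv_cancel_left₀ h0.ne']
  have h2 : Filter.Tendsto (fun N : ℝ => (N ^ 2)⁻¹ * deriv smoothLog ((N ^ 2)⁻¹ * t)) Filter.atTop
      (nhds (0 * deriv smoothLog (0 * t))) := by
    have h3 := hsq.inv_tendsto_atTop
    exact h3.mul (((contDiff_deriv contDiff_smoothLog).continuous.tendsto _).comp
      (h3.mul_const t))
  simpa [deriv_logKernel] using h1.sub h2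

/-! ### The gradient as a Riesz potential. -/

theorem bump_norm_eq_zero {k n : ℕ} {z : E n} (hz : z ∉ Metric.closedBall 0 1) :
    bump (k + 2) (‖z‖ ^ 2) = 0 := by
  rw [mem_closedBall_zero_iff, not_le] at hz
  exact bump_eq_zero (one_le_pow₀ hz.le)

theorem exists_abs_bump_le (k n : ℕ) :
    ∃ B, 0 ≤ B ∧ ∀ z : E n, |bump (k + 2) (‖z‖ ^ 2)| ≤ B := by
  have hc : Continuous fun z : E n => bump (k + 2) (‖z‖ ^ 2) :=
    (contDiff_bump _).continuous.comp (by fun_prop)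
  obtain ⟨B, hB⟩ := hc.bounded_above_of_compact_support
    (HasCompactSupport.intro (isCompact_closedBall _ _) fun z hz => bump_norm_eq_zero hz)
  exact ⟨B, (norm_nonneg _).trans (hB 0), hB⟩

/-- Rescaled bumps concentrate at their centre. -/
theorem tendsto_integral_bump_mul {k n : ℕ} (hn : n = 2 * (k + 2)) {w : E n → ℝ} (hw : Continuous w)
    (x : E n) :
    Filter.Tendsto (fun N : ℝ => ∫ y, (N ^ 2) ^ (k + 2) * bump (k + 2) (N ^ 2 * ‖y - x‖ ^ 2) * w y)
      Filter.atTop (nhds ((∫ z : E n, bump (k + 2) (‖z‖ ^ 2)) * w x)) := by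
  obtain ⟨B, hB0, hB⟩ := exists_abs_bump_le k n
  obtain ⟨M, hM⟩ := (isCompact_closedBall x 1).exists_bound_of_continuousOn hw.continuousOn
  have hM0 : 0 ≤ M := (norm_nonneg _).trans (hM x (Metric.mem_closedBall_self zero_le_one))
  have h1 : ∀ N : ℝ, 0 < N → ∫ y, (N ^ 2) ^ (k + 2) * bump (k + 2) (N ^ 2 * ‖y - x‖ ^ 2) * w y
      = ∫ z : E n, bump (k + 2) (‖z‖ ^ 2) * w (x + N⁻¹ • z) := by
    intro N hN
    have h2 := Measure.integral_comp_smul (volume : Measure (E n))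
      (fun z => bump (k + 2) (‖z‖ ^ 2) * w (x + N⁻¹ • z)) N
    rw [finrank_euclideanSpace_fin, abs_of_pos (by positivity), smul_eq_mul] at h2
    have h3 : ∫ z : E n, bump (k + 2) (‖z‖ ^ 2) * w (x + N⁻¹ • z)
        = N ^ n * ∫ z : E n, bump (k + 2) (‖N • z‖ ^ 2) * w (x + N⁻¹ • N • z) := by
      rw [h2, mul_inv_cancel_left₀ (by positivity)]
    rw [h3, ← integral_sub_right_eq_self (fun z => bump (k + 2) (‖N • z‖ ^ 2) *
      w (x + N⁻¹ • N • z)) x, ← integral_const_mul]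
    refine integral_congr_ae (Filter.Eventually.of_forall fun y => ?_)
    simp only [smul_smul, inv_mul_cancel₀ hN.ne', one_smul, add_sub_cancel, norm_smul,
      Real.norm_of_nonneg hN.le, mul_pow]
    rw [← pow_mul, ← hn]
    ring_nf
  rw [← integral_mul_const]
  refine (tendsto_integral_filter_of_dominated_convergence
    (fun z => (Metric.closedBall (0 : E n) 1).indicator (fun _ => B * M) z) ?_ ?_ ?_ ?_).congr'
    ((Filter.eventually_gt_atTop 0).mono fun N hN => (h1 N hN).symm)
  · refine Filter.Eventually.of_forall fun N => Continuous.aestronglyMeasurable ?_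
    exact ((contDiff_bump _).continuous.comp (by fun_prop)).mul (hw.comp (by fun_prop))
  · filter_upwards [Filter.eventually_ge_atTop 1] with N hN
    refine Filter.Eventually.of_forall fun z => ?_
    by_cases hz : z ∈ Metric.closedBall (0 : E n) 1
    · rw [Set.indicator_of_mem hz, norm_mul]
      refine mul_le_mul (hB z) (hM _ ?_) (norm_nonneg _) hB0
      rw [mem_closedBall_zero_iff] at hz
      rw [Metric.mem_closedBall, dist_eq_norm, add_sub_cancel_left, norm_smul, norm_inv,
        Real.norm_of_nonneg (by linarith)]
      exact mul_le_one₀ (inv_le_one_of_one_le₀ hN) (norm_nonneg _) hz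
    · rw [Set.indicator_of_notMem hz, bump_norm_eq_zero hz, zero_mul, norm_zero]
  · rw [integrable_indicator_iff Metric.isClosed_closedBall.measurableSet]
    exact integrableOn_const measure_closedBall_lt_top.ne
  · refine Filter.Eventually.of_forall fun z => Filter.Tendsto.const_mul _ ?_
    have h4 : Filter.Tendsto (fun N : ℝ => x + N⁻¹ • z) Filter.atTop (nhds (x + (0 : ℝ) • z)) :=
      (tendsto_inv_atTop_zero.smul_const z).const_add x
    rw [zero_smul, add_zero] at h4
    exact (hw.tendsto x).comp h4

/-- Averages of a function of average growth `O(R⁻¹)` over large balls vanish in the limit. -/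
theorem tendsto_integral_bump_mul_zero {k n : ℕ} (hn : n = 2 * (k + 2)) {w : E n → ℝ} (hw : Continuous w)
    {C : ℝ} (hC : ∀ R : ℝ, 1 ≤ R →
      ∫ y in Metric.closedBall 0 R, |w y| ≤ C * R ^ (n - 1)) (x : E n) :
    Filter.Tendsto (fun N : ℝ =>
        ∫ y, ((N ^ 2)⁻¹) ^ (k + 2) * bump (k + 2) ((N ^ 2)⁻¹ * ‖y - x‖ ^ 2) * w y)
      Filter.atTop (nhds 0) := by
  obtain ⟨B, hB0, hB⟩ := exists_abs_bump_le k n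
  have hC0 : 0 ≤ C := by
    have := (integral_nonneg (μ := volume.restrict (Metric.closedBall (0 : E n) 1))
      (f := fun y => |w y|) fun y => abs_nonneg _).trans (hC 1 le_rfl)
    simpa using this
  -- Once N ≥ ‖x‖, the support of the rescaled bump lies in the ball of radius 2N about 0. The
  -- prefactor N⁻ⁿ against growth Nⁿ⁻¹ leaves N⁻¹.
  have hbound : ∀ N : ℝ, 1 ≤ N → ‖x‖ ≤ N →
      |∫ y, ((N ^ 2)⁻¹) ^ (k + 2) * bump (k + 2) ((N ^ 2)⁻¹ * ‖y - x‖ ^ 2) * w y|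
        ≤ B * C * 2 ^ (n - 1) * N⁻¹ := by
    intro N hN hxN
    have hN0 : 0 < N := by linarith
    have hi : IntegrableOn (fun y => |w y|) (Metric.closedBall (0 : E n) (2 * N)) :=
      hw.abs.continuousOn.integrableOn_compact (isCompact_closedBall _ _)
    have hb : ∀ y, bump (k + 2) ((N ^ 2)⁻¹ * ‖y - x‖ ^ 2)
        = bump (k + 2) (‖N⁻¹ • (y - x)‖ ^ 2) := fun y => by
      rw [norm_smul, mul_pow, norm_inv, Real.norm_of_nonneg hN0.le, inv_pow]
    have h1 : |∫ y, ((N ^ 2)⁻¹) ^ (k + 2) * bump (k + 2) ((N ^ 2)⁻¹ * ‖y - x‖ ^ 2) * w y|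
        ≤ ∫ y, (Metric.closedBall (0 : E n) (2 * N)).indicator
            (fun y => (N ^ n)⁻¹ * B * |w y|) y := by
      rw [← Real.norm_eq_abs]
      refine norm_integral_le_of_norm_le ((integrable_indicator_iff
        Metric.isClosed_closedBall.measurableSet).2 (hi.const_mul _))
        (Filter.Eventually.of_forall fun y => ?_)
      rw [hb]
      by_cases hy : y ∈ Metric.closedBall (0 : E n) (2 * N)
      · rw [Set.indicator_of_mem hy, norm_mul, norm_mul, inv_pow, ← pow_mul, ← hn, norm_inv,
          norm_pow, Real.norm_of_nonneg hN0.le]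
        have := hB (N⁻¹ • (y - x))
        rw [← Real.norm_eq_abs] at this
        rw [← Real.norm_eq_abs]
        gcongr
      · rw [Set.indicator_of_notMem hy, bump_norm_eq_zero, mul_zero, zero_mul, norm_zero]
        intro hy'
        apply hy
        rw [mem_closedBall_zero_iff] at hy' ⊢
        rw [norm_smul, norm_inv, Real.norm_of_nonneg hN0.le, inv_mul_le_iff₀ hN0] at hy'
        calc ‖y‖ = ‖(y - x) + x‖ := by rw [sub_add_cancel]
          _ ≤ ‖y - x‖ + ‖x‖ := norm_add_le _ _
          _ ≤ 2 * N := by linarith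
    refine h1.trans ?_
    rw [integral_indicator Metric.isClosed_closedBall.measurableSet, integral_const_mul]
    have h2 := hC (2 * N) (by linarith)
    calc (N ^ n)⁻¹ * B * ∫ y in Metric.closedBall (0 : E n) (2 * N), |w y|
        ≤ (N ^ n)⁻¹ * B * (C * (2 * N) ^ (n - 1)) := by gcongr
      _ = _ := by
        have : N ^ n = N ^ (n - 1) * N := by rw [← pow_succ]; congr 1; omega
        rw [this, mul_pow]
        field_simp
  refine (tendsto_zero_iff_abs_tendsto_zero _).2 (squeeze_zero' (Filter.Eventually.of_forall fun _ => abs_nonneg _)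
    (g := fun N : ℝ => B * C * 2 ^ (n - 1) * N⁻¹) ?_ ?_)
  · filter_upwards [Filter.eventually_ge_atTop 1, Filter.eventually_ge_atTop ‖x‖] with N h1 h2
      using hbound N h1 h2
  · simpa using tendsto_inv_atTop_zero.const_mul (B * C * 2 ^ (n - 1))

theorem abs_coord_le_norm {n : ℕ} (z : E n) (i : Fin n) : |z i| ≤ ‖z‖ := by
  simpa using PiLp.norm_apply_le z i

theorem tendsto_integral_deriv_logKernel {n : ℕ} (hn : 1 < n) {F : E n → ℝ} (hF : Integrable F)
    (hc : Continuous F) (i : Fin n) (x : E n) :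
    Filter.Tendsto (fun N : ℝ => ∫ y, 2 * (y - x) i * deriv (logKernel N) (‖y - x‖ ^ 2) * F y)
      Filter.atTop (nhds (∫ y, 2 * (y - x) i * (‖y - x‖ ^ 2)⁻¹ * F y)) := by
  obtain ⟨C, hC0, hC⟩ := exists_abs_deriv_logKernel_le
  have : Nontrivial (E n) := by
    have : Nonempty (Fin n) := ⟨i⟩
    infer_instance
  refine tendsto_integral_filter_of_dominated_convergence
    (fun y => 2 * C * (|F y| / ‖x - y‖)) ?_ ?_ ((integrable_div_norm hn hF hc x).const_mul _) ?_
  · refine Filter.Eventually.of_forall fun N => Continuous.aestronglyMeasurable ?_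
    have := (contDiff_deriv (contDiff_logKernel N)).continuous
    have h2 : Continuous fun y : E n => (y - x) i :=
      (EuclideanSpace.proj i : E n →L[ℝ] ℝ).continuous.comp (continuous_id.sub continuous_const)
    exact ((continuous_const.mul h2).mul (this.comp (by fun_prop))).mul hc
  · filter_upwards [Filter.eventually_gt_atTop 0] with N hN
    refine Filter.Eventually.of_forall fun y => ?_
    rcases eq_or_ne y x with rfl | hy
    · simp
    · have hy0 : 0 < ‖y - x‖ := norm_pos_iff.2 (sub_ne_zero.2 hy)
      have h1 := hC N (‖y - x‖ ^ 2) hN (by positivity)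
      rw [norm_mul, norm_mul, norm_mul, Real.norm_eq_abs, Real.norm_eq_abs, Real.norm_eq_abs,
        Real.norm_eq_abs, abs_two, norm_sub_rev x y]
      calc 2 * |(y - x) i| * |deriv (logKernel N) (‖y - x‖ ^ 2)| * |F y|
          ≤ 2 * ‖y - x‖ * (C / ‖y - x‖ ^ 2) * |F y| := by
            gcongr; exact abs_coord_le_norm _ _
        _ = _ := by field_simp
  · have h0 : ∀ᵐ y : E n, y ≠ x := by simp [ae_iff, measure_singleton]
    filter_upwards [h0] with y hy
    have hy0 : 0 < ‖y - x‖ := norm_pos_iff.2 (sub_ne_zero.2 hy)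
    exact ((tendsto_deriv_logKernel (by positivity)).const_mul _).mul_const _

/-- The integral of `logKernel` against ∂ᵢ of the iterated Laplacian of `u` is computed in two ways:
moving only ∂ᵢ onto the kernel, or commuting derivatives and moving all the Laplacians. -/
theorem integral_logKernel_mul {k n : ℕ} (hn : n = 2 * (k + 2)) {u : E n → ℝ} (hu : ContDiff ℝ ∞ u)
    (i : Fin n) (x : E n) {N : ℝ} (hN : 1 ≤ N) :
    -∫ y, 2 * (y - x) i * deriv (logKernel N) (‖y - x‖ ^ 2) * (Laplacian.laplacian^[k + 2] u) y
      = (∫ y, (N ^ 2) ^ (k + 2) * bump (k + 2) (N ^ 2 * ‖y - x‖ ^ 2) * partialDeriv i u y)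
      - ∫ y, ((N ^ 2)⁻¹) ^ (k + 2) * bump (k + 2) ((N ^ 2)⁻¹ * ‖y - x‖ ^ 2) * partialDeriv i u y := by
  have hN0 : 0 < N := by linarith
  have hk : (radialLaplacian n)^[k + 2] (logKernel N) = fun t =>
      (N ^ 2) ^ (k + 2) * bump (k + 2) (N ^ 2 * t)
        - ((N ^ 2)⁻¹) ^ (k + 2) * bump (k + 2) ((N ^ 2)⁻¹ * t) := by
    rw [hn]; exact iterate_radialLaplacian_logKernel (k + 1) N
  have hh := contDiff_radial (contDiff_logKernel N) x
  have hhc : HasCompactSupport fun y => logKernel N (‖y - x‖ ^ 2) := by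
    refine HasCompactSupport.intro (isCompact_closedBall x N) fun y hy => ?_
    rw [Metric.mem_closedBall, dist_eq_norm, not_le] at hy
    exact logKernel_eq_zero hN (by gcongr)
  have h1 := integral_mul_partialDeriv i hh hhc (contDiff_iterate_laplacian (k + 2) hu)
  simp only [partialDeriv_radial i (contDiff_logKernel N)] at h1
  rw [← h1, ← iterate_laplacian_partialDeriv _ i hu,
    integral_mul_iterate_laplacian _ hh hhc (contDiff_partialDeriv i hu),
    iterate_laplacian_radial _ (contDiff_logKernel N), hk]
  have hw := (contDiff_partialDeriv i hu).continuous
  have hint : ∀ a : ℝ, 0 < a → Integrable fun y : E n =>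
      a ^ (k + 2) * bump (k + 2) (a * ‖y - x‖ ^ 2) * partialDeriv i u y := by
    intro a ha
    have hb : Continuous fun y : E n => a ^ (k + 2) * bump (k + 2) (a * ‖y - x‖ ^ 2) :=
      continuous_const.mul ((contDiff_bump _).continuous.comp (by fun_prop))
    refine (hb.mul hw).integrable_of_hasCompactSupport (HasCompactSupport.mul_right ?_)
    refine HasCompactSupport.intro (isCompact_closedBall x (√a)⁻¹) fun y hy => ?_
    rw [Metric.mem_closedBall, dist_eq_norm, not_le, inv_lt_iff_one_lt_mul₀ (by positivity)] at hy
    rw [bump_eq_zero, mul_zero]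
    have h3 : (√a) ^ 2 = a := Real.sq_sqrt ha.le
    calc (1 : ℝ) ≤ (‖y - x‖ * √a) ^ 2 := one_le_pow₀ (by linarith)
      _ = a * ‖y - x‖ ^ 2 := by rw [mul_pow, h3, mul_comm]
  rw [← integral_sub (hint _ (by positivity)) (hint _ (by positivity))]
  refine integral_congr_ae (Filter.Eventually.of_forall fun y => ?_)
  exact sub_mul _ _ _

/-- The gradient of `u` as a Riesz potential of its Q-curvature density. -/
theorem critConst_mul_partialDeriv {k n : ℕ} (hn : n = 2 * (k + 2)) {u : E n → ℝ} (hu : ContDiff ℝ ∞ u)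
    (hF : Integrable (Laplacian.laplacian^[k + 2] u)) {C : ℝ}
    (hC : ∀ R : ℝ, 1 ≤ R →
      ∫ y in Metric.closedBall 0 R, ‖gradient u y‖ ≤ C * R ^ (n - 1))
    (i : Fin n) (x : E n) :
    critConst n * partialDeriv i u x
      = ∫ y, (y - x) i * (‖y - x‖ ^ 2)⁻¹ * ((-1) ^ k * (Laplacian.laplacian^[k + 2] u) y) := by
  have hw := (contDiff_partialDeriv i hu).continuous
  have hC' : ∀ R : ℝ, 1 ≤ R → ∫ y in Metric.closedBall 0 R, |partialDeriv i u y|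
      ≤ C * R ^ (n - 1) := fun R hR => by
    refine le_trans (setIntegral_mono_on ?_ ?_ Metric.isClosed_closedBall.measurableSet
      fun y _ => ?_) (hC R hR)
    · exact hw.abs.continuousOn.integrableOn_compact (isCompact_closedBall _ _)
    · exact (continuous_gradient hu).norm.continuousOn.integrableOn_compact
        (isCompact_closedBall _ _)
    · rw [partialDeriv_eq_gradient]
      exact abs_coord_le_norm _ _
  have h1 := (tendsto_integral_bump_mul hn hw x).sub (tendsto_integral_bump_mul_zero hn hw hC' x)
  have h2 := (tendsto_integral_deriv_logKernel (by omega) hF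
    (contDiff_iterate_laplacian _ hu).continuous i x).neg
  -- The two sides of `integral_logKernel_mul` have these limits as N tends to infinity; equating
  -- them is the representation formula, up to constants.
  have h3 := tendsto_nhds_unique (h1.congr' ((Filter.eventually_ge_atTop 1).mono fun N hN =>
    (integral_logKernel_mul hn hu i x hN).symm)) h2
  have h6 : ∫ z : E n, bump (k + 2) (‖z‖ ^ 2) = -2 * (-1) ^ k * critConst n := by
    subst hn; exact integral_bump_eq_critConst k
  rw [h6, sub_zero] at h3
  have h4 : ∫ y, (y - x) i * (‖y - x‖ ^ 2)⁻¹ * ((-1) ^ k * (Laplacian.laplacian^[k + 2] u) y)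
      = (-1) ^ k * (1 / 2) *
        ∫ y, 2 * (y - x) i * (‖y - x‖ ^ 2)⁻¹ * (Laplacian.laplacian^[k + 2] u) y := by
    rw [← integral_const_mul]
    refine integral_congr_ae (Filter.Eventually.of_forall fun y => ?_)
    simp only
    ring
  have h5 : ((-1 : ℝ) ^ k) * (-1) ^ k = 1 := by rw [← mul_pow]; norm_num
  rw [h4]
  linear_combination (-(1 / 2) * (-1) ^ k) * h3 - critConst n * partialDeriv i u x * h5

/-! ### Blow-down of the gradient. -/

/-- The measure `|f| dx`. -/
noncomputable def absMeasure {n : ℕ} (f : E n → ℝ) : Measure (E n) :=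
  volume.withDensity fun y => ‖f y‖ₑ

theorem lintegral_absMeasure {n : ℕ} {f : E n → ℝ} (hf : Continuous f) (g : E n → ENNReal) :
    ∫⁻ y, g y ∂absMeasure f = ∫⁻ y, ‖f y‖ₑ * g y :=
  lintegral_withDensity_eq_lintegral_mul_non_measurable _ hf.measurable.enorm
    (Filter.Eventually.of_forall fun _ => enorm_lt_top) g

theorem isFiniteMeasure_absMeasure {n : ℕ} {f : E n → ℝ} (hf : Integrable f) :
    IsFiniteMeasure (absMeasure f) :=
  isFiniteMeasure_withDensity hf.2.ne

/-- The kernel `z / ‖z‖²`. -/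
noncomputable def rieszKernel {n : ℕ} (z : E n) : E n := (‖z‖ ^ 2)⁻¹ • z

theorem norm_rieszKernel {n : ℕ} (z : E n) : ‖rieszKernel z‖ = ‖z‖⁻¹ := by
  rcases eq_or_ne z 0 with rfl | hz
  · simp [rieszKernel]
  · have : ‖z‖ ≠ 0 := norm_ne_zero_iff.2 hz
    rw [rieszKernel, norm_smul, norm_inv, norm_pow, norm_norm]
    field_simp

/-- The kernel is inversion in the unit sphere, and this is how inversion distorts distances. -/
theorem norm_rieszKernel_sub {n : ℕ} {x y : E n} (hx : x ≠ 0) (hy : y ≠ 0) :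
    ‖rieszKernel x - rieszKernel y‖ = ‖x - y‖ / (‖x‖ * ‖y‖) := by
  have h := dist_div_norm_sq_smul hx hy 1
  simp only [one_pow, one_div, inv_pow] at h
  rw [← dist_eq_norm, rieszKernel, rieszKernel, h, dist_eq_norm]
  ring

theorem rieszKernel_smul {n : ℕ} {r : ℝ} (hr : r ≠ 0) (z : E n) :
    r • rieszKernel (r • z) = rieszKernel z := by
  simp only [rieszKernel, norm_smul, mul_pow, smul_smul]
  congr 1
  rw [Real.norm_eq_abs, sq_abs]
  field_simp

theorem rieszKernel_neg {n : ℕ} (z : E n) : rieszKernel (-z) = -rieszKernel z := by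
  simp [rieszKernel]

theorem measurable_rieszKernel {n : ℕ} : Measurable (rieszKernel : E n → E n) := by
  unfold rieszKernel; fun_prop

/-- The assertion that `-u` has the gradient of the logarithmic potential of `f`. -/
def IsLogPotential {n : ℕ} (u f : E n → ℝ) : Prop :=
  ∀ (i : Fin n) (x : E n), partialDeriv i u x = ∫ y, (y - x) i * (‖y - x‖ ^ 2)⁻¹ * f y

theorem integrable_smul_rieszKernel {n : ℕ} (hn : 1 < n) {f : E n → ℝ} (hf : Integrable f)
    (hc : Continuous f) (x : E n) : Integrable fun y => f y • rieszKernel (y - x) := by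
  refine (integrable_div_norm hn hf hc x).mono' ?_ (Filter.Eventually.of_forall fun y => ?_)
  · exact hc.aestronglyMeasurable.smul
      (measurable_rieszKernel.comp (measurable_id.sub_const x)).aestronglyMeasurable
  · rw [norm_smul, norm_rieszKernel, norm_sub_rev y x, Real.norm_eq_abs, div_eq_mul_inv]

theorem IsLogPotential.gradient_eq {n : ℕ} (hn : 1 < n) {u f : E n → ℝ} (h : IsLogPotential u f)
    (hf : Integrable f) (hc : Continuous f) (x : E n) :
    gradient u x = ∫ y, f y • rieszKernel (y - x) := by
  ext i
  rw [← partialDeriv_eq_gradient, h i x]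
  have h1 := (EuclideanSpace.proj i : E n →L[ℝ] ℝ).integral_comp_comm
    (integrable_smul_rieszKernel hn hf hc x)
  refine Eq.trans ?_ h1
  refine integral_congr_ae (Filter.Eventually.of_forall fun y => ?_)
  simp [rieszKernel]
  ring

/-- By homogeneity of the kernel K, the left side is the norm of ∫ f(y)(K(x) - K(x - y/R)) dy.
`norm_rieszKernel_sub` evaluates the difference, and ‖x‖ > 1 allows dropping a factor from the
denominator. -/
theorem IsLogPotential.enorm_smul_gradient_add_le {n : ℕ} (hn : 1 < n) {u f : E n → ℝ}
    (h : IsLogPotential u f) (hf : Integrable f) (hc : Continuous f) {R : ℝ} (hR : 0 < R)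
    {x : E n} (hx : 1 < ‖x‖) :
    ‖R • gradient u (R • x) + (∫ y, f y) • rieszKernel x‖ₑ
      ≤ ∫⁻ y, ENNReal.ofReal (‖R⁻¹ • y‖ / ‖x - R⁻¹ • y‖) ∂absMeasure f := by
  have hx0 : x ≠ 0 := fun h0 => by simp [h0] at hx; linarith
  have h1 : R • gradient u (R • x) + (∫ y, f y) • rieszKernel x
      = ∫ y, f y • (rieszKernel x - rieszKernel (x - R⁻¹ • y)) := by
    rw [h.gradient_eq hn hf hc, ← integral_smul, ← integral_smul_const, ← integral_add]
    · refine integral_congr_ae (Filter.Eventually.of_forall fun y => ?_)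
      simp only
      have h2 : y - R • x = R • (-(x - R⁻¹ • y)) := by
        rw [smul_neg, smul_sub, smul_smul, mul_inv_cancel₀ hR.ne', one_smul, neg_sub]
      rw [smul_comm R, h2, rieszKernel_smul hR.ne', rieszKernel_neg]
      module
    · exact (integrable_smul_rieszKernel hn hf hc _).smul R
    · exact hf.smul_const _
  rw [h1, lintegral_absMeasure hc]
  refine (enorm_integral_le_lintegral_enorm _).trans (lintegral_mono_ae ?_)
  have : Nontrivial (E n) := nontrivial_of_ne x 0 hx0
  have h0 : ∀ᵐ y : E n, y ≠ R • x := by simp [ae_iff, measure_singleton]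
  filter_upwards [h0] with y hy
  have hy' : x - R⁻¹ • y ≠ 0 := by
    intro h3
    apply hy
    rw [sub_eq_zero.1 h3, smul_smul, mul_inv_cancel₀ hR.ne', one_smul]
  rw [enorm_smul]
  refine mul_le_mul_right ?_ _
  rw [← ofReal_norm]
  refine ENNReal.ofReal_le_ofReal ?_
  rw [norm_rieszKernel_sub hx0 hy', sub_sub_cancel]
  have : 0 < ‖x - R⁻¹ • y‖ := norm_pos_iff.2 hy'
  refine div_le_div_of_nonneg_left (norm_nonneg _) this ?_
  exact le_mul_of_one_le_left this.le hx.le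

theorem sq_lintegral_le {X : Type*} [MeasurableSpace X] (ν : Measure X) {g : X → ENNReal}
    (hg : AEMeasurable g ν) : (∫⁻ y, g y ∂ν) ^ 2 ≤ ν Set.univ * ∫⁻ y, g y ^ 2 ∂ν := by
  have h := ENNReal.lintegral_mul_le_Lp_mul_Lq ν Real.HolderConjugate.two_two
    (f := fun _ => 1) aemeasurable_const hg
  simp only [Pi.mul_apply, one_mul, ENNReal.one_rpow, lintegral_const] at h
  calc (∫⁻ y, g y ∂ν) ^ 2
      ≤ ((ν Set.univ) ^ (1 / 2 : ℝ) * (∫⁻ y, g y ^ (2 : ℝ) ∂ν) ^ (1 / 2 : ℝ)) ^ 2 := by gcongr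
    _ = _ := by
      rw [mul_pow, ← ENNReal.rpow_natCast, ← ENNReal.rpow_natCast, ← ENNReal.rpow_mul,
        ← ENNReal.rpow_mul]
      simp

/-- The quantity `‖z‖² ∫_B ‖x - z‖⁻² dx`. -/
noncomputable def ballEnergy {n : ℕ} (B : Set (E n)) (z : E n) : ENNReal :=
  ∫⁻ x in B, ENNReal.ofReal (‖z‖ ^ 2 / ‖x - z‖ ^ 2)

/-- For ‖z‖ ≤ 6 this is local integrability of ‖x‖⁻², valid as n > 2; for ‖z‖ > 6 the integrand is
at most 4, since `B` lies in the ball of radius 3. The first bound serves as dominating function,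
the second gives decay at z = y/R as R grows. -/
theorem exists_ballEnergy_le {n : ℕ} (hn : 2 < n) {B : Set (E n)} (hB : MeasurableSet B)
    (hB3 : ∀ x ∈ B, ‖x‖ ≤ 3) : ∃ A : ℝ, 0 ≤ A ∧
      (∀ z, ballEnergy B z ≤ ENNReal.ofReal A) ∧
      ∀ z, ballEnergy B z ≤ ENNReal.ofReal (‖z‖ ^ 2 * A) := by
  have hBv : volume B < ⊤ := (measure_mono fun x hx => mem_closedBall_zero_iff.2 (hB3 x hx)).trans_lt
    (measure_closedBall_lt_top (x := (0 : E n)) (r := 3))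
  have hi : Integrable (B.indicator fun _ => (1 : ℝ)) :=
    (integrable_indicator_iff hB).2 (integrableOn_const hBv.ne)
  have hpot := fun z : E n => integrable_div_norm_pow hn hi (x := z) (M := 1) fun y _ => by
    by_cases hy : y ∈ B <;> simp [hy]
  set A0 : ℝ := 1 * ballMoment n 2 + ∫ y, |B.indicator (fun _ => (1 : ℝ)) y| with hA0
  have hA0n : 0 ≤ A0 :=
    add_nonneg (mul_nonneg zero_le_one (ballMoment_nonneg _ _)) (integral_nonneg fun _ => abs_nonneg _)
  have h1 : ∀ z, ballEnergy B z ≤ ENNReal.ofReal (‖z‖ ^ 2 * A0) := by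
    intro z
    have h2 : ballEnergy B z
        = ∫⁻ x, ENNReal.ofReal (‖z‖ ^ 2 * (|B.indicator (fun _ => (1 : ℝ)) x| / ‖z - x‖ ^ 2)) := by
      rw [ballEnergy, ← lintegral_indicator hB]
      refine lintegral_congr fun x => ?_
      by_cases hx : x ∈ B
      · simp [hx, norm_sub_rev, div_eq_mul_inv]
      · simp [hx]
    rw [h2, ← ofReal_integral_eq_lintegral_ofReal ((hpot z).1.const_mul _)
      (Filter.Eventually.of_forall fun x => by positivity), integral_const_mul]
    exact ENNReal.ofReal_le_ofReal (mul_le_mul_of_nonneg_left (hpot z).2 (by positivity))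
  have hv0 : 0 ≤ volume.real B := ENNReal.toReal_nonneg
  refine ⟨36 * A0 + 4 * volume.real B, by positivity, fun z => ?_, fun z => (h1 z).trans
    (ENNReal.ofReal_le_ofReal (mul_le_mul_of_nonneg_left (by linarith) (by positivity)))⟩
  rcases le_or_gt ‖z‖ 6 with hz | hz
  · refine (h1 z).trans (ENNReal.ofReal_le_ofReal ?_)
    have : ‖z‖ ^ 2 ≤ 36 := by nlinarith [norm_nonneg z]
    nlinarith
  · have h3 : ballEnergy B z ≤ ∫⁻ _ in B, ENNReal.ofReal 4 := by
      refine setLIntegral_mono measurable_const fun x hx => ENNReal.ofReal_le_ofReal ?_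
      have h4 : ‖z‖ ≤ 2 * ‖x - z‖ := by
        have := norm_sub_norm_le z x
        rw [norm_sub_rev] at this
        linarith [hB3 x hx]
      have h5 : 0 < ‖x - z‖ := by linarith
      rw [div_le_iff₀ (by positivity)]
      nlinarith [norm_nonneg z]
    refine h3.trans ?_
    rw [setLIntegral_const, ← ENNReal.ofReal_toReal hBv.ne, ← ENNReal.ofReal_mul (by norm_num)]
    refine ENNReal.ofReal_le_ofReal ?_
    change 4 * volume.real B ≤ _
    linarith

theorem measurable_ballEnergy {n : ℕ} (B : Set (E n)) :
    Measurable (ballEnergy B) := by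
  unfold ballEnergy
  exact Measurable.lintegral_prod_right' (f := fun p : E n × E n =>
    ENNReal.ofReal (‖p.1‖ ^ 2 / ‖p.2 - p.1‖ ^ 2)) (by fun_prop)

theorem continuous_smul_gradient_smul {n : ℕ} {u : E n → ℝ} (hu : ContDiff ℝ ∞ u) (R : ℝ) :
    Continuous fun x => R • gradient u (R • x) :=
  ((continuous_gradient hu).comp (continuous_const_smul R)).const_smul R

theorem continuousOn_rieszKernel {n : ℕ} {B : Set (E n)} (hB : ∀ x ∈ B, 1 < ‖x‖) :
    ContinuousOn (rieszKernel : E n → E n) B := by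
  unfold rieszKernel
  refine ContinuousOn.smul (ContinuousOn.inv₀ (continuous_norm.pow 2).continuousOn fun x hx => ?_) continuousOn_id
  exact pow_ne_zero 2 (zero_lt_one.trans (hB x hx)).ne'

theorem continuousOn_smul_gradient_add {n : ℕ} {u : E n → ℝ} (hu : ContDiff ℝ ∞ u) {B : Set (E n)}
    (hB : ∀ x ∈ B, 1 < ‖x‖) (R α : ℝ) :
    ContinuousOn (fun x => R • gradient u (R • x) + α • rieszKernel x) B :=
  (continuous_smul_gradient_smul hu R).continuousOn.add ((continuousOn_rieszKernel hB).const_smul α)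

/-- The rescaled gradients converge in `L²` to the gradient of `-α log ‖x‖`. -/
theorem IsLogPotential.tendsto_integral_sq {n : ℕ} (hn : 2 < n) {u f : E n → ℝ}
    (hu : ContDiff ℝ ∞ u)
    (h : IsLogPotential u f) (hf : Integrable f) (hc : Continuous f) {B : Set (E n)}
    (hBc : IsCompact B) (hB : ∀ x ∈ B, 1 < ‖x‖) (hB3 : ∀ x ∈ B, ‖x‖ ≤ 3) :
    Filter.Tendsto (fun R : ℝ =>
        ∫ x in B, ‖R • gradient u (R • x) + (∫ y, f y) • rieszKernel x‖ ^ 2)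
      Filter.atTop (nhds 0) := by
  have := isFiniteMeasure_absMeasure hf
  have hBm := hBc.measurableSet
  obtain ⟨A, hA0, hA1, hA2⟩ := exists_ballEnergy_le hn hBm hB3
  have h1 : Filter.Tendsto (fun R : ℝ => ∫⁻ y, ballEnergy B (R⁻¹ • y) ∂absMeasure f)
      Filter.atTop (nhds (∫⁻ _, 0 ∂absMeasure f)) := by
    refine tendsto_lintegral_filter_of_dominated_convergence (fun _ => ENNReal.ofReal A) ?_ ?_ ?_ ?_
    · exact Filter.Eventually.of_forall fun R =>
        (measurable_ballEnergy B).comp (measurable_const_smul _)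
    · exact Filter.Eventually.of_forall fun R => Filter.Eventually.of_forall fun y => hA1 _
    · rw [lintegral_const]
      exact (ENNReal.mul_lt_top ENNReal.ofReal_lt_top (measure_lt_top _ _)).ne
    · refine Filter.Eventually.of_forall fun y => ?_
      refine tendsto_of_tendsto_of_tendsto_of_le_of_le tendsto_const_nhds ?_ (fun _ => zero_le)
        fun R => hA2 (R⁻¹ • y)
      rw [← ENNReal.ofReal_zero]
      refine ENNReal.tendsto_ofReal ?_
      have h2 : Filter.Tendsto (fun R : ℝ => R⁻¹ • y) Filter.atTop (nhds ((0 : ℝ) • y)) :=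
        tendsto_inv_atTop_zero.smul_const y
      have h3 := (h2.norm.pow 2).mul_const A
      simpa using h3
  rw [lintegral_zero] at h1
  have h2 : Filter.Tendsto (fun R : ℝ => absMeasure f Set.univ *
      ∫⁻ y, ballEnergy B (R⁻¹ • y) ∂absMeasure f) Filter.atTop (nhds 0) := by
    simpa using ENNReal.Tendsto.const_mul h1 (Or.inr (measure_ne_top (absMeasure f) Set.univ))
  -- Cauchy–Schwarz in `y` against the finite measure |f| dy, then Tonelli.
  have h3 : ∀ R : ℝ, 0 < R →
      ∫⁻ x in B, ENNReal.ofReal (‖R • gradient u (R • x) + (∫ y, f y) • rieszKernel x‖ ^ 2)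
        ≤ absMeasure f Set.univ * ∫⁻ y, ballEnergy B (R⁻¹ • y) ∂absMeasure f := by
    intro R hR
    have hm : Measurable fun p : E n × E n =>
        ENNReal.ofReal (‖R⁻¹ • p.2‖ ^ 2 / ‖p.1 - R⁻¹ • p.2‖ ^ 2) := by fun_prop
    have h4 : ∫⁻ y, ballEnergy B (R⁻¹ • y) ∂absMeasure f
        = ∫⁻ x in B, ∫⁻ y, ENNReal.ofReal (‖R⁻¹ • y‖ ^ 2 / ‖x - R⁻¹ • y‖ ^ 2) ∂absMeasure f := by
      rw [lintegral_lintegral_swap hm.aemeasurable]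
      rfl
    rw [h4, ← lintegral_const_mul _ hm.lintegral_prod_right']
    refine setLIntegral_mono (hm.lintegral_prod_right'.const_mul _) fun x hx => ?_
    have h5 := h.enorm_smul_gradient_add_le (by omega) hf hc hR (hB x hx)
    rw [ENNReal.ofReal_pow (norm_nonneg _), ofReal_norm]
    refine (pow_le_pow_left' h5 2).trans ((sq_lintegral_le _ ?_).trans (le_of_eq ?_))
    · exact (by fun_prop : Measurable fun y : E n =>
        ENNReal.ofReal (‖R⁻¹ • y‖ / ‖x - R⁻¹ • y‖)).aemeasurable
    · congr 2
      ext y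
      rw [← ENNReal.ofReal_pow (by positivity), div_pow]
  have h8 : ∀ R : ℝ, ∫ x in B, ‖R • gradient u (R • x) + (∫ y, f y) • rieszKernel x‖ ^ 2
      = (∫⁻ x in B, ENNReal.ofReal
          (‖R • gradient u (R • x) + (∫ y, f y) • rieszKernel x‖ ^ 2)).toReal := by
    intro R
    exact integral_eq_lintegral_of_nonneg_ae (Filter.Eventually.of_forall fun x => sq_nonneg _)
      (((continuousOn_smul_gradient_add hu hB R _).norm.pow 2).aestronglyMeasurable hBm)
  simp only [h8]
  rw [← ENNReal.toReal_zero]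
  refine (ENNReal.tendsto_toReal ENNReal.zero_ne_top).comp ?_
  refine tendsto_of_tendsto_of_tendsto_of_le_of_le' tendsto_const_nhds h2
    (Filter.Eventually.of_forall fun _ => bot_le) ?_
  filter_upwards [Filter.eventually_gt_atTop 0] with R hR using h3 R hR

/-! ### Weak limit of the rescaled scalar curvature. -/

theorem partialDeriv_comp_smul {n : ℕ} {u : E n → ℝ} (hu : ContDiff ℝ ∞ u) (r : ℝ) (i : Fin n) :
    partialDeriv i (fun y => u (r • y)) = fun x => r * partialDeriv i u (r • x) := by
  ext x
  rw [partialDeriv_eq_gradient, gradient_comp_smul hu, partialDeriv_eq_gradient]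
  simp

theorem contDiff_comp_smul {n : ℕ} {u : E n → ℝ} (hu : ContDiff ℝ ∞ u) (r : ℝ) :
    ContDiff ℝ ∞ fun y => u (r • y) := hu.comp (contDiff_const_smul r)

theorem laplacian_comp_smul {n : ℕ} {u : E n → ℝ} (hu : ContDiff ℝ ∞ u) (r : ℝ) (x : E n) :
    Laplacian.laplacian (fun y => u (r • y)) x = r ^ 2 * Laplacian.laplacian u (r • x) := by
  rw [laplacian_eq_sum hu, laplacian_eq_sum (contDiff_comp_smul hu r), Finset.mul_sum]
  refine Finset.sum_congr rfl fun i _ => ?_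
  rw [partialDeriv_comp_smul hu]
  have h := contDiff_partialDeriv i hu
  have h2 : (fun x => r * partialDeriv i u (r • x))
      = fun x => (fun y => r * partialDeriv i u y) (r • x) := rfl
  rw [h2, partialDeriv_comp_smul (contDiff_const.mul h)]
  have h3 : partialDeriv i (fun y => r * partialDeriv i u y) (r • x)
      = r * partialDeriv i (partialDeriv i u) (r • x) := by
    unfold partialDeriv at h ⊢
    rw [fderiv_const_mul (h.differentiable (by simp) _)]
    simp
  simp only [h3]
  ring

theorem gradient_smoothLog {n : ℕ} {x : E n} (hx : 1 < ‖x‖) :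
    gradient (fun y : E n => smoothLog (‖y - 0‖ ^ 2)) x = (2 : ℝ) • rieszKernel x := by
  ext i
  rw [← partialDeriv_eq_gradient, partialDeriv_radial i contDiff_smoothLog, sub_zero,
    deriv_smoothLog (one_lt_pow₀ hx (by norm_num))]
  simp [rieszKernel]
  ring

theorem laplacian_smoothLog {n : ℕ} {x : E n} (hx : 1 < ‖x‖) :
    Laplacian.laplacian (fun y : E n => smoothLog (‖y - 0‖ ^ 2)) x
      = 2 * (n - 2) * (‖x‖ ^ 2)⁻¹ := by
  rw [laplacian_radial contDiff_smoothLog]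
  have h := iterate_radialLaplacian_smoothLog n 0 (t := ‖x - 0‖ ^ 2)
    (by rw [sub_zero]; exact one_lt_pow₀ hx (by norm_num))
  simp only [zero_add, Function.iterate_one] at h
  refine h.trans ?_
  rw [sub_zero, Finset.prod_range_zero, Nat.cast_zero, zero_add, zpow_neg_one]
  ring

theorem setIntegral_eq_of_support {n : ℕ} {B : Set (E n)} {F : E n → ℝ}
    (h : ∀ x, x ∉ B → F x = 0) : ∫ x, F x = ∫ x in B, F x :=
  (setIntegral_eq_integral_of_forall_compl_eq_zero h).symm

theorem gradient_eq_zero_of_notMem {n : ℕ} {B : Set (E n)} (hB : IsClosed B) {φ : E n → ℝ}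
    (h : ∀ x, x ∉ B → φ x = 0) {x : E n} (hx : x ∉ B) : gradient φ x = 0 := by
  have h0 : φ =ᶠ[nhds x] fun _ => 0 := by
    filter_upwards [hB.isOpen_compl.mem_nhds hx] with y hy using h y hy
  rw [← norm_eq_zero, norm_gradient, h0.fderiv_eq]
  simp

/-- On `B` the kernel is half the gradient of `smoothLog` of ‖x‖², and its divergence is (n-2)/‖x‖².
Using the globally smooth function avoids any boundary term at the origin. -/
theorem setIntegral_inner_gradient_rieszKernel {n : ℕ} {B : Set (E n)} (hBc : IsCompact B)
    (hB : ∀ x ∈ B, 1 < ‖x‖) {φ : E n → ℝ} (hφ : ContDiff ℝ ∞ φ) (h0 : ∀ x, x ∉ B → φ x = 0) :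
    ∫ x in B, inner ℝ (gradient φ x) (rieszKernel x)
      = -(((n : ℝ) - 2) * ∫ x in B, φ x * (‖x‖ ^ 2)⁻¹) := by
  have hc : HasCompactSupport φ := HasCompactSupport.intro hBc h0
  have h := integral_mul_laplacian_eq_neg_inner hφ hc (contDiff_radial contDiff_smoothLog (0 : E n))
  rw [setIntegral_eq_of_support (B := B) fun x hx => by rw [h0 x hx, zero_mul],
    setIntegral_eq_of_support (B := B) fun x hx => by
      rw [gradient_eq_zero_of_notMem hBc.isClosed h0 hx, inner_zero_left]] at h
  have h1 : ∫ x in B, φ x * Laplacian.laplacian (fun y : E n => smoothLog (‖y - 0‖ ^ 2)) x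
      = 2 * (((n : ℝ) - 2) * ∫ x in B, φ x * (‖x‖ ^ 2)⁻¹) := by
    rw [← integral_const_mul, ← integral_const_mul]
    refine setIntegral_congr_fun hBc.measurableSet fun x hx => ?_
    simp only [laplacian_smoothLog (hB x hx)]
    ring
  have h2 : ∫ x in B, inner ℝ (gradient φ x)
        (gradient (fun y : E n => smoothLog (‖y - 0‖ ^ 2)) x)
      = 2 * ∫ x in B, inner ℝ (gradient φ x) (rieszKernel x) := by
    rw [← integral_const_mul]
    refine setIntegral_congr_fun hBc.measurableSet fun x hx => ?_
    simp only [gradient_smoothLog (hB x hx), inner_smul_right]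
  rw [h1, h2] at h
  linarith

/-- Convergence to zero in `L²` of a compact set implies convergence in `L¹`. -/
theorem tendsto_setIntegral_of_sq {n : ℕ} {B : Set (E n)} (hBc : IsCompact B) {h : ℝ → E n → ℝ}
    (hc : ∀ R, ContinuousOn (h R) B) (h0 : ∀ R x, 0 ≤ h R x)
    (hs : Filter.Tendsto (fun R => ∫ x in B, h R x ^ 2) Filter.atTop (nhds 0)) :
    Filter.Tendsto (fun R => ∫ x in B, h R x) Filter.atTop (nhds 0) := by
  have hBv : volume B < ⊤ := hBc.measure_lt_top
  set s : ℝ → ℝ := fun R => ∫ x in B, h R x ^ 2 with hsdef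
  have hs0 : ∀ R, 0 ≤ s R := fun R => integral_nonneg fun x => sq_nonneg _
  have hsq : Filter.Tendsto (fun R => √(s R)) Filter.atTop (nhds 0) := by
    simpa using hs.sqrt
  have hlim : Filter.Tendsto (fun R : ℝ => (√(s R) + R⁻¹) * volume.real B + √(s R))
      Filter.atTop (nhds 0) := by
    simpa using ((hsq.add tendsto_inv_atTop_zero).mul_const (volume.real B)).add hsq
  refine squeeze_zero' (Filter.Eventually.of_forall fun R => integral_nonneg fun x => h0 R x) ?_ hlim
  filter_upwards [Filter.eventually_gt_atTop 0] with R hR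
  have hRi : 0 < R⁻¹ := inv_pos.2 hR
  have hq := Real.sqrt_nonneg (s R)
  -- The near-optimal weight in h ≤ δ + h²/δ; the summand R⁻¹ keeps it positive when the L² norm
  -- vanishes.
  set δ := √(s R) + R⁻¹ with hδ
  have hδ0 : 0 < δ := by positivity
  have hi2 : IntegrableOn (fun x => h R x ^ 2) B := ((hc R).pow 2).integrableOn_compact hBc
  have hci : IntegrableOn (fun _ : E n => δ) B := integrableOn_const hBv.ne
  have h1 : ∫ x in B, h R x ≤ ∫ x in B, (δ + δ⁻¹ * h R x ^ 2) := by
    refine setIntegral_mono_on ((hc R).integrableOn_compact hBc)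
      (hci.add (hi2.const_mul _)) hBc.measurableSet fun x _ => ?_
    have h2 : δ + δ⁻¹ * h R x ^ 2 - h R x = δ⁻¹ * (h R x - δ / 2) ^ 2 + 3 / 4 * δ := by
      field_simp; ring
    have : 0 ≤ δ⁻¹ * (h R x - δ / 2) ^ 2 + 3 / 4 * δ := by positivity
    linarith
  rw [integral_add hci (hi2.const_mul _), setIntegral_const,
    integral_const_mul, smul_eq_mul, mul_comm] at h1
  refine h1.trans (add_le_add_right ?_ _)
  rw [inv_mul_le_iff₀ hδ0]
  change s R ≤ _
  have := Real.mul_self_sqrt (hs0 R)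
  have h3 : 0 ≤ R⁻¹ * √(s R) := by positivity
  rw [hδ, add_mul]
  linarith

/-- The rescaled integrals of `-Δu - (n-2)/2 ‖∇u‖²`, which is a multiple of `R_g e^{2u}`. -/
theorem IsLogPotential.tendsto_energy {n : ℕ} (hn : 2 < n) {u f : E n → ℝ}
    (hu : ContDiff ℝ ∞ u) (h : IsLogPotential u f) (hf : Integrable f) (hc : Continuous f)
    {B : Set (E n)} (hBc : IsCompact B) (hB : ∀ x ∈ B, 1 < ‖x‖) (hB3 : ∀ x ∈ B, ‖x‖ ≤ 3)
    {φ : E n → ℝ} (hφ : ContDiff ℝ ∞ φ) (h0 : ∀ x, x ∉ B → φ x = 0) (hφ0 : ∀ x, 0 ≤ φ x)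
    (hφ1 : ∀ x, φ x ≤ 1) :
    Filter.Tendsto (fun R : ℝ => ∫ x in B, φ x * (R ^ 2 * (-Laplacian.laplacian u (R • x)
        - ((n : ℝ) - 2) / 2 * ‖gradient u (R • x)‖ ^ 2)))
      Filter.atTop (nhds (((n : ℝ) - 2) * ((∫ y, f y) - (∫ y, f y) ^ 2 / 2) *
        ∫ x in B, φ x * (‖x‖ ^ 2)⁻¹)) := by
  set α := ∫ y, f y with hα
  set D : ℝ → E n → E n := fun R x => R • gradient u (R • x) + α • rieszKernel x with hD
  have hBm := hBc.measurableSet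
  have hcφ : HasCompactSupport φ := HasCompactSupport.intro hBc h0
  obtain ⟨M, hM0, hM⟩ := exists_norm_gradient_le hφ hcφ
  have hDc : ∀ R, ContinuousOn (D R) B := fun R => continuousOn_smul_gradient_add hu hB R α
  have hKc := continuousOn_rieszKernel hB
  have hgc : ContinuousOn (gradient φ) B := (continuous_gradient hφ).continuousOn
  have hφc : ContinuousOn φ B := hφ.continuous.continuousOn
  have hs : Filter.Tendsto (fun R => ∫ x in B, ‖D R x‖ ^ 2) Filter.atTop (nhds 0) :=
    h.tendsto_integral_sq hn hu hf hc hBc hB hB3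
  have hs1 : Filter.Tendsto (fun R => ∫ x in B, ‖D R x‖) Filter.atTop (nhds 0) :=
    tendsto_setIntegral_of_sq hBc (fun R => (hDc R).norm) (fun R x => norm_nonneg _) hs
  -- Everything that involves the remainder `D` after substituting R∇u(Rx) = D - αK, where K is
  -- `rieszKernel`. It is at most quadratic in `D`, so L¹ and L² convergence of `D` make its
  -- integral vanish.
  set err : ℝ → E n → ℝ := fun R x => inner ℝ (gradient φ x) (D R x)
    - ((n : ℝ) - 2) / 2 * (φ x * (‖D R x‖ ^ 2 - 2 * α * inner ℝ (D R x) (rieszKernel x))) with herr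
  have hn2 : (0 : ℝ) ≤ ((n : ℝ) - 2) / 2 := by
    have : (2 : ℝ) < n := by exact_mod_cast hn
    linarith
  have herr0 : Filter.Tendsto (fun R => ∫ x in B, err R x) Filter.atTop (nhds 0) := by
    have hlim : Filter.Tendsto (fun R => (M + ((n : ℝ) - 2) / 2 * (2 * |α|)) * (∫ x in B, ‖D R x‖)
        + ((n : ℝ) - 2) / 2 * ∫ x in B, ‖D R x‖ ^ 2) Filter.atTop (nhds 0) := by
      simpa using (hs1.const_mul (M + ((n : ℝ) - 2) / 2 * (2 * |α|))).add
        (hs.const_mul (((n : ℝ) - 2) / 2))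
    refine squeeze_zero_norm (fun R => ?_) hlim
    have hi1 : IntegrableOn (fun x => ‖D R x‖) B := (hDc R).norm.integrableOn_compact hBc
    have hi2 : IntegrableOn (fun x => ‖D R x‖ ^ 2) B :=
      ((hDc R).norm.pow 2).integrableOn_compact hBc
    rw [← integral_const_mul, ← integral_const_mul, ← integral_add (hi1.const_mul _)
      (hi2.const_mul _)]
    refine norm_integral_le_of_norm_le ((hi1.const_mul _).add (hi2.const_mul _)) ?_
    filter_upwards [ae_restrict_mem hBm] with x hx
    have h1 : |inner ℝ (gradient φ x) (D R x)| ≤ M * ‖D R x‖ :=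
      (abs_real_inner_le_norm _ _).trans (mul_le_mul_of_nonneg_right (hM x) (norm_nonneg _))
    have h2 : |inner ℝ (D R x) (rieszKernel x)| ≤ ‖D R x‖ := by
      refine (abs_real_inner_le_norm _ _).trans (mul_le_of_le_one_right (norm_nonneg _) ?_)
      rw [norm_rieszKernel]
      exact inv_le_one_of_one_le₀ (hB x hx).le
    have h3 : |‖D R x‖ ^ 2 - 2 * α * inner ℝ (D R x) (rieszKernel x)|
        ≤ ‖D R x‖ ^ 2 + 2 * |α| * ‖D R x‖ := by
      refine (abs_sub _ _).trans (add_le_add (by rw [abs_of_nonneg (sq_nonneg _)]) ?_)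
      rw [abs_mul, abs_mul, abs_two]
      gcongr
    rw [Real.norm_eq_abs]
    calc |err R x| ≤ |inner ℝ (gradient φ x) (D R x)| + |((n : ℝ) - 2) / 2 *
          (φ x * (‖D R x‖ ^ 2 - 2 * α * inner ℝ (D R x) (rieszKernel x)))| := abs_sub _ _
      _ ≤ M * ‖D R x‖ + ((n : ℝ) - 2) / 2 * (1 * (‖D R x‖ ^ 2 + 2 * |α| * ‖D R x‖)) := by
        rw [abs_mul, abs_mul, abs_of_nonneg hn2, abs_of_nonneg (hφ0 x)]
        have := hφ1 x
        have := hφ0 x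
        gcongr
      _ = _ := by ring
  -- An exact identity. The Laplacian is moved onto φ, so only first derivatives of `u` must
  -- converge; the terms free of `D` contribute (n-2)α from -Δ and (n-2)α²/2 from the square.
  have hmain : ∀ R : ℝ, ∫ x in B, φ x * (R ^ 2 * (-Laplacian.laplacian u (R • x)
        - ((n : ℝ) - 2) / 2 * ‖gradient u (R • x)‖ ^ 2))
      = (∫ x in B, err R x) + ((n : ℝ) - 2) * (α - α ^ 2 / 2) *
        ∫ x in B, φ x * (‖x‖ ^ 2)⁻¹ := by
    intro R
    have huR := contDiff_comp_smul hu R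
    have e1 := integral_mul_laplacian_eq_neg_inner hφ hcφ huR
    rw [setIntegral_eq_of_support (B := B) fun x hx => by rw [h0 x hx, zero_mul],
      setIntegral_eq_of_support (B := B) fun x hx => by
        rw [gradient_eq_zero_of_notMem hBc.isClosed h0 hx, inner_zero_left]] at e1
    simp only [laplacian_comp_smul hu, gradient_comp_smul hu] at e1
    have hgR : ContinuousOn (fun x => R • gradient u (R • x)) B :=
      (continuous_smul_gradient_smul hu R).continuousOn
    have hLc : ContinuousOn (fun x => φ x * (R ^ 2 * Laplacian.laplacian u (R • x))) B :=
      (hφ.continuous.mul (continuous_const.mul ((contDiff_laplacian hu).continuous.comp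
        (continuous_const_smul R)))).continuousOn
    have hGc : ContinuousOn (fun x => φ x * ‖R • gradient u (R • x)‖ ^ 2) B :=
      hφc.mul (hgR.norm.pow 2)
    have hIc : ContinuousOn (fun x => φ x * (‖x‖ ^ 2)⁻¹) B := by
      refine hφc.mul (ContinuousOn.inv₀ (continuous_norm.pow 2).continuousOn fun x hx => ?_)
      exact pow_ne_zero 2 (zero_lt_one.trans (hB x hx)).ne'
    have e2 : ∫ x in B, φ x * (R ^ 2 * (-Laplacian.laplacian u (R • x)
          - ((n : ℝ) - 2) / 2 * ‖gradient u (R • x)‖ ^ 2))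
        = -(∫ x in B, φ x * (R ^ 2 * Laplacian.laplacian u (R • x)))
          - ((n : ℝ) - 2) / 2 * ∫ x in B, φ x * ‖R • gradient u (R • x)‖ ^ 2 := by
      have hLi : IntegrableOn (fun x => -(φ x * (R ^ 2 * Laplacian.laplacian u (R • x)))) B :=
        (hLc.integrableOn_compact hBc).neg
      rw [← integral_neg, ← integral_const_mul, ← integral_sub hLi ((hGc.integrableOn_compact hBc).const_mul _)]
      refine setIntegral_congr_fun hBm fun x _ => ?_
      simp only [norm_smul, mul_pow, Real.norm_eq_abs, sq_abs]
      ring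
    have e3 := setIntegral_inner_gradient_rieszKernel hBc hB hφ h0
    rw [e2, e1, neg_neg]
    have hi1 : IntegrableOn (fun x => inner ℝ (gradient φ x) (R • gradient u (R • x))) B :=
      (hgc.inner hgR).integrableOn_compact hBc
    have hi2 : IntegrableOn (fun x => inner ℝ (gradient φ x) (rieszKernel x)) B :=
      (hgc.inner hKc).integrableOn_compact hBc
    have e4 : (∫ x in B, err R x) = (∫ x in B, inner ℝ (gradient φ x) (R • gradient u (R • x)))
        + α * (∫ x in B, inner ℝ (gradient φ x) (rieszKernel x))
        - ((n : ℝ) - 2) / 2 * ((∫ x in B, φ x * ‖R • gradient u (R • x)‖ ^ 2)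
          - α ^ 2 * ∫ x in B, φ x * (‖x‖ ^ 2)⁻¹) := by
      have hi3 : IntegrableOn (fun x => inner ℝ (gradient φ x) (R • gradient u (R • x))
          + α * inner ℝ (gradient φ x) (rieszKernel x)) B := hi1.add (hi2.const_mul α)
      have hi4 : IntegrableOn (fun x => φ x * ‖R • gradient u (R • x)‖ ^ 2
          - α ^ 2 * (φ x * (‖x‖ ^ 2)⁻¹)) B :=
        (hGc.integrableOn_compact hBc).sub ((hIc.integrableOn_compact hBc).const_mul _)
      rw [← integral_const_mul α, ← integral_add hi1 (hi2.const_mul α), ← integral_const_mul (α ^ 2),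
        ← integral_sub (hGc.integrableOn_compact hBc) ((hIc.integrableOn_compact hBc).const_mul _),
        ← integral_const_mul, ← integral_sub hi3 (hi4.const_mul _)]
      refine setIntegral_congr_fun hBm fun x hx => ?_
      simp only [herr, hD]
      rw [inner_add_right, inner_smul_right _ (rieszKernel x), inner_add_left, norm_add_sq_real]
      simp only [inner_smul_left (rieszKernel x), inner_smul_right _ (rieszKernel x),
        conj_trivial, norm_smul α, real_inner_self_eq_norm_sq, mul_pow, norm_rieszKernel, inv_pow,
        Real.norm_eq_abs, sq_abs]
      ring
    rw [e4, e3]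
    ring
  simp only [hmain]
  simpa using herr0.add_const (((n : ℝ) - 2) * (α - α ^ 2 / 2) * ∫ x in B, φ x * (‖x‖ ^ 2)⁻¹)

/-! ### The logarithmic potential and its exponential integrability. -/

theorem inner_rieszKernel_le {n : ℕ} (z x : E n) : |inner ℝ (rieszKernel z) x| ≤ ‖x‖ / ‖z‖ := by
  refine (abs_real_inner_le_norm _ _).trans (le_of_eq ?_)
  rw [norm_rieszKernel, div_eq_inv_mul]

theorem hasDerivAt_log_norm_sub_smul {n : ℕ} {x y : E n} {t : ℝ} (h : y - t • x ≠ 0) :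
    HasDerivAt (fun t : ℝ => -(1 / 2) * Real.log (‖y - t • x‖ ^ 2))
      (inner ℝ (rieszKernel (y - t • x)) x) t := by
  have h1 : HasDerivAt (fun t : ℝ => y - t • x) (-x) t := by
    simpa using ((hasDerivAt_id t).smul_const x).const_sub y
  have h2 := h1.norm_sq
  have h3 : ‖y - t • x‖ ^ 2 ≠ 0 := pow_ne_zero 2 (norm_ne_zero_iff.2 h)
  refine ((h2.log h3).const_mul (-(1 / 2))).congr_deriv ?_
  rw [rieszKernel, inner_smul_left, inner_neg_right]
  simp
  ring

theorem integral_inner_rieszKernel {n : ℕ} {x y : E n} (h : ∀ t : ℝ, y - t • x ≠ 0) :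
    ∫ t in (0 : ℝ)..1, inner ℝ (rieszKernel (y - t • x)) x = Real.log ‖y‖ - Real.log ‖x - y‖ := by
  have hc : Continuous fun t : ℝ => inner ℝ (rieszKernel (y - t • x)) x := by
    have h0 : Continuous fun t : ℝ => y - t • x := by fun_prop
    refine Continuous.inner (Continuous.smul (Continuous.inv₀ (h0.norm.pow 2) fun t => ?_) h0)
      continuous_const
    exact pow_ne_zero 2 (norm_ne_zero_iff.2 (h t))
  rw [intervalIntegral.integral_eq_sub_of_hasDerivAt
    (fun t _ => hasDerivAt_log_norm_sub_smul (h t)) (hc.intervalIntegrable _ _)]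
  rw [zero_smul, sub_zero, one_smul, norm_sub_rev x y, Real.log_pow, Real.log_pow]
  push_cast
  ring

theorem ae_forall_sub_smul_ne_zero {n : ℕ} (hn : 1 < n) (x : E n) :
    ∀ᵐ y : E n, ∀ t : ℝ, y - t • x ≠ 0 := by
  have h : volume ((Submodule.span ℝ {x} : Submodule ℝ (E n)) : Set (E n)) = 0 := by
    refine Measure.addHaar_submodule _ _ fun htop => ?_
    have h1 := finrank_span_le_card (R := ℝ) ({x} : Set (E n))
    rw [htop, finrank_top, finrank_euclideanSpace_fin] at h1
    simp at h1
    omega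
  rw [ae_iff]
  refine measure_mono_null (fun y hy => ?_) h
  simp only [not_forall, not_not, Set.mem_ofPred_eq] at hy
  obtain ⟨t, ht⟩ := hy
  exact Submodule.mem_span_singleton.2 ⟨t, (sub_eq_zero.1 ht).symm⟩

/-- `u` is, up to an additive constant, the logarithmic potential of `f`. -/
theorem IsLogPotential.sub_eq {n : ℕ} (hn : 1 < n) {u f : E n → ℝ} (hu : ContDiff ℝ ∞ u)
    (h : IsLogPotential u f) (hf : Integrable f) (hc : Continuous f) (x : E n) :
    Integrable (fun y => f y * (Real.log ‖y‖ - Real.log ‖x - y‖)) ∧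
      u x - u 0 = ∫ y, f y * (Real.log ‖y‖ - Real.log ‖x - y‖) := by
  set g : ℝ → E n → ℝ := fun t y => f y * inner ℝ (rieszKernel (y - t • x)) x with hg
  obtain ⟨A, hA⟩ := exists_bound_div_norm_pow hn hf hc ‖x‖
  simp only [pow_one] at hA
  have hseg : ∀ t ∈ Set.Ioc (0 : ℝ) 1, ‖t • x‖ ≤ ‖x‖ := fun t ht => by
    rw [norm_smul, Real.norm_of_nonneg ht.1.le]
    exact mul_le_of_le_one_left (norm_nonneg _) ht.2
  have hgle : ∀ t y, ‖g t y‖ ≤ ‖x‖ * (|f y| / ‖t • x - y‖) := fun t y => by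
    rw [hg, norm_mul, Real.norm_eq_abs, Real.norm_eq_abs]
    calc |f y| * |inner ℝ (rieszKernel (y - t • x)) x|
        ≤ |f y| * (‖x‖ / ‖y - t • x‖) := by gcongr; exact inner_rieszKernel_le _ _
      _ = _ := by rw [norm_sub_rev]; ring
  have hgm : Measurable (Function.uncurry g) := by
    have h1 : Measurable fun p : ℝ × E n => inner ℝ (rieszKernel (p.2 - p.1 • x)) x := by
      unfold rieszKernel; fun_prop
    exact (hc.measurable.comp measurable_snd).mul h1
  have hgi1 : ∀ t ∈ Set.Ioc (0 : ℝ) 1, Integrable (g t) := fun t ht =>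
    ((hA _ (hseg t ht)).1.const_mul ‖x‖).mono'
      (hgm.comp measurable_prodMk_left).aestronglyMeasurable (Filter.Eventually.of_forall (hgle t))
  -- The gradient formula is integrated along the segment from 0 to `x`. Fubini applies because the
  -- Riesz potential of |f| is bounded by `A` on the whole segment.
  have hgi : Integrable (Function.uncurry g) ((volume.restrict (Set.Ioc (0 : ℝ) 1)).prod volume) := by
    rw [integrable_prod_iff hgm.aestronglyMeasurable]
    refine ⟨(ae_restrict_mem measurableSet_Ioc).mono hgi1, ?_⟩
    refine (integrable_const (‖x‖ * A)).mono'
      hgm.aestronglyMeasurable.norm.integral_prod_right' ?_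
    filter_upwards [ae_restrict_mem measurableSet_Ioc] with t ht
    rw [Real.norm_of_nonneg (integral_nonneg fun _ => norm_nonneg _)]
    calc ∫ y, ‖Function.uncurry g (t, y)‖ ≤ ∫ y, ‖x‖ * (|f y| / ‖t • x - y‖) :=
          integral_mono (hgi1 t ht).norm ((hA _ (hseg t ht)).1.const_mul _) (hgle t)
      _ ≤ ‖x‖ * A := by
          rw [integral_const_mul]
          exact mul_le_mul_of_nonneg_left (hA _ (hseg t ht)).2 (norm_nonneg _)
  have hin : ∀ᵐ y : E n, ∫ t in Set.Ioc (0 : ℝ) 1, g t y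
      = f y * (Real.log ‖y‖ - Real.log ‖x - y‖) := by
    filter_upwards [ae_forall_sub_smul_ne_zero hn x] with y hy
    rw [integral_const_mul, ← intervalIntegral.integral_of_le zero_le_one,
      integral_inner_rieszKernel hy]
  refine ⟨hgi.integral_prod_right.congr hin, ?_⟩
  rw [← integral_congr_ae hin, ← integral_integral_swap hgi]
  have hd : ∀ t : ℝ, HasDerivAt (fun t : ℝ => u (t • x)) (∫ y, g t y) t := by
    intro t
    have h1 : HasDerivAt (fun t : ℝ => t • x) x t := by
      simpa using (hasDerivAt_id t).smul_const x
    have h2 := ((hu.differentiable (by simp) (t • x)).hasFDerivAt).comp_hasDerivAt t h1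
    refine h2.congr_deriv ?_
    rw [fderiv_apply_eq_inner_gradient, h.gradient_eq hn hf hc, real_inner_comm,
      ← integral_inner (integrable_smul_rieszKernel hn hf hc _)]
    refine integral_congr_ae (Filter.Eventually.of_forall fun y => ?_)
    simp only [hg]
    rw [inner_smul_right, real_inner_comm]
  have hcont : Continuous fun t : ℝ => ∫ y, g t y := by
    have h3 : (fun t : ℝ => ∫ y, g t y) = fun t => inner ℝ (gradient u (t • x)) x := by
      ext t
      rw [← fderiv_apply_eq_inner_gradient]
      have h1 : HasDerivAt (fun t : ℝ => t • x) x t := by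
        simpa using (hasDerivAt_id t).smul_const x
      exact (hd t).unique
        (((hu.differentiable (by simp) (t • x)).hasFDerivAt).comp_hasDerivAt t h1)
    rw [h3]
    exact ((continuous_gradient hu).comp (by fun_prop)).inner continuous_const
  rw [← intervalIntegral.integral_of_le zero_le_one,
    intervalIntegral.integral_eq_sub_of_hasDerivAt (fun t _ => hd t) (hcont.intervalIntegrable _ _)]
  simp

theorem abs_log_le {t : ℝ} (ht : 0 < t) : |Real.log t| ≤ t + t⁻¹ := by
  have h1 := Real.log_le_sub_one_of_pos ht
  have h2 := Real.log_le_sub_one_of_pos (inv_pos.2 ht)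
  rw [Real.log_inv] at h2
  have := inv_pos.2 ht
  rw [abs_le]
  constructor <;> linarith

/-- If ‖y‖ ≤ r ≤ ‖x‖/2, then ‖x - y‖ and ‖x‖ agree up to a factor 2 and only log ‖y‖ remains. If ‖y‖
> r, the triangle inequality bounds both ratios. The growth in ‖x‖ and the singularity at y = x thus
occur only where ‖y‖ > r, where |f| has small mass. -/
theorem abs_log_ratio_le {n : ℕ} {x y : E n} {r : ℝ} (hr : 1 ≤ r) (hx : 2 * r ≤ ‖x‖) (hy : y ≠ 0)
    (hxy : x ≠ y) :
    |Real.log ‖y‖ - Real.log ‖x - y‖ + Real.log ‖x‖| ≤ (r + 1 + ‖y‖⁻¹)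
      + {y : E n | r < ‖y‖}.indicator (fun y => 2 * Real.log ‖x‖
        + Real.log (1 + ‖x‖ / ‖x - y‖)) y := by
  have hy0 : 0 < ‖y‖ := norm_pos_iff.2 hy
  have hd0 : 0 < ‖x - y‖ := norm_pos_iff.2 (sub_ne_zero.2 hxy)
  have hx0 : 0 < ‖x‖ := by linarith
  have hlog2 : Real.log 2 ≤ 1 := by
    have := Real.log_le_sub_one_of_pos (show (0 : ℝ) < 2 by norm_num); linarith
  have hlx : 0 ≤ Real.log ‖x‖ := Real.log_nonneg (by linarith)
  have hyi : 0 < ‖y‖⁻¹ := inv_pos.2 hy0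
  have tri1 : ‖x - y‖ ≤ ‖x‖ + ‖y‖ := norm_sub_le _ _
  have tri2 : ‖x‖ ≤ ‖x - y‖ + ‖y‖ := by simpa using norm_add_le (x - y) y
  have tri3 : ‖y‖ ≤ ‖x‖ + ‖x - y‖ := by simpa using norm_sub_le x (x - y)
  by_cases hyr : r < ‖y‖
  · have hmem : y ∈ {y : E n | r < ‖y‖} := hyr
    rw [Set.indicator_of_mem hmem]
    have hq : 0 ≤ Real.log (1 + ‖x‖ / ‖x - y‖) := Real.log_nonneg (by
      have : 0 ≤ ‖x‖ / ‖x - y‖ := by positivity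
      linarith)
    have up : Real.log ‖y‖ - Real.log ‖x - y‖ ≤ Real.log (1 + ‖x‖ / ‖x - y‖) := by
      rw [← Real.log_div hy0.ne' hd0.ne']
      refine Real.log_le_log (by positivity) ?_
      rw [div_le_iff₀ hd0, add_mul, div_mul_cancel₀ _ hd0.ne']
      linarith
    have low : Real.log ‖x - y‖ - Real.log ‖y‖ ≤ Real.log 2 + Real.log ‖x‖ := by
      rw [← Real.log_div hd0.ne' hy0.ne', ← Real.log_mul (by norm_num) hx0.ne']
      refine Real.log_le_log (by positivity) ?_
      rw [div_le_iff₀ hy0]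
      nlinarith
    rw [abs_le]
    constructor <;> linarith
  · have hnm : y ∉ {y : E n | r < ‖y‖} := hyr
    rw [Set.indicator_of_notMem hnm, add_zero]
    rw [not_lt] at hyr
    have h1 := abs_log_le hy0
    have h2 : |Real.log ‖x‖ - Real.log ‖x - y‖| ≤ Real.log 2 := by
      have h3 : Real.log ‖x‖ - Real.log ‖x - y‖ ≤ Real.log 2 := by
        rw [← Real.log_div hx0.ne' hd0.ne']
        refine Real.log_le_log (by positivity) ?_
        rw [div_le_iff₀ hd0]
        linarith
      have h4 : Real.log ‖x - y‖ - Real.log ‖x‖ ≤ Real.log 2 := by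
        rw [← Real.log_div hd0.ne' hx0.ne']
        refine Real.log_le_log (by positivity) ?_
        rw [div_le_iff₀ hx0]
        linarith
      rw [abs_le]
      constructor <;> linarith
    calc |Real.log ‖y‖ - Real.log ‖x - y‖ + Real.log ‖x‖|
        = |Real.log ‖y‖ + (Real.log ‖x‖ - Real.log ‖x - y‖)| := by congr 1; ring
      _ ≤ |Real.log ‖y‖| + |Real.log ‖x‖ - Real.log ‖x - y‖| := abs_add_le _ _
      _ ≤ _ := by linarith

theorem IsLogPotential.abs_add_log_le {n : ℕ} (hn : 1 < n) {u f : E n → ℝ} (hu : ContDiff ℝ ∞ u)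
    (h : IsLogPotential u f) (hf : Integrable f) (hc : Continuous f) {r ε : ℝ} (hr : 1 ≤ r)
    (hε : ∫ y in {y : E n | r < ‖y‖}, |f y| ≤ ε) : ∃ C : ℝ, ∀ x : E n, 2 * r ≤ ‖x‖ →
      |u x + (∫ y, f y) * Real.log ‖x‖| ≤ C + 2 * ε * Real.log ‖x‖
        + ∫ y in {y : E n | r < ‖y‖}, |f y| * Real.log (1 + ‖x‖ / ‖x - y‖) := by
  set T := {y : E n | r < ‖y‖} with hT
  have hTm : MeasurableSet T := measurableSet_lt measurable_const measurable_norm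
  have hI0 : Integrable fun y => |f y| * (r + 1 + ‖y‖⁻¹) := by
    have h1 := integrable_div_norm hn hf hc 0
    refine ((hf.abs.mul_const (r + 1)).add h1).congr (Filter.Eventually.of_forall fun y => ?_)
    simp only [Pi.add_apply, zero_sub, norm_neg]
    ring
  refine ⟨|u 0| + ∫ y, |f y| * (r + 1 + ‖y‖⁻¹), fun x hx => ?_⟩
  have hx1 : 1 ≤ ‖x‖ := by linarith
  have hlx : 0 ≤ Real.log ‖x‖ := Real.log_nonneg hx1
  obtain ⟨hi, he⟩ := h.sub_eq hn hu hf hc x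
  have hI1 : Integrable fun y => |f y| * Real.log (1 + ‖x‖ / ‖x - y‖) := by
    refine ((integrable_div_norm hn hf hc x).const_mul ‖x‖).mono' ?_
      (Filter.Eventually.of_forall fun y => ?_)
    · exact hf.abs.aestronglyMeasurable.mul
        (by fun_prop : Measurable fun y : E n => Real.log (1 + ‖x‖ / ‖x - y‖)).aestronglyMeasurable
    · have hq : 0 ≤ ‖x‖ / ‖x - y‖ := by positivity
      have h2 := Real.log_le_sub_one_of_pos (show 0 < 1 + ‖x‖ / ‖x - y‖ by linarith)
      have h3 : 0 ≤ Real.log (1 + ‖x‖ / ‖x - y‖) := Real.log_nonneg (by linarith)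
      rw [Real.norm_of_nonneg (by positivity)]
      calc |f y| * Real.log (1 + ‖x‖ / ‖x - y‖) ≤ |f y| * (‖x‖ / ‖x - y‖) := by
            gcongr; linarith
        _ = _ := by ring
  have hI2 : Integrable fun y => T.indicator (fun y => 2 * Real.log ‖x‖ * |f y|
      + |f y| * Real.log (1 + ‖x‖ / ‖x - y‖)) y :=
    ((hf.abs.const_mul _).add hI1).indicator hTm
  have h4 : u x + (∫ y, f y) * Real.log ‖x‖
      = u 0 + ∫ y, f y * (Real.log ‖y‖ - Real.log ‖x - y‖ + Real.log ‖x‖) := by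
    have : ∫ y, f y * (Real.log ‖y‖ - Real.log ‖x - y‖ + Real.log ‖x‖)
        = (∫ y, f y * (Real.log ‖y‖ - Real.log ‖x - y‖)) + (∫ y, f y) * Real.log ‖x‖ := by
      rw [← integral_mul_const, ← integral_add hi (hf.mul_const _)]
      refine integral_congr_ae (Filter.Eventually.of_forall fun y => ?_)
      simp only
      ring
    rw [this, ← he]
    ring
  have h5 : |∫ y, f y * (Real.log ‖y‖ - Real.log ‖x - y‖ + Real.log ‖x‖)|
      ≤ ∫ y, (|f y| * (r + 1 + ‖y‖⁻¹) + T.indicator (fun y => 2 * Real.log ‖x‖ * |f y|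
        + |f y| * Real.log (1 + ‖x‖ / ‖x - y‖)) y) := by
    rw [← Real.norm_eq_abs]
    refine norm_integral_le_of_norm_le (hI0.add hI2) ?_
    filter_upwards [ae_forall_sub_smul_ne_zero hn x] with y hy
    have hy0 : y ≠ 0 := by simpa using hy 0
    have hxy : x ≠ y := fun h0 => by simpa [h0] using hy 1
    rw [norm_mul, Real.norm_eq_abs, Real.norm_eq_abs]
    refine (mul_le_mul_of_nonneg_left (abs_log_ratio_le hr hx hy0 hxy) (abs_nonneg _)).trans ?_
    rw [mul_add]
    refine add_le_add le_rfl (le_of_eq ?_)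
    by_cases hyT : y ∈ T
    · rw [Set.indicator_of_mem hyT, Set.indicator_of_mem hyT]; ring
    · rw [Set.indicator_of_notMem hyT, Set.indicator_of_notMem hyT, mul_zero]
  rw [integral_add hI0 hI2, integral_indicator hTm,
    integral_add (hf.abs.const_mul _).integrableOn hI1.integrableOn, integral_const_mul] at h5
  rw [h4]
  refine (abs_add_le _ _).trans ?_
  have h6 := mul_le_mul_of_nonneg_left hε (show 0 ≤ 2 * Real.log ‖x‖ by linarith)
  linarith

/-- Jensen's inequality for `exp (2 ∫ log (1 + q))` against a measure of mass at most `1/2`. -/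
theorem exp_two_mul_integral_log_le {X : Type*} [MeasurableSpace X] (ν : Measure X)
    [IsFiniteMeasure ν] (hν : ν.real Set.univ ≤ 1 / 2) {q : X → ℝ} (hq : Measurable q)
    (hq0 : ∀ y, 0 ≤ q y) :
    ENNReal.ofReal (Real.exp (2 * ∫ y, Real.log (1 + q y) ∂ν))
      ≤ 1 + 2 * ∫⁻ y, ENNReal.ofReal (q y) ∂ν := by
  rcases eq_or_ne (∫⁻ y, ENNReal.ofReal (q y) ∂ν) ⊤ with htop | htop
  · rw [htop]; simp
  have hqi : Integrable q ν := by
    refine ⟨hq.aestronglyMeasurable, ?_⟩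
    rw [hasFiniteIntegral_iff_ofReal (Filter.Eventually.of_forall hq0)]
    exact lt_top_iff_ne_top.2 htop
  rw [← ofReal_integral_eq_lintegral_ofReal hqi (Filter.Eventually.of_forall hq0)]
  set Q := ∫ y, q y ∂ν with hQ
  have hQ0 : 0 ≤ Q := integral_nonneg hq0
  set M := ν.real Set.univ with hM
  have hM0 : 0 ≤ M := ENNReal.toReal_nonneg
  set s := 1 + 2 * Q with hs
  have hs0 : 0 < s := by linarith
  have hli : Integrable (fun y => Real.log (1 + q y)) ν := by
    refine hqi.mono' (by fun_prop : Measurable fun y => Real.log (1 + q y)).aestronglyMeasurable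
      (Filter.Eventually.of_forall fun y => ?_)
    have h1 := hq0 y
    have h2 := Real.log_le_sub_one_of_pos (show 0 < 1 + q y by linarith)
    rw [Real.norm_of_nonneg (Real.log_nonneg (by linarith))]
    linarith
  -- The concave function log lies below its tangent at s = 1 + 2Q. This choice makes the mass bound
  -- 1/2 turn the result into (log s)/2.
  have h1 : ∫ y, Real.log (1 + q y) ∂ν ≤ ∫ y, ((Real.log s - 1 + s⁻¹) + s⁻¹ * q y) ∂ν := by
    refine integral_mono hli ((integrable_const _).add (hqi.const_mul _)) fun y => ?_
    have h2 := hq0 y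
    have h3 := Real.log_le_sub_one_of_pos (show 0 < (1 + q y) / s by positivity)
    rw [Real.log_div (by linarith) hs0.ne'] at h3
    have h4 : (1 + q y) / s = s⁻¹ + s⁻¹ * q y := by field_simp
    simp only
    linarith
  rw [integral_add (integrable_const _) (hqi.const_mul _), integral_const, integral_const_mul,
    smul_eq_mul, ← hM, ← hQ] at h1
  have h5 : 1 - s⁻¹ ≤ Real.log s := Real.one_sub_inv_le_log_of_pos hs0
  have h6 : s⁻¹ * Q = (1 - s⁻¹) / 2 := by
    have : Q = (s - 1) / 2 := by rw [hs]; ring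
    rw [this]; field_simp
  have h7 : 2 * ∫ y, Real.log (1 + q y) ∂ν ≤ Real.log s := by
    rw [h6] at h1
    nlinarith
  calc ENNReal.ofReal (Real.exp (2 * ∫ y, Real.log (1 + q y) ∂ν))
      ≤ ENNReal.ofReal s := ENNReal.ofReal_le_ofReal (by
        rw [← Real.exp_log hs0]; exact Real.exp_le_exp.2 h7)
    _ = _ := by
      rw [hs, ENNReal.ofReal_add zero_le_one (by linarith), ENNReal.ofReal_mul (by norm_num)]
      simp

theorem tendsto_setIntegral_norm_gt {n : ℕ} {g : E n → ℝ} (hg : Integrable g) :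
    Filter.Tendsto (fun r : ℝ => ∫ y in {y : E n | r < ‖y‖}, g y) Filter.atTop (nhds 0) := by
  have hm : ∀ r : ℝ, MeasurableSet {y : E n | r < ‖y‖} := fun r =>
    measurableSet_lt measurable_const measurable_norm
  have h : Filter.Tendsto (fun r : ℝ => ∫ y, {y : E n | r < ‖y‖}.indicator g y) Filter.atTop
      (nhds (∫ _ : E n, (0 : ℝ))) := by
    refine tendsto_integral_filter_of_dominated_convergence (fun y => |g y|)
      (Filter.Eventually.of_forall fun r => (hg.indicator (hm r)).aestronglyMeasurable)
      (Filter.Eventually.of_forall fun r => Filter.Eventually.of_forall fun y => ?_) hg.abs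
      (Filter.Eventually.of_forall fun y => ?_)
    · exact norm_indicator_le_norm_self g y
    · refine tendsto_const_nhds.congr' ?_
      filter_upwards [Filter.eventually_ge_atTop ‖y‖] with r hr
      rw [Set.indicator_of_notMem]
      exact not_lt.2 hr
  simpa only [integral_zero, integral_indicator (hm _)] using h

theorem setIntegral_absMeasure {n : ℕ} {f : E n → ℝ} (hf : Continuous f) (g : E n → ℝ)
    {T : Set (E n)} (hT : MeasurableSet T) :
    ∫ y in T, g y ∂absMeasure f = ∫ y in T, |f y| * g y :=
  setIntegral_withDensity_eq_setIntegral_smul hf.nnnorm.measurable g hT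

theorem exists_setLIntegral_norm_sub_inv_le {n : ℕ} (hn : 1 < n) {B : Set (E n)}
    (hB : IsCompact B) : ∃ A : ℝ, 0 ≤ A ∧
      ∀ z, ∫⁻ x in B, ENNReal.ofReal (‖x - z‖⁻¹) ≤ ENNReal.ofReal A := by
  have hBm := hB.measurableSet
  have hi : Integrable (B.indicator fun _ => (1 : ℝ)) :=
    (integrable_indicator_iff hBm).2 (integrableOn_const hB.measure_lt_top.ne)
  have hpot := fun z : E n => integrable_div_norm_pow hn hi (x := z) (M := 1) fun y _ => by
    by_cases hy : y ∈ B <;> simp [hy]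
  refine ⟨1 * ballMoment n 1 + ∫ y, |B.indicator (fun _ => (1 : ℝ)) y|,
    add_nonneg (mul_nonneg zero_le_one (ballMoment_nonneg _ _))
      (integral_nonneg fun _ => abs_nonneg _), fun z => ?_⟩
  have h2 : ∫⁻ x in B, ENNReal.ofReal (‖x - z‖⁻¹)
      = ∫⁻ x, ENNReal.ofReal (|B.indicator (fun _ => (1 : ℝ)) x| / ‖z - x‖ ^ 1) := by
    rw [← lintegral_indicator hBm]
    refine lintegral_congr fun x => ?_
    by_cases hx : x ∈ B
    · simp [hx, norm_sub_rev]
    · simp [hx]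
  rw [h2, ← ofReal_integral_eq_lintegral_ofReal (hpot z).1
    (Filter.Eventually.of_forall fun x => div_nonneg (abs_nonneg _) (pow_nonneg (norm_nonneg _) _))]
  exact ENNReal.ofReal_le_ofReal (hpot z).2

/-- Exponential integrability of a logarithmic potential on dilates of a fixed set. -/
theorem IsLogPotential.exists_exp_le {n : ℕ} (hn : 1 < n) {u f : E n → ℝ} (hu : ContDiff ℝ ∞ u)
    (h : IsLogPotential u f) (hf : Integrable f) (hc : Continuous f) {B : Set (E n)}
    (hBc : IsCompact B) (hB : ∀ x ∈ B, 1 < ‖x‖) (hB3 : ∀ x ∈ B, ‖x‖ ≤ 3) {δ : ℝ} (hδ : 0 < δ) :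
    ∃ C : ℝ, 0 < C ∧ ∀ᶠ R : ℝ in Filter.atTop,
      ∫ x in B, Real.exp (2 * |u (R • x) + (∫ y, f y) * Real.log R|) ≤ C * R ^ δ := by
  have hBm := hBc.measurableSet
  set α := ∫ y, f y with hα
  obtain ⟨A, hA0, hA⟩ := exists_setLIntegral_norm_sub_inv_le hn hBc
  -- The tail contributes 2ε log R to the potential, hence R^{4ε} after exponentiating twice it,
  -- whence δ/4. The bound 1/2 is the mass allowed in `exp_two_mul_integral_log_le`.
  set ε := min (δ / 4) (1 / 2) with hεdef
  have hε0 : 0 < ε := by positivity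
  have hεδ : 4 * ε ≤ δ := by linarith [min_le_left (δ / 4) (1 / 2 : ℝ)]
  obtain ⟨r, hr1, hr⟩ : ∃ r : ℝ, 1 ≤ r ∧ ∫ y in {y : E n | r < ‖y‖}, |f y| ≤ ε :=
    ((Filter.eventually_ge_atTop 1).and
      ((tendsto_setIntegral_norm_gt hf.abs).eventually (Iic_mem_nhds hε0))).exists
  obtain ⟨C0, hC0⟩ := h.abs_add_log_le hn hu hf hc hr1 hr
  set T := {y : E n | r < ‖y‖} with hT
  have hTm : MeasurableSet T := measurableSet_lt measurable_const measurable_norm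
  have := isFiniteMeasure_absMeasure hf
  set ν := (absMeasure f).restrict T with hν
  have hνm : ν.real Set.univ ≤ 1 / 2 := by
    have h1 := setIntegral_absMeasure hc (fun _ => (1 : ℝ)) hTm
    simp only [integral_const, mul_one, smul_eq_mul] at h1
    rw [hν, h1]
    exact hr.trans (min_le_right _ _)
  set P : ℝ → E n → ℝ := fun R x => ∫ y, Real.log (1 + ‖R • x‖ / ‖R • x - y‖) ∂ν with hP
  -- Jensen removes the exponential; Tonelli then leaves integrals of ‖x - z‖⁻¹ over `B`, which are
  -- bounded uniformly in z = y/R.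
  have hPbound : ∀ R : ℝ, 0 < R → ∫⁻ x in B, ENNReal.ofReal (Real.exp (2 * P R x))
      ≤ ENNReal.ofReal (volume.real B + 3 * A) := by
    intro R hR
    have hm : Measurable fun p : E n × E n =>
        ENNReal.ofReal (‖R • p.1‖ / ‖R • p.1 - p.2‖) := by fun_prop
    have hinner : ∀ y, ∫⁻ x in B, ENNReal.ofReal (‖R • x‖ / ‖R • x - y‖)
        ≤ ENNReal.ofReal (3 * A) := by
      intro y
      calc ∫⁻ x in B, ENNReal.ofReal (‖R • x‖ / ‖R • x - y‖)
          ≤ ∫⁻ x in B, ENNReal.ofReal 3 * ENNReal.ofReal (‖x - R⁻¹ • y‖⁻¹) := by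
            refine setLIntegral_mono (by fun_prop) fun x hx => ?_
            rw [← ENNReal.ofReal_mul (by norm_num)]
            refine ENNReal.ofReal_le_ofReal ?_
            have e : R • x - y = R • (x - R⁻¹ • y) := by
              rw [smul_sub, smul_smul, mul_inv_cancel₀ hR.ne', one_smul]
            rw [e, norm_smul, norm_smul, mul_div_mul_left _ _ (norm_ne_zero_iff.2 hR.ne'),
              div_eq_mul_inv]
            exact mul_le_mul_of_nonneg_right (hB3 x hx) (by positivity)
        _ = ENNReal.ofReal 3 * ∫⁻ x in B, ENNReal.ofReal (‖x - R⁻¹ • y‖⁻¹) :=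
            lintegral_const_mul _ (by fun_prop)
        _ ≤ ENNReal.ofReal 3 * ENNReal.ofReal A := by gcongr; exact hA _
        _ = _ := (ENNReal.ofReal_mul (by norm_num)).symm
    calc ∫⁻ x in B, ENNReal.ofReal (Real.exp (2 * P R x))
        ≤ ∫⁻ x in B, (1 + 2 * ∫⁻ y, ENNReal.ofReal (‖R • x‖ / ‖R • x - y‖) ∂ν) := by
          refine lintegral_mono fun x => ?_
          exact exp_two_mul_integral_log_le ν hνm (by fun_prop) fun y => by positivity
      _ = volume B + 2 * ∫⁻ y, (∫⁻ x in B, ENNReal.ofReal (‖R • x‖ / ‖R • x - y‖)) ∂ν := by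
          rw [lintegral_add_left measurable_const, lintegral_const_mul _ hm.lintegral_prod_right',
            lintegral_lintegral_swap hm.aemeasurable]
          simp
      _ ≤ volume B + 2 * ∫⁻ _, ENNReal.ofReal (3 * A) ∂ν := by
          gcongr
          exact hinner _
      _ ≤ ENNReal.ofReal (volume.real B) + 2 * (ENNReal.ofReal (3 * A) * ENNReal.ofReal (1 / 2)) := by
          rw [lintegral_const, Measure.real, ENNReal.ofReal_toReal hBc.measure_lt_top.ne]
          gcongr
          rw [← ENNReal.ofReal_toReal (measure_ne_top ν Set.univ)]
          exact ENNReal.ofReal_le_ofReal hνm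
      _ = _ := by
          have h2 (b : ℝ) : 2 * ENNReal.ofReal b = ENNReal.ofReal (2 * b) := by
            rw [ENNReal.ofReal_mul zero_le_two, ENNReal.ofReal_ofNat]
          rw [ENNReal.ofReal_add measureReal_nonneg (by positivity),
            ← ENNReal.ofReal_mul (by positivity), h2]
          congr 2
          ring
  set c := C0 + 2 * ε * Real.log 3 + |α| * Real.log 3 with hcdef
  have hv0 : 0 ≤ volume.real B := ENNReal.toReal_nonneg
  refine ⟨Real.exp (2 * c) * (volume.real B + 3 * A + 1), by positivity, ?_⟩
  filter_upwards [Filter.eventually_ge_atTop (2 * r)] with R hR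
  have hR1 : 1 ≤ R := by linarith
  have hR0 : 0 < R := by linarith
  have hlR : 0 ≤ Real.log R := Real.log_nonneg hR1
  have hpt : ∀ x ∈ B, Real.exp (2 * |u (R • x) + α * Real.log R|)
      ≤ Real.exp (2 * c) * R ^ δ * Real.exp (2 * P R x) := by
    intro x hx
    have hx1 := hB x hx
    have hx0 : 0 < ‖x‖ := by linarith
    have hn1 : ‖R • x‖ = R * ‖x‖ := by rw [norm_smul, Real.norm_of_nonneg hR0.le]
    have h1 := hC0 (R • x) (by rw [hn1]; nlinarith)
    rw [← setIntegral_absMeasure hc _ hTm] at h1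
    have h2 : Real.log ‖R • x‖ = Real.log R + Real.log ‖x‖ := by
      rw [hn1, Real.log_mul hR0.ne' hx0.ne']
    have h3 : 0 ≤ Real.log ‖x‖ := Real.log_nonneg hx1.le
    have h4 : Real.log ‖x‖ ≤ Real.log 3 := Real.log_le_log hx0 (hB3 x hx)
    have h5 : |u (R • x) + α * Real.log R| ≤ c + 2 * ε * Real.log R + P R x := by
      have e : u (R • x) + α * Real.log R
          = (u (R • x) + α * Real.log ‖R • x‖) - α * Real.log ‖x‖ := by rw [h2]; ring
      rw [e]
      refine (abs_sub _ _).trans ?_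
      rw [abs_mul, abs_of_nonneg h3]
      have h6 : |α| * Real.log ‖x‖ ≤ |α| * Real.log 3 := by gcongr
      have h7 : 2 * ε * Real.log ‖R • x‖ ≤ 2 * ε * (Real.log R + Real.log 3) := by
        rw [h2]; gcongr
      change _ ≤ C0 + 2 * ε * Real.log ‖R • x‖ + P R x at h1
      linarith
    have h8 : R ^ δ = Real.exp (δ * Real.log R) := by
      rw [Real.rpow_def_of_pos hR0, mul_comm]
    rw [h8, ← Real.exp_add, ← Real.exp_add]
    refine Real.exp_le_exp.2 ?_
    have h9 : 4 * ε * Real.log R ≤ δ * Real.log R := by gcongr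
    linarith
  have hcont : Continuous fun x : E n => Real.exp (2 * |u (R • x) + α * Real.log R|) := by
    have := hu.continuous
    fun_prop
  rw [integral_eq_lintegral_of_nonneg_ae (Filter.Eventually.of_forall fun x => (Real.exp_pos _).le)
    hcont.aestronglyMeasurable]
  have hK : 0 ≤ Real.exp (2 * c) * R ^ δ := by positivity
  refine ENNReal.toReal_le_of_le_ofReal (by positivity) ?_
  calc ∫⁻ x in B, ENNReal.ofReal (Real.exp (2 * |u (R • x) + α * Real.log R|))
      ≤ ∫⁻ x in B, ENNReal.ofReal (Real.exp (2 * c) * R ^ δ)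
          * ENNReal.ofReal (Real.exp (2 * P R x)) := by
        refine setLIntegral_mono' hBm fun x hx => ?_
        rw [← ENNReal.ofReal_mul hK]
        exact ENNReal.ofReal_le_ofReal (hpt x hx)
    _ = ENNReal.ofReal (Real.exp (2 * c) * R ^ δ)
          * ∫⁻ x in B, ENNReal.ofReal (Real.exp (2 * P R x)) :=
        lintegral_const_mul' _ _ ENNReal.ofReal_ne_top
    _ ≤ ENNReal.ofReal (Real.exp (2 * c) * R ^ δ) * ENNReal.ofReal (volume.real B + 3 * A) := by
        gcongr
        exact hPbound R hR0
    _ = ENNReal.ofReal (Real.exp (2 * c) * R ^ δ * (volume.real B + 3 * A)) :=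
        (ENNReal.ofReal_mul hK).symm
    _ ≤ _ := by
        refine ENNReal.ofReal_le_ofReal ?_
        have : Real.exp (2 * c) * R ^ δ * (volume.real B + 3 * A)
            ≤ Real.exp (2 * c) * R ^ δ * (volume.real B + 3 * A + 1) :=
          mul_le_mul_of_nonneg_left (by linarith) hK
        linarith

/-! ### Quantization of the total curvature. -/

theorem eventually_forall_smul {n : ℕ} {p : E n → Prop} (hp : ∀ᶠ x in Filter.cocompact (E n), p x)
    {B : Set (E n)} (hB : ∀ x ∈ B, 1 < ‖x‖) :
    ∀ᶠ R : ℝ in Filter.atTop, ∀ x ∈ B, p (R • x) := by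
  obtain ⟨K, hK, hKs⟩ := Filter.mem_cocompact.1 hp
  obtain ⟨ρ, hρ⟩ := hK.isBounded.exists_norm_le
  filter_upwards [Filter.eventually_ge_atTop (max ρ 1)] with R hR x hx
  refine hKs fun hxK => ?_
  have h1 := hρ _ hxK
  have hR1 : 1 ≤ R := (le_max_right _ _).trans hR
  have hR2 : ρ ≤ R := (le_max_left _ _).trans hR
  rw [norm_smul, Real.norm_of_nonneg (by linarith)] at h1
  nlinarith [hB x hx]

theorem exists_annular_cutoff {n : ℕ} (hn : 0 < n) :
    ∃ (B : Set (E n)) (φ : E n → ℝ), IsCompact B ∧ (∀ x ∈ B, 1 < ‖x‖) ∧ (∀ x ∈ B, ‖x‖ ≤ 3) ∧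
      ContDiff ℝ ∞ φ ∧ (∀ x, x ∉ B → φ x = 0) ∧ (∀ x, 0 ≤ φ x) ∧ (∀ x, φ x ≤ 1) ∧
      0 < volume.real B ∧ 0 < ∫ x in B, φ x * (‖x‖ ^ 2)⁻¹ := by
  obtain ⟨c, hc⟩ : ∃ c : E n, ‖c‖ = 2 :=
    ⟨EuclideanSpace.single ⟨0, hn⟩ 2, by simp⟩
  let φ : ContDiffBump c := ⟨1 / 4, 1 / 2, by norm_num, by norm_num⟩
  have hdist : ∀ x ∈ Metric.closedBall c (1 / 2), 1 < ‖x‖ ∧ ‖x‖ ≤ 3 := by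
    intro x hx
    rw [mem_closedBall_iff_norm] at hx
    have h1 := norm_sub_norm_le x c
    have h2 := norm_sub_norm_le c x
    rw [norm_sub_rev] at h2
    constructor <;> linarith
  have h0 : ∀ x, x ∉ Metric.closedBall c (1 / 2) → φ x = 0 := by
    intro x hx
    rw [Metric.mem_closedBall, not_le] at hx
    exact φ.zero_of_le_dist hx.le
  have hcont : ContinuousOn (fun x : E n => φ x * (‖x‖ ^ 2)⁻¹) (Metric.closedBall c (1 / 2)) := by
    refine φ.continuous.continuousOn.mul (ContinuousOn.inv₀ (by fun_prop) fun x hx => ?_)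
    have := (hdist x hx).1
    positivity
  have hint : IntegrableOn (fun x : E n => φ x * (‖x‖ ^ 2)⁻¹) (Metric.closedBall c (1 / 2)) :=
    hcont.integrableOn_compact (isCompact_closedBall _ _)
  refine ⟨Metric.closedBall c (1 / 2), φ, isCompact_closedBall _ _, fun x hx => (hdist x hx).1,
    fun x hx => (hdist x hx).2, φ.contDiff, h0, fun x => φ.nonneg, fun x => φ.le_one, ?_, ?_⟩
  · exact ENNReal.toReal_pos (Metric.measure_closedBall_pos volume c (by norm_num)).ne'
      (isCompact_closedBall _ _).measure_lt_top.ne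
  · rw [setIntegral_pos_iff_support_of_nonneg_ae _ hint]
    · refine (Metric.measure_ball_pos volume c (r := 1 / 2) (by norm_num)).trans_le
        (measure_mono fun x hx => ⟨?_, Metric.ball_subset_closedBall hx⟩)
      have h1 := (hdist x (Metric.ball_subset_closedBall hx)).1
      have h2 : 0 < φ x := φ.pos_of_mem_ball hx
      have : 0 < φ x * (‖x‖ ^ 2)⁻¹ := by positivity
      exact this.ne'
    · exact Filter.Eventually.of_forall fun x => mul_nonneg φ.nonneg (by positivity)

theorem setIntegral_mono_compact {n : ℕ} {B : Set (E n)} (hB : IsCompact B) {f g : E n → ℝ}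
    (hf : Continuous f) (hg : Continuous g) (h : ∀ x ∈ B, f x ≤ g x) :
    ∫ x in B, f x ≤ ∫ x in B, g x :=
  setIntegral_mono_on (hf.continuousOn.integrableOn_compact hB)
    (hg.continuousOn.integrableOn_compact hB) hB.measurableSet h

/-- `R_g e^{2u} / (2(n-1))`, in terms of `u`. -/
noncomputable def scalarDensity {n : ℕ} (u : E n → ℝ) (x : E n) : ℝ :=
  -Laplacian.laplacian u x - ((n : ℝ) - 2) / 2 * ‖gradient u x‖ ^ 2

theorem continuous_scalarDensity {n : ℕ} {u : E n → ℝ} (hu : ContDiff ℝ ∞ u) :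
    Continuous (scalarDensity u) := by
  have h1 : Continuous (Laplacian.laplacian u) := (contDiff_laplacian hu).continuous
  have h2 : Continuous (gradient u) := continuous_gradient hu
  unfold scalarDensity
  fun_prop

/-- Nonnegative curvature near infinity makes the limit in `tendsto_energy` nonnegative, so α - α²/2
≥ 0. -/
theorem IsLogPotential.total_mem_Icc {n : ℕ} (hn : 2 < n) {u f : E n → ℝ} (hu : ContDiff ℝ ∞ u)
    (h : IsLogPotential u f) (hf : Integrable f) (hc : Continuous f)
    (hS : ∀ᶠ x in Filter.cocompact (E n), 0 ≤ scalarDensity u x) :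
    0 ≤ ∫ y, f y ∧ ∫ y, f y ≤ 2 := by
  obtain ⟨B, φ, hBc, hB, hB3, hφ, h0, hφ0, hφ1, -, hI⟩ := exists_annular_cutoff (n := n) (by omega)
  have hT := h.tendsto_energy hn hu hf hc hBc hB hB3 hφ h0 hφ0 hφ1
  have hn' : (0 : ℝ) < (n : ℝ) - 2 := by
    have : (2 : ℝ) < n := by exact_mod_cast hn
    linarith
  have hlim : 0 ≤ ((n : ℝ) - 2) * ((∫ y, f y) - (∫ y, f y) ^ 2 / 2) *
      ∫ x in B, φ x * (‖x‖ ^ 2)⁻¹ := by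
    refine ge_of_tendsto hT ?_
    filter_upwards [eventually_forall_smul hS hB] with R hR
    exact setIntegral_nonneg hBc.measurableSet fun x hx =>
      mul_nonneg (hφ0 x) (mul_nonneg (sq_nonneg R) (hR x hx))
  have h2 : 0 ≤ (∫ y, f y) - (∫ y, f y) ^ 2 / 2 :=
    nonneg_of_mul_nonneg_right (nonneg_of_mul_nonneg_left hlim hI) hn'
  constructor <;> nlinarith

/-- Lower bound for the scaled mean of `e^{2u}` in the subcritical range. -/
theorem IsLogPotential.exists_le_integral_exp {n : ℕ} (hn : 2 < n) {u f : E n → ℝ}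
    (hu : ContDiff ℝ ∞ u) (h : IsLogPotential u f) (hf : Integrable f) (hc : Continuous f)
    {C : ℝ} (hS : ∀ᶠ x in Filter.cocompact (E n), scalarDensity u x ≤ C * Real.exp (2 * u x))
    {B : Set (E n)} (hBc : IsCompact B) (hB : ∀ x ∈ B, 1 < ‖x‖) (hB3 : ∀ x ∈ B, ‖x‖ ≤ 3)
    {φ : E n → ℝ} (hφ : ContDiff ℝ ∞ φ) (h0 : ∀ x, x ∉ B → φ x = 0) (hφ0 : ∀ x, 0 ≤ φ x)
    (hφ1 : ∀ x, φ x ≤ 1) (hI : 0 < ∫ x in B, φ x * (‖x‖ ^ 2)⁻¹)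
    (hα0 : 0 < ∫ y, f y) (hα2 : ∫ y, f y < 2) :
    ∃ c : ℝ, 0 < c ∧ ∀ᶠ R : ℝ in Filter.atTop, c ≤ ∫ x in B, R ^ 2 * Real.exp (2 * u (R • x)) := by
  have hT := h.tendsto_energy hn hu hf hc hBc hB hB3 hφ h0 hφ0 hφ1
  have hn' : (0 : ℝ) < (n : ℝ) - 2 := by
    have : (2 : ℝ) < n := by exact_mod_cast hn
    linarith
  have hL : 0 < ((n : ℝ) - 2) * ((∫ y, f y) - (∫ y, f y) ^ 2 / 2) *
      ∫ x in B, φ x * (‖x‖ ^ 2)⁻¹ :=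
    mul_pos (mul_pos hn' (by nlinarith)) hI
  set L := ((n : ℝ) - 2) * ((∫ y, f y) - (∫ y, f y) ^ 2 / 2) * ∫ x in B, φ x * (‖x‖ ^ 2)⁻¹
  -- `C` need not be positive; enlarging it to at least 1 permits division.
  have hM : 0 < max C 1 := lt_max_of_lt_right one_pos
  refine ⟨L / 2 / max C 1, by positivity, ?_⟩
  filter_upwards [hT.eventually (lt_mem_nhds (half_lt_self hL)), eventually_forall_smul hS hB]
    with R h1 h2
  rw [div_le_iff₀ hM, mul_comm, ← integral_const_mul]
  refine h1.le.trans (setIntegral_mono_compact hBc ?_ ?_ fun x hx => ?_)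
  · have h3 : Continuous fun x : E n => scalarDensity u (R • x) :=
      (continuous_scalarDensity hu).comp (continuous_const_smul R)
    exact hφ.continuous.mul (continuous_const.mul h3)
  · have := hu.continuous
    fun_prop
  · have h3 : scalarDensity u (R • x) ≤ max C 1 * Real.exp (2 * u (R • x)) :=
      (h2 x hx).trans (by gcongr; exact le_max_left _ _)
    have h4 : 0 ≤ R ^ 2 * (max C 1 * Real.exp (2 * u (R • x))) := by positivity
    calc φ x * (R ^ 2 * scalarDensity u (R • x))
        ≤ φ x * (R ^ 2 * (max C 1 * Real.exp (2 * u (R • x)))) :=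
          mul_le_mul_of_nonneg_left (mul_le_mul_of_nonneg_left h3 (sq_nonneg R)) (hφ0 x)
      _ ≤ 1 * (R ^ 2 * (max C 1 * Real.exp (2 * u (R • x)))) :=
          mul_le_mul_of_nonneg_right (hφ1 x) h4
      _ = _ := by ring

/-- With α = 0 the curvature limit vanishes and gives no information. Instead, `exists_exp_le` with
δ = 1 bounds the integral of e^{-2u(Rx)} by CR, and Cauchy–Schwarz in the form |B|² ≤ ∫e^{2u}
∫e^{-2u} leaves a lower bound of order R² · R⁻¹. -/
theorem IsLogPotential.exists_le_integral_exp_of_total_eq_zero {n : ℕ} (hn : 1 < n)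
    {u f : E n → ℝ} (hu : ContDiff ℝ ∞ u) (h : IsLogPotential u f) (hf : Integrable f)
    (hc : Continuous f) {B : Set (E n)} (hBc : IsCompact B) (hB : ∀ x ∈ B, 1 < ‖x‖)
    (hB3 : ∀ x ∈ B, ‖x‖ ≤ 3) (hv : 0 < volume.real B) (hα : ∫ y, f y = 0) :
    ∃ c : ℝ, 0 < c ∧ ∀ᶠ R : ℝ in Filter.atTop, c ≤ ∫ x in B, R ^ 2 * Real.exp (2 * u (R • x)) := by
  obtain ⟨C, hC0, hC⟩ := h.exists_exp_le hn hu hf hc hBc hB hB3 one_pos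
  refine ⟨volume.real B ^ 2 / C, by positivity, ?_⟩
  filter_upwards [hC, Filter.eventually_ge_atTop 1] with R hR hR1
  have hR0 : 0 < R := by linarith
  simp only [hα, zero_mul, add_zero, Real.rpow_one] at hR
  have hucont := hu.continuous
  set s := volume.real B / (C * R) with hs
  have hs0 : 0 < s := by positivity
  -- Linearised Cauchy–Schwarz, obtained from (s e^{-2w} - 1)² e^{2w} ≥ 0. The value s = |B|/(CR)
  -- maximises the resulting bound.
  have hpt : ∀ w : ℝ, 2 * s - s ^ 2 * Real.exp (2 * |w|) ≤ Real.exp (2 * w) := by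
    intro w
    have h1 : Real.exp (-(2 * w)) ≤ Real.exp (2 * |w|) :=
      Real.exp_le_exp.2 (by linarith [neg_abs_le w])
    have h2 : Real.exp (2 * w) * Real.exp (-(2 * w)) = 1 := by
      rw [← Real.exp_add]; simp
    have h3 := Real.exp_pos (-(2 * w))
    have h4 : s ^ 2 * Real.exp (-(2 * w)) ≤ s ^ 2 * Real.exp (2 * |w|) := by gcongr
    have h5 : 0 ≤ (s * Real.exp (-(2 * w)) - 1) ^ 2 * Real.exp (2 * w) := by positivity
    have h6 : (s * Real.exp (-(2 * w)) - 1) ^ 2 * Real.exp (2 * w)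
        = s ^ 2 * Real.exp (-(2 * w)) * (Real.exp (2 * w) * Real.exp (-(2 * w)))
          - 2 * s * (Real.exp (2 * w) * Real.exp (-(2 * w))) + Real.exp (2 * w) := by ring
    rw [h2] at h6
    linarith
  have h1 : ∫ x in B, (2 * s - s ^ 2 * Real.exp (2 * |u (R • x)|))
      ≤ ∫ x in B, Real.exp (2 * u (R • x)) :=
    setIntegral_mono_compact hBc (by fun_prop) (by fun_prop) fun x _ => hpt _
  have hi : IntegrableOn (fun x : E n => s ^ 2 * Real.exp (2 * |u (R • x)|)) B :=
    (by fun_prop : Continuous fun x : E n => s ^ 2 * Real.exp (2 * |u (R • x)|)).continuousOn.integrableOn_compact hBc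
  have hi' : IntegrableOn (fun _ : E n => 2 * s) B :=
    integrableOn_const hBc.measure_lt_top.ne
  rw [integral_sub hi' hi, setIntegral_const, integral_const_mul, smul_eq_mul] at h1
  have h2 : s ^ 2 * ∫ x in B, Real.exp (2 * |u (R • x)|) ≤ s ^ 2 * (C * R) := by gcongr
  have h3 : volume.real B * (2 * s) - s ^ 2 * (C * R) = volume.real B ^ 2 / C / R := by
    rw [hs]; field_simp; ring
  rw [integral_const_mul]
  calc volume.real B ^ 2 / C ≤ volume.real B ^ 2 / C * R := le_mul_of_one_le_right (by positivity) hR1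
    _ = R ^ 2 * (volume.real B ^ 2 / C / R) := by field_simp
    _ ≤ _ := by
      refine mul_le_mul_of_nonneg_left ?_ (sq_nonneg R)
      linarith

/-- The integrand is at most R^{2-2α} e^{2|u(Rx) + α log R|}. Taking δ = α - 1 in `exists_exp_le`
leaves the total power R^{1-α}. -/
theorem IsLogPotential.tendsto_integral_exp {n : ℕ} (hn : 1 < n) {u f : E n → ℝ}
    (hu : ContDiff ℝ ∞ u) (h : IsLogPotential u f) (hf : Integrable f) (hc : Continuous f)
    {B : Set (E n)} (hBc : IsCompact B) (hB : ∀ x ∈ B, 1 < ‖x‖) (hB3 : ∀ x ∈ B, ‖x‖ ≤ 3)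
    (hα : 1 < ∫ y, f y) :
    Filter.Tendsto (fun R : ℝ => ∫ x in B, R ^ 2 * Real.exp (2 * u (R • x)))
      Filter.atTop (nhds 0) := by
  have hδ : 0 < (∫ y, f y) - 1 := by linarith
  obtain ⟨C, hC0, hC⟩ := h.exists_exp_le hn hu hf hc hBc hB hB3 hδ
  set α := ∫ y, f y
  have hlim : Filter.Tendsto (fun R : ℝ => C * R ^ (-(α - 1))) Filter.atTop (nhds 0) := by
    simpa using (tendsto_rpow_neg_atTop hδ).const_mul C
  refine squeeze_zero' (Filter.Eventually.of_forall fun R => by positivity) ?_ hlim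
  filter_upwards [hC, Filter.eventually_gt_atTop 0] with R hR hR0
  have hucont := hu.continuous
  have h1 : ∫ x in B, R ^ 2 * Real.exp (2 * u (R • x))
      ≤ ∫ x in B, R ^ (2 - 2 * α) * Real.exp (2 * |u (R • x) + α * Real.log R|) := by
    refine setIntegral_mono_compact hBc (by fun_prop) (by fun_prop) fun x _ => ?_
    rw [← Real.rpow_natCast, Real.rpow_def_of_pos hR0, Real.rpow_def_of_pos hR0,
      ← Real.exp_add, ← Real.exp_add]
    refine Real.exp_le_exp.2 ?_
    push_cast
    linarith [le_abs_self (u (R • x) + α * Real.log R)]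
  rw [integral_const_mul (R ^ (2 - 2 * α))] at h1
  refine h1.trans ((mul_le_mul_of_nonneg_left hR (Real.rpow_nonneg hR0.le _)).trans_eq ?_)
  rw [mul_left_comm, ← Real.rpow_add hR0]
  congr 2
  ring

open scoped Pointwise in
-- The volume of R·B is the integral over `B` of the m-th power of R²e^{2u(Rx)}, which the mean
-- bounds from below. As R·B lies outside the ball of radius R, this contradicts vanishing of the
-- tail of a convergent integral.
theorem not_integrable_exp_of_le_integral {m n : ℕ} (hn : n = 2 * m) (hm : 0 < m) {u : E n → ℝ}
    (hu : Continuous u) {B : Set (E n)} (hBc : IsCompact B) (hB : ∀ x ∈ B, 1 < ‖x‖)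
    (hv : 0 < volume.real B) {c : ℝ} (hc : 0 < c)
    (h : ∀ᶠ R : ℝ in Filter.atTop, c ≤ ∫ x in B, R ^ 2 * Real.exp (2 * u (R • x))) :
    ¬ Integrable fun x => Real.exp (n * u x) := by
  intro hi
  -- Half of the guaranteed mean of s = R²e^{2u(Rx)} over `B`. The linear bound sᵐ ≥ ηᵐ⁻¹(s - η) for
  -- s > 0 then integrates to at least ηᵐ⁻¹c/2.
  set η := c / (2 * volume.real B) with hη
  have hη0 : 0 < η := by positivity
  have hc' : 0 < η ^ (m - 1) * (c / 2) := by positivity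
  obtain ⟨R, ⟨hR, hR0⟩, hR2⟩ := ((h.and (Filter.eventually_gt_atTop 0)).and
    ((tendsto_setIntegral_norm_gt hi).eventually (gt_mem_nhds hc'))).exists
  refine hR2.not_ge ?_
  have h1 : ∫ y in R • B, Real.exp (n * u y) ≤ ∫ y in {y : E n | R < ‖y‖}, Real.exp (n * u y) := by
    refine setIntegral_mono_set hi.integrableOn
      (Filter.Eventually.of_forall fun y => (Real.exp_pos _).le)
      (LE.le.eventuallyLE ?_)
    rintro _ ⟨x, hx, rfl⟩
    have := hB x hx
    simp only [Set.mem_ofPred_eq, norm_smul, Real.norm_of_nonneg hR0.le]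
    nlinarith
  have h2 := Measure.setIntegral_comp_smul_of_pos volume (fun y : E n => Real.exp (n * u y)) B hR0
  rw [finrank_euclideanSpace_fin, smul_eq_mul] at h2
  have h3 : ∫ y in R • B, Real.exp (n * u y) = ∫ x in B, R ^ n * Real.exp (n * u (R • x)) := by
    rw [integral_const_mul, h2, mul_inv_cancel_left₀ (by positivity)]
  refine le_trans ?_ h1
  rw [h3]
  have hpt : ∀ x ∈ B, η ^ (m - 1) * (R ^ 2 * Real.exp (2 * u (R • x)) - η)
      ≤ R ^ n * Real.exp (n * u (R • x)) := by
    intro x _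
    have e : R ^ n * Real.exp (n * u (R • x)) = (R ^ 2 * Real.exp (2 * u (R • x))) ^ m := by
      have hnm : (n : ℝ) = 2 * m := by exact_mod_cast hn
      rw [mul_pow, ← pow_mul, ← Real.exp_nat_mul, ← hn, hnm]
      congr 2
      ring
    rw [e]
    have hs0 : 0 < R ^ 2 * Real.exp (2 * u (R • x)) := by positivity
    set s := R ^ 2 * Real.exp (2 * u (R • x))
    rcases le_total s η with hsη | hsη
    · exact (mul_nonpos_of_nonneg_of_nonpos (by positivity) (by linarith)).trans (by positivity)
    · obtain ⟨j, rfl⟩ := Nat.exists_eq_add_of_lt hm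
      rw [show 0 + j + 1 - 1 = j by omega, show 0 + j + 1 = j + 1 by omega, pow_succ]
      gcongr
      linarith
  have hcs : Continuous fun x : E n => R ^ 2 * Real.exp (2 * u (R • x)) := by fun_prop
  refine le_trans ?_ (setIntegral_mono_compact hBc (by fun_prop) (by fun_prop) hpt)
  have hi1 : IntegrableOn (fun x : E n => R ^ 2 * Real.exp (2 * u (R • x))) B :=
    hcs.continuousOn.integrableOn_compact hBc
  have hi2 : IntegrableOn (fun _ : E n => η) B := integrableOn_const hBc.measure_lt_top.ne
  rw [integral_const_mul, integral_sub hi1 hi2, setIntegral_const, smul_eq_mul]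
  have h4 : volume.real B * η = c / 2 := by rw [hη]; field_simp
  rw [h4]
  gcongr
  linarith

/-- The quantization of the normalised total Q-curvature `∫ f` of a logarithmic potential. -/
theorem IsLogPotential.total_quantization {m n : ℕ} (hn : n = 2 * m) (hm : 2 ≤ m) {u f : E n → ℝ}
    (hu : ContDiff ℝ ∞ u) (h : IsLogPotential u f) (hf : Integrable f) (hc : Continuous f) {C : ℝ}
    (hS : ∀ᶠ x in Filter.cocompact (E n),
      0 ≤ scalarDensity u x ∧ scalarDensity u x ≤ C * Real.exp (2 * u x)) :
    ((0 ≤ ∫ y, f y ∧ ∫ y, f y ≤ 1) ∨ ∫ y, f y = 2) ∧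
      (Integrable (fun x => Real.exp (n * u x)) → ∫ y, f y = 2) := by
  obtain ⟨B, φ, hBc, hB, hB3, hφ, h0, hφ0, hφ1, hv, hI⟩ :=
    exists_annular_cutoff (n := n) (by omega)
  obtain ⟨hα0, hα2⟩ := h.total_mem_Icc (by omega) hu hf hc (hS.mono fun x hx => hx.1)
  -- For every α other than 2 the mean of R²e^{2u(Rx)} stays away from 0; both conclusions
  -- contradict this bound.
  have hlow : ∫ y, f y ≠ 2 → ∃ c : ℝ, 0 < c ∧ ∀ᶠ R : ℝ in Filter.atTop,
      c ≤ ∫ x in B, R ^ 2 * Real.exp (2 * u (R • x)) := by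
    intro h2
    rcases hα0.eq_or_lt with h1 | h1
    · exact h.exists_le_integral_exp_of_total_eq_zero (by omega) hu hf hc hBc hB hB3 hv h1.symm
    · exact h.exists_le_integral_exp (by omega) hu hf hc (hS.mono fun x hx => hx.2) hBc hB hB3
        hφ h0 hφ0 hφ1 hI h1 (lt_of_le_of_ne hα2 h2)
  constructor
  · by_contra! hcon
    obtain ⟨c, hc0, hcR⟩ := hlow hcon.2
    have := ge_of_tendsto
      (h.tendsto_integral_exp (by omega) hu hf hc hBc hB hB3 (hcon.1 hα0)) hcR
    linarith
  · intro hi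
    by_contra h2
    obtain ⟨c, hc0, hcR⟩ := hlow h2
    exact not_integrable_exp_of_le_integral hn (by omega) hu.continuous hBc hB hv hc0 hcR hi

/-! ### Return to Q-curvature and scalar curvature. -/

theorem negLaplacianPow_eq {n : ℕ} (m : ℕ) {u : E n → ℝ} (hu : ContDiff ℝ ∞ u) (x : E n) :
    negLaplacianPow m u x = (-1) ^ m * (Laplacian.laplacian^[m] u) x := by
  unfold negLaplacianPow
  induction m generalizing x with
  | zero => simp
  | succ m ih =>
    rw [Function.iterate_succ_apply', Function.iterate_succ_apply', funext ih]
    have h := InnerProductSpace.laplacian_smul (𝕜 := ℝ) (x := x) ((-1 : ℝ) ^ m)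
      (((contDiff_iterate_laplacian m hu).of_le (by norm_cast)).contDiffAt (x := x))
    change -(Laplacian.laplacian ((-1 : ℝ) ^ m • Laplacian.laplacian^[m] u) x) = _
    rw [h, smul_eq_mul, pow_succ]
    ring

theorem scalarCurvature_mul_exp {n : ℕ} {u : E n → ℝ} (hu : ContDiff ℝ ∞ u) (x : E n) :
    scalarCurvature (conformalMetric u) x * Real.exp (2 * u x)
      = 2 * ((n : ℝ) - 1) * scalarDensity u x := by
  rw [scalarCurvature_conformalMetric hu, sum_partialDeriv_sq, scalarDensity]
  ring

end ConformalQ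

open ConformalQ in
theorem mainTheorem5 (n : ℕ) (hn : 4 ≤ n) (hne : Even n)
    (u : EuclideanSpace ℝ (Fin n) → ℝ) (hu : ContDiff ℝ ∞ u)
    (hQ : Integrable (fun x => ConformalQ.qCurvature u x * Real.exp (n * u x)) volume)
    (C : ℝ)
    (hR : ∀ᶠ x in Filter.cocompact (EuclideanSpace ℝ (Fin n)),
      0 ≤ ConformalQ.scalarCurvature (ConformalQ.conformalMetric u) x ∧
        ConformalQ.scalarCurvature (ConformalQ.conformalMetric u) x ≤ C) :
    ((0 ≤ (∫ x, ConformalQ.qCurvature u x * Real.exp (n * u x)) ∧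
        (∫ x, ConformalQ.qCurvature u x * Real.exp (n * u x))
          ≤ ((n - 1).factorial : ℝ) * ConformalQ.sphereVolume n / 2) ∨
      (∫ x, ConformalQ.qCurvature u x * Real.exp (n * u x))
        = ((n - 1).factorial : ℝ) * ConformalQ.sphereVolume n) ∧
    (Integrable (fun x => Real.exp (n * u x)) volume →
      (∫ x, ConformalQ.qCurvature u x * Real.exp (n * u x))
        = ((n - 1).factorial : ℝ) * ConformalQ.sphereVolume n) := by
  obtain ⟨k, hk⟩ : ∃ k, n = 2 * (k + 2) := by
    obtain ⟨j, hj⟩ := hne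
    exact ⟨j - 2, by omega⟩
  have hn4 : (4 : ℝ) ≤ n := by exact_mod_cast hn
  have hγ : 0 < critConst n := hk ▸ critConst_pos k
  have hγe : ((n - 1).factorial : ℝ) * sphereVolume n = critConst n * 2 := by
    rw [critConst]; ring
  set F : E n → ℝ := Laplacian.laplacian^[k + 2] u with hF
  have hFc : Continuous F := (contDiff_iterate_laplacian (k + 2) hu).continuous
  have hq : (fun x => qCurvature u x * Real.exp (n * u x)) = fun x => (-1) ^ k * F x := by
    funext x
    have hh : n / 2 = k + 2 := by omega
    rw [qCurvature, hh, negLaplacianPow_eq _ hu, mul_right_comm, ← Real.exp_add]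
    simp [pow_add, hF]
  have hFi : Integrable F := by
    rw [hq] at hQ
    refine (hQ.const_mul ((-1) ^ k)).congr (Filter.Eventually.of_forall fun x => ?_)
    change (-1 : ℝ) ^ k * ((-1) ^ k * F x) = F x
    rw [← mul_assoc, ← mul_pow]
    simp
  have hS : ∀ᶠ x in Filter.cocompact (E n), 0 ≤ scalarDensity u x ∧
      scalarDensity u x ≤ C / (2 * ((n : ℝ) - 1)) * Real.exp (2 * u x) := by
    filter_upwards [hR] with x hx
    have h1 := scalarCurvature_mul_exp hu x
    have h2 : 0 < 2 * ((n : ℝ) - 1) := by linarith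
    have h3 : scalarDensity u x = scalarCurvature (conformalMetric u) x * Real.exp (2 * u x)
        / (2 * ((n : ℝ) - 1)) := by
      rw [h1, mul_div_cancel_left₀ _ h2.ne']
    rw [h3]
    refine ⟨div_nonneg (mul_nonneg hx.1 (Real.exp_pos _).le) h2.le, ?_⟩
    rw [div_mul_eq_mul_div]
    gcongr
    exact hx.2
  -- Here n ≥ 4 enters: (n-2)/2 ≥ 1, so nonnegative scalar curvature implies |∇u|² + Δu ≤ 0 near
  -- infinity.
  obtain ⟨A, hA⟩ := integral_norm_gradient_le (by omega) hu (hS.mono fun x hx => by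
    have h1 := hx.1
    unfold scalarDensity at h1
    nlinarith [mul_nonneg (by linarith : (0 : ℝ) ≤ (n : ℝ) - 4) (sq_nonneg ‖gradient u x‖)])
  -- Normalised so that total mass 2 corresponds to (n-1)!|𝕊ⁿ|.
  set f : E n → ℝ := fun x => (critConst n)⁻¹ * ((-1) ^ k * F x) with hf
  have hlog : IsLogPotential u f := by
    intro i x
    have h1 := critConst_mul_partialDeriv hk hu hFi hA i x
    rw [← mul_right_inj' hγ.ne', h1, ← integral_const_mul]
    congr 1
    funext y
    simp only [hf, hF]
    field_simp
  have hfi : Integrable f := (hFi.const_mul _).const_mul _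
  have hfc : Continuous f := by fun_prop
  have key := hlog.total_quantization hk (by omega) hu hfi hfc hS
  have htot : ∫ x, qCurvature u x * Real.exp (n * u x) = critConst n * ∫ y, f y := by
    rw [hq, hf, integral_const_mul (critConst n)⁻¹, mul_inv_cancel_left₀ hγ.ne']
  rw [htot, hγe]
  have hhalf : critConst n * 2 / 2 = critConst n * 1 := by ring
  rw [hhalf, mul_right_inj' hγ.ne', mul_le_mul_iff_right₀ hγ, mul_nonneg_iff_of_pos_left hγ]
  exact key
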